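/- Let $\mathscr D$ be a triangulated category, $\mathscr D_1\subset\mathscr D$ a left admissible full triangulated subcategory (the inclusion has a left adjoint $i_1^*$), and $\mathscr D_2:={}^{\perp}\mathscr D_1$, whose inclusion has a right adjoint $i_2^!$. Let $\Lambda_1,\Lambda_2$ be lattices of finite rank, $v_i\colon K(\mathscr D_i)\twoheadrightarrow\Lambda_i$ surjective homomorphisms, $\Lambda=\Lambda_1\oplus\Lambda_2$, and $v=v_1\oplus v_2\colon K(\mathscr D)\cong K(\mathscr D_1)\oplus K(\mathscr D_2)\to\Lambda$, i.e. $v[X]=(v_1[i_1^*X],v_2[i_2^!X])$. Fix norms on $\Lambda_{\mathbb R}$ and $(\Lambda_2)_{\mathbb R}$. A stability condition on a triangulated category with respect to such data is a pair $(Z,\mathscr P)$ of a homomorphism $Z$ from the lattice to $\mathbb C$ and a slicing $\mathscr P$ such that $Z(v(E))\in\mathbb R_{>0}\,e^{i\pi\phi}$ for $0\neq E\in\mathscr P(\phi)$, and such that the support property holds: $\|v(E)\|\le C|Z(v(E))|$ for some $C>0$ and all nonzero $E$ in some $\mathscr P(\phi)$. For full subcategories $\mathscr B_i\subset\mathscr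 D_i$ put $$\langle\mathscr B_2,\mathscr B_1\rangle:=\{X\in\mathscr D\mid i_1^*X\in\mathscr B_1,\ i_2^!X\in\mathscr B_2\}.$$ A relative stability condition on $\mathscr D$ with respect to $\mathscr D_1$ is a pair $(Z,\mathscr P_1)$ of a homomorphism $Z\colon\Lambda\to\mathbb C$ and a slicing $\mathscr P_1$ of $\mathscr D_1$ for which there is a stability condition $(Z,\mathscr P)$ on $\mathscr D$ such that * $\mathscr P_1(\phi)\subset\mathscr P(\phi)$ for all $\phi\in\mathbb R$, and $(Z|_{\Lambda_2},\mathscr P_2)$ with $\mathscr P_2(\phi):=\mathscr P(\phi)\cap\mathscr D_2$ is a stability condition on $\mathscr D_2$; * there are $0<\epsilon<\delta<1$ such that $\langle\mathscr B_2,\mathscr B_1\rangle$ is the heart of a bounded t-structure on $\mathscr D$ for all hearts $\mathscr B_i\subset\mathscr P_i((\delta-\epsilon,1+\delta+\epsilon))$ of bounded t-structures on $\mathscr D_i$, $i=1,2$. **Proposition.** The assignment $(Z,\mathscr P_1)\mapsto(Z,\mathscr P_1((0,1]))$ is a bijection from the set of relative stability conditions on $\mathscr D$ with respect to $\mathscr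 D_1$ onto the set of pairs $(Z,\mathscr A_1)$ of a homomorphism $Z\colon\Lambda\to\mathbb C$ and the heart $\mathscr A_1$ of a bounded t-structure on $\mathscr D_1$ for which there is a heart $\mathscr A\supset\mathscr A_1$ of a bounded t-structure on $\mathscr D$ such that 1. (a) $Z\circ v$ is a stability function on $\mathscr A$ (it maps nonzero objects into $\{me^{i\pi\phi}\mid m>0,\ 0<\phi\le1\}$) with the Harder–Narasimhan property and the support property ($\|v(E)\|\le C|Z(v(E))|$ for some $C>0$ and all $Z$-semistable $E\in\mathscr A$); (b) $\mathscr A_2:=\mathscr A\cap\mathscr D_2$ is the heart of a bounded t-structure on $\mathscr D_2$, and every $Z|_{\Lambda_2}$-semistable object of $\mathscr A_2$ is $Z$-semistable in $\mathscr A$; 2. there are $0<\epsilon<\delta<1$ such that $\langle\mathscr B_2,\mathscr B_1\rangle$ is the heart of a bounded t-structure on $\mathscr D$ for all hearts $\mathscr B_i\subset\mathscr A_i(\epsilon,\delta)$ of bounded t-structures on $\mathscr D_i$, $i=1,2$. Here $\mathscr A_i(\epsilon,\delta)$ is the extension-closed subcategory of $\mathscr D_i$ generated by the $Z|_{\Lambda_i}$-semistable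 objects of $\mathscr A_i$ of phase in $(\delta-\epsilon,1]$ and by the shifts $F[1]$ of the $Z|_{\Lambda_i}$-semistable objects $F$ of $\mathscr A_i$ of phase in $(0,\delta+\epsilon)$. Moreover, if $(Z,\mathscr P_1)$ is a relative stability condition and $\mathscr A_1=\mathscr P_1((0,1])$, then for $\phi\in(0,1]$ the category $\mathscr P_1(\phi)$ consists of the zero objects and the $Z|_{\Lambda_1}$-semistable objects of $\mathscr A_1$ of phase $\phi$. -/

import Mathlib

open CategoryTheory CategoryTheory.Limits CategoryTheory.Pretriangulated
open CategoryTheory.Triangulated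
open scoped TensorProduct

universe u v u' v'

namespace RelStab

noncomputable section

/-! ### Stability functions, semistable objects and Harder-Narasimhan filtrations -/

/-- The strict upper half-plane `{m exp(iπφ) | m > 0, φ ∈ (0,1]}`. -/
def upperHalf : Set ℂ :=
  {z | ∃ m φ : ℝ, 0 < m ∧ 0 < φ ∧ φ ≤ 1 ∧ z = m * Complex.exp (Real.pi * φ * Complex.I)}

/-- The phase `φ ∈ (0,1]` of `m exp(iπφ)` in the strict upper half-plane. -/
def phase (z : ℂ) : ℝ := Complex.arg z / Real.pi

section Abelian

variable {A : Type u} [Category.{v} A] [Preadditive A]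

/-- Nonzero objects have charge in the strict upper half-plane. The function `W` will always be
the restriction to objects of a homomorphism defined on a Grothendieck group, so that additivity
on short exact sequences is automatic. -/
def IsStabilityFunction (W : A → ℂ) : Prop :=
  ∀ E : A, ¬ IsZero E → W E ∈ upperHalf

/-- A nonzero object all of whose nonzero subobjects have phase at most its own. -/
def IsSemistable (W : A → ℂ) (E : A) : Prop :=
  ¬ IsZero E ∧ ∀ ⦃F : A⦄ (f : F ⟶ E), Mono f → ¬ IsZero F → phase (W F) ≤ phase (W E)

/-- A chain of subobjects `0 = E₀ ⊂ E₁ ⊂ ⋯ ⊂ Eₙ = E` with semistable factors of strictly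
decreasing phases. -/
structure HNChain (W : A → ℂ) (E : A) where
  n : ℕ
  obj : Fin (n + 1) → A
  fac : Fin n → A
  incl (i : Fin n) : obj i.castSucc ⟶ obj i.succ
  proj (i : Fin n) : obj i.succ ⟶ fac i
  incl_proj (i : Fin n) : incl i ≫ proj i = 0
  shortExact (i : Fin n) : (ShortComplex.mk (incl i) (proj i) (incl_proj i)).ShortExact
  bot : IsZero (obj 0)
  top : obj (Fin.last n) ≅ E
  semistable (i : Fin n) : IsSemistable W (fac i)
  strictAnti : StrictAnti fun i => phase (W (fac i))

/-- The Harder-Narasimhan property. -/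
def HasHN (W : A → ℂ) : Prop := ∀ E : A, ¬ IsZero E → Nonempty (HNChain W E)

end Abelian

/-! ### Grothendieck group, hearts and slicings of a triangulated category -/

section Triangulated

variable (C : Type u) [Category.{v} C] [Preadditive C] [HasZeroObject C] [HasShift C ℤ]
  [∀ n : ℤ, (shiftFunctor C n).Additive] [Pretriangulated C]

/-- The relations `[Y] = [X] + [Z]`, one for each distinguished triangle `X ⟶ Y ⟶ Z ⟶ X⟦1⟧`. -/
def K0Rel : AddSubgroup (FreeAbelianGroup C) :=
  AddSubgroup.closure {x | ∃ T : Triangle C, T ∈ distTriang C ∧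
    x = FreeAbelianGroup.of T.obj₂ - (FreeAbelianGroup.of T.obj₁ + FreeAbelianGroup.of T.obj₃)}

/-- The Grothendieck group `K(C)` of a triangulated category. -/
def K0 : Type u := FreeAbelianGroup C ⧸ K0Rel C

instance : AddCommGroup (K0 C) := inferInstanceAs (AddCommGroup (FreeAbelianGroup C ⧸ K0Rel C))

variable {C}

/-- The class of an object in the Grothendieck group. -/
def K0.of (X : C) : K0 C := QuotientAddGroup.mk' (K0Rel C) (FreeAbelianGroup.of X)

lemma K0.of_triangle (T : Triangle C) (hT : T ∈ distTriang C) :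
    K0.of T.obj₂ = K0.of T.obj₁ + K0.of T.obj₃ := by
  have h : FreeAbelianGroup.of T.obj₂ -
      (FreeAbelianGroup.of T.obj₁ + FreeAbelianGroup.of T.obj₃) ∈ K0Rel C :=
    AddSubgroup.subset_closure ⟨T, hT, rfl⟩
  have h' := (QuotientAddGroup.eq_zero_iff (N := K0Rel C) _).2 h
  exact sub_eq_zero.1 h'

/-- A function on objects which is additive on distinguished triangles factors through `K(C)`. -/
def K0.lift {G : Type*} [AddCommGroup G] (f : C → G)
    (hf : ∀ T : Triangle C, T ∈ distTriang C → f T.obj₂ = f T.obj₁ + f T.obj₃) : K0 C →+ G :=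
  QuotientAddGroup.lift (K0Rel C) (FreeAbelianGroup.lift f) (by
    refine (AddSubgroup.closure_le _).2 ?_
    rintro _ ⟨T, hT, rfl⟩
    simp [hf T hT])

@[simp]
lemma K0.lift_of {G : Type*} [AddCommGroup G] (f : C → G)
    (hf : ∀ T : Triangle C, T ∈ distTriang C → f T.obj₂ = f T.obj₁ + f T.obj₃) (X : C) :
    K0.lift f hf (K0.of X) = f X := by
  change FreeAbelianGroup.lift f (FreeAbelianGroup.of X) = f X
  simp

/-- The homomorphism of Grothendieck groups induced by a triangulated functor. -/
def K0.map {D : Type u'} [Category.{v'} D] [Preadditive D] [HasZeroObject D] [HasShift D ℤ]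
    [∀ n : ℤ, (shiftFunctor D n).Additive] [Pretriangulated D]
    (F : C ⥤ D) [F.CommShift ℤ] [F.IsTriangulated] : K0 C →+ K0 D :=
  K0.lift (fun X => K0.of (F.obj X))
    (fun T hT => K0.of_triangle (F.mapTriangle.obj T) (F.map_distinguished T hT))

/-- `A` is the heart of a bounded t-structure on `C`. -/
def IsBoundedHeart (A : ObjectProperty C) : Prop :=
  ∃ t : TStructure C, (∀ X : C, t.bounded X) ∧ t.heart = A

/-- The extension-closed subcategory generated by `S`. (It is closed under isomorphisms, because
`X ⟶ Y ⟶ 0 ⟶ X⟦1⟧` is a distinguished triangle for an isomorphism `X ⟶ Y`.) -/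
inductive ExtClosure (S : ObjectProperty C) : ObjectProperty C
  | zero (X : C) (hX : IsZero X) : ExtClosure S X
  | of (X : C) (hX : S X) : ExtClosure S X
  | ext (T : Triangle C) (hT : T ∈ distTriang C) (h₁ : ExtClosure S T.obj₁)
      (h₃ : ExtClosure S T.obj₃) : ExtClosure S T.obj₂

/-- A Harder-Narasimhan filtration of `E` with respect to a family `P` of full subcategories: a
sequence of distinguished triangles `Eᵢ ⟶ Eᵢ₊₁ ⟶ Aᵢ ⟶ Eᵢ⟦1⟧` with `E₀ = 0`, `Eₙ = E` and nonzero
factors `Aᵢ ∈ P(φᵢ)` of strictly decreasing phases. -/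
structure HNFiltration (P : ℝ → ObjectProperty C) (E : C) where
  n : ℕ
  obj : Fin (n + 1) → C
  fac : Fin n → C
  φ : Fin n → ℝ
  incl (i : Fin n) : obj i.castSucc ⟶ obj i.succ
  proj (i : Fin n) : obj i.succ ⟶ fac i
  conn (i : Fin n) : fac i ⟶ (obj i.castSucc)⟦(1 : ℤ)⟧
  distinguished (i : Fin n) : Triangle.mk (incl i) (proj i) (conn i) ∈ distTriang C
  bot : IsZero (obj 0)
  top : obj (Fin.last n) ≅ E
  mem (i : Fin n) : P (φ i) (fac i)
  ne_zero (i : Fin n) : ¬ IsZero (fac i)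
  strictAnti : StrictAnti φ

variable (C) in
/-- A slicing of a triangulated category. -/
structure Slicing where
  /-- the full additive subcategory `P(φ)` -/
  obj : ℝ → ObjectProperty C
  iso_mem (φ : ℝ) {X Y : C} (e : X ≅ Y) (hX : obj φ X) : obj φ Y
  zero_mem (φ : ℝ) {X : C} (hX : IsZero X) : obj φ X
  biprod_mem (φ : ℝ) {X Y : C} (b : BinaryBicone X Y) (hb : Nonempty b.IsBilimit)
    (hX : obj φ X) (hY : obj φ Y) : obj φ b.pt
  shift_iff (φ : ℝ) (X : C) : obj (φ + 1) (X⟦(1 : ℤ)⟧) ↔ obj φ X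
  hom_eq_zero {φ₁ φ₂ : ℝ} (h : φ₂ < φ₁) {X Y : C} (hX : obj φ₁ X) (hY : obj φ₂ Y)
    (f : X ⟶ Y) : f = 0
  exists_hn (E : C) (hE : ¬ IsZero E) : Nonempty (HNFiltration obj E)

/-- The subcategory `P(I)`, for an interval `I`, of the zero objects and the objects all of whose
Harder-Narasimhan phases (equivalently, the largest and the smallest one) lie in `I`. -/
def Slicing.interval (P : Slicing C) (I : Set ℝ) : ObjectProperty C :=
  fun E => IsZero E ∨ ∃ F : HNFiltration P.obj E, ∀ i, F.φ i ∈ I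

/-! ### Stability conditions -/

/-- A norm on the real vector space `Λ_ℝ`. -/
structure LatticeNorm (Λ : Type*) [AddCommGroup Λ] extends Seminorm ℝ (ℝ ⊗[ℤ] Λ) where
  eq_zero (x : ℝ ⊗[ℤ] Λ) (hx : toFun x = 0) : x = 0

/-- The norm in `Λ_ℝ` of a lattice element. -/
def LatticeNorm.norm {Λ : Type*} [AddCommGroup Λ] (N : LatticeNorm Λ) (x : Λ) : ℝ :=
  N.toSeminorm ((1 : ℝ) ⊗ₜ[ℤ] x)

variable {Λ : Type*} [AddCommGroup Λ]

/-- Pre-stability condition: `Z(v(E)) = m(E) exp(iπφ)` with `m(E) > 0` for `0 ≠ E ∈ P(φ)`. -/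
def IsPreStability (v : K0 C →+ Λ) (Z : Λ →+ ℂ) (P : Slicing C) : Prop :=
  ∀ (φ : ℝ) (E : C), P.obj φ E → ¬ IsZero E →
    ∃ m : ℝ, 0 < m ∧ Z (v (K0.of E)) = m * Complex.exp (Real.pi * φ * Complex.I)

/-- The support property: `‖v(E)‖ ≤ c |Z(v(E))|` for all `0 ≠ E` in the class `S`
of semistable objects. -/
def SupportProperty (v : K0 C →+ Λ) (N : LatticeNorm Λ) (Z : Λ →+ ℂ) (S : C → Prop) : Prop :=
  ∃ c : ℝ, 0 < c ∧ ∀ E : C, S E → ¬ IsZero E → N.norm (v (K0.of E)) ≤ c * ‖Z (v (K0.of E))‖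

/-- `(Z, P)` is a Bridgeland stability condition on `C` with respect to `(Λ, v)`. -/
def IsStability (v : K0 C →+ Λ) (N : LatticeNorm Λ) (Z : Λ →+ ℂ) (P : Slicing C) : Prop :=
  IsPreStability v Z P ∧ SupportProperty v N Z (fun E => ∃ φ : ℝ, P.obj φ E)

/-- The function induced on the objects of a full subcategory (a heart) by `Z ∘ v`. -/
def charge (v : K0 C →+ Λ) (Z : Λ →+ ℂ) (A : ObjectProperty C) : A.FullSubcategory → ℂ :=
  fun E => Z (v (K0.of E.obj))

/-- `E` lies in the heart `A` and is semistable in `A` for `Z ∘ v`. -/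
def SemistableIn (v : K0 C →+ Λ) (Z : Λ →+ ℂ) (A : ObjectProperty C) (E : C) : Prop :=
  ∃ h : A E, IsSemistable (charge v Z A) ⟨E, h⟩

/-- The subcategory `A(ε, δ)`: the extension-closed subcategory generated by the semistable
objects of `A` of phase in `(δ - ε, 1]` and the shifts `F⟦1⟧` of the semistable
objects `F` of `A` of phase in `(0, δ + ε)`. -/
def tiltRange (v : K0 C →+ Λ) (Z : Λ →+ ℂ) (A : ObjectProperty C) (ε δ : ℝ) :
    ObjectProperty C :=
  ExtClosure fun E =>
    (SemistableIn v Z A E ∧ phase (Z (v (K0.of E))) ∈ Set.Ioc (δ - ε) 1) ∨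
    (SemistableIn v Z A (E⟦(-1 : ℤ)⟧) ∧
      phase (Z (v (K0.of (E⟦(-1 : ℤ)⟧)))) ∈ Set.Ioo 0 (δ + ε))

end Triangulated

/-! ### The semiorthogonal decomposition of a left admissible subcategory -/

section Relative

variable {D : Type u} [Category.{v} D] [Preadditive D] [HasZeroObject D] [HasShift D ℤ]
  [∀ n : ℤ, (shiftFunctor D n).Additive] [Pretriangulated D]
  (D₁ : ObjectProperty D) [D₁.IsTriangulated]

/-- A full triangulated subcategory is left admissible if its inclusion has a left adjoint. -/
abbrev LeftAdmissible : Prop := D₁.ι.IsRightAdjoint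

/-- `D₂ := ⊥D₁`, the left orthogonal. Since `D₁` is stable under shifts, this
is `{E | Hom(E, D₁⟦n⟧) = 0 for all n}`. -/
abbrev orth : ObjectProperty D := D₁.leftOrthogonal

lemma orth_of_universal {X L K : D} (η : X ⟶ L)
    (hex : ∀ Y : D, D₁ Y → ∀ u : X ⟶ Y, ∃ w : L ⟶ Y, η ≫ w = u)
    (huniq : ∀ Y : D, D₁ Y → ∀ w : L ⟶ Y, η ≫ w = 0 → w = 0)
    (k : K ⟶ X) (h : L ⟶ K⟦(1 : ℤ)⟧) (hT : Triangle.mk k η h ∈ distTriang D) : orth D₁ K := by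
  intro Y f hY
  have e₁ : k ≫ η = 0 := comp_distTriang_mor_zero₁₂ _ hT
  have e₂ : η ≫ h = 0 := comp_distTriang_mor_zero₂₃ _ hT
  have h₁ : h ≫ f⟦(1 : ℤ)⟧' = 0 :=
    huniq _ (D₁.le_shift 1 _ hY) _ (by rw [reassoc_of% e₂, zero_comp])
  obtain ⟨u, hu⟩ : ∃ u : X⟦(1 : ℤ)⟧ ⟶ Y⟦(1 : ℤ)⟧, f⟦(1 : ℤ)⟧' = (-k⟦(1 : ℤ)⟧') ≫ u :=
    Triangle.yoneda_exact₃ _ (rot_of_distTriang _ hT) (f⟦(1 : ℤ)⟧') h₁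
  obtain ⟨u', rfl⟩ := (shiftFunctor D (1 : ℤ)).map_surjective u
  have hf : f = -(k ≫ u') := by
    apply (shiftFunctor D (1 : ℤ)).map_injective
    rw [hu, Functor.map_neg, Functor.map_comp, Preadditive.neg_comp]
  obtain ⟨w, rfl⟩ := hex Y hY u'
  rw [hf, reassoc_of% e₁, zero_comp, neg_zero]

variable [LeftAdmissible D₁]

/-- The left adjoint `i₁^*` of the inclusion of `D₁`. -/
def proj₁ : D ⥤ D₁.FullSubcategory := D₁.ι.leftAdjoint

/-- The adjunction between `i₁^*` and the inclusion of `D₁`. -/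
def adj₁ : proj₁ D₁ ⊣ D₁.ι := Adjunction.ofIsRightAdjoint D₁.ι

instance : (proj₁ D₁).CommShift ℤ := (adj₁ D₁).leftAdjointCommShift ℤ

instance : (adj₁ D₁).CommShift ℤ := (adj₁ D₁).commShift_of_rightAdjoint ℤ

instance : (proj₁ D₁).IsTriangulated := (adj₁ D₁).isTriangulated_leftAdjoint

lemma exists_unit_triangle (X : D) : ∃ (K L : D) (_ : orth D₁ K) (_ : D₁ L) (k : K ⟶ X)
    (η : X ⟶ L) (h : L ⟶ K⟦(1 : ℤ)⟧), Triangle.mk k η h ∈ distTriang D := by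
  let η : X ⟶ ((proj₁ D₁).obj X).obj := (adj₁ D₁).unit.app X
  obtain ⟨K, k, h, hT⟩ := distinguished_cocone_triangle₁ η
  have key (Y : D) (hY : D₁ Y) (w : (proj₁ D₁).obj X ⟶ ⟨Y, hY⟩) :
      (adj₁ D₁).homEquiv X ⟨Y, hY⟩ w = η ≫ w.hom := Adjunction.homEquiv_unit _ _ _ _
  refine ⟨K, _, orth_of_universal D₁ η (fun Y hY u => ?_) (fun Y hY w hw => ?_) k h hT,
    ((proj₁ D₁).obj X).property, k, η, h, hT⟩
  · obtain ⟨w, hw⟩ := ((adj₁ D₁).homEquiv X ⟨Y, hY⟩).surjective u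
    exact ⟨w.hom, by rw [← key Y hY, hw]⟩
  · let w' : (proj₁ D₁).obj X ⟶ ⟨Y, hY⟩ := ⟨w⟩
    have h0 : w' = 0 := by
      apply ((adj₁ D₁).homEquiv X ⟨Y, hY⟩).injective
      rw [key, key]
      exact hw.trans comp_zero.symm
    exact congrArg (fun t => t.hom) h0

instance : (orth D₁).ι.IsLeftAdjoint := by
  have : ∀ X : D, HasTerminal (CostructuredArrow (orth D₁).ι X) := fun X => by
    obtain ⟨K, L, hK, hL, k, η, h, hT⟩ := exists_unit_triangle D₁ X
    have hz : ∀ (Z : (orth D₁).FullSubcategory) (f : Z.obj ⟶ K), f ≫ k = 0 → f = 0 := by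
      intro Z f hf
      obtain ⟨g, hg⟩ := Triangle.coyoneda_exact₂ _ (inv_rot_of_distTriang _ hT) f hf
      have h0 : g = 0 := Z.property g (D₁.le_shift (-1) _ hL)
      rw [hg, h0]
      exact zero_comp
    have hl : ∀ Z : CostructuredArrow (orth D₁).ι X, ∃ f : Z.left.obj ⟶ K, f ≫ k = Z.hom := by
      intro Z
      obtain ⟨g, hg⟩ := Triangle.coyoneda_exact₂ _ hT Z.hom
        (Z.left.property _ hL)
      exact ⟨g, hg.symm⟩
    choose l hl using hl
    refine IsTerminal.hasTerminal (X := CostructuredArrow.mk (S := (orth D₁).ι)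
      (Y := (⟨K, hK⟩ : (orth D₁).FullSubcategory)) k) (IsTerminal.ofUniqueHom
        (fun Z => CostructuredArrow.homMk ((orth D₁).fullyFaithfulι.preimage (l Z)) ?_) ?_)
    · exact hl Z
    · intro Z m
      ext
      have hm : m.left.hom ≫ k = Z.hom := CostructuredArrow.w m
      let m' : Z.left.obj ⟶ K := m.left.hom
      have := hz Z.left (m' - l Z) (by rw [Preadditive.sub_comp, hl, sub_eq_zero]; exact hm)
      exact sub_eq_zero.1 this
  exact isLeftAdjoint_of_costructuredArrowTerminals _

/-- The right adjoint `i₂^!` of the inclusion of `D₂`. -/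
def proj₂ : D ⥤ (orth D₁).FullSubcategory := (orth D₁).ι.rightAdjoint

/-- The adjunction between the inclusion of `D₂` and `i₂^!`. -/
def adj₂ : (orth D₁).ι ⊣ proj₂ D₁ := Adjunction.ofIsLeftAdjoint (orth D₁).ι

instance : (proj₂ D₁).CommShift ℤ := (adj₂ D₁).rightAdjointCommShift ℤ

instance : (adj₂ D₁).CommShift ℤ := (adj₂ D₁).commShift_of_leftAdjoint ℤ

instance : (proj₂ D₁).IsTriangulated := (adj₂ D₁).isTriangulated_rightAdjoint

/-- The glued subcategory `⟨A₂, A₁⟩ = {X | i₁^* X ∈ A₁, i₂^! X ∈ A₂}`. -/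
def glue (A₁ : ObjectProperty D₁.FullSubcategory) (A₂ : ObjectProperty (orth D₁).FullSubcategory) :
    ObjectProperty D :=
  fun X => A₁ ((proj₁ D₁).obj X) ∧ A₂ ((proj₂ D₁).obj X)

/-- All hearts of bounded t-structures contained in `R₁` and `R₂` glue to the heart of a
bounded t-structure on `D`. -/
def HeartsGlue (R₁ : ObjectProperty D₁.FullSubcategory)
    (R₂ : ObjectProperty (orth D₁).FullSubcategory) : Prop :=
  ∀ (B₁ : ObjectProperty D₁.FullSubcategory) (B₂ : ObjectProperty (orth D₁).FullSubcategory),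
    IsBoundedHeart B₁ → IsBoundedHeart B₂ → B₁ ≤ R₁ → B₂ ≤ R₂ → IsBoundedHeart (glue D₁ B₁ B₂)

variable {D₁} {Λ₁ Λ₂ : Type*} [AddCommGroup Λ₁] [AddCommGroup Λ₂]
  (v₁ : K0 D₁.FullSubcategory →+ Λ₁) (v₂ : K0 (orth D₁).FullSubcategory →+ Λ₂)

/-- The homomorphism `v = v₁ ⊕ v₂ : K(D) → Λ₁ ⊕ Λ₂`, through the identification
`K(D) ≅ K(D₁) ⊕ K(D₂)`, `[X] ↦ ([i₁^* X], [i₂^! X])`. -/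
def sumClass : K0 D →+ Λ₁ × Λ₂ :=
  (v₁.comp (K0.map (proj₁ D₁))).prod (v₂.comp (K0.map (proj₂ D₁)))

/-- The restriction of `Z` to `Λ₁`. -/
def res₁ (Z : Λ₁ × Λ₂ →+ ℂ) : Λ₁ →+ ℂ := Z.comp (AddMonoidHom.inl Λ₁ Λ₂)

/-- The restriction of `Z` to `Λ₂`. -/
def res₂ (Z : Λ₁ × Λ₂ →+ ℂ) : Λ₂ →+ ℂ := Z.comp (AddMonoidHom.inr Λ₁ Λ₂)

/-- `(Z, P₁)` is a relative stability condition on `D` with respect to `D₁`. The slicing `P₂` is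
the restriction of `P` to `D₂`. -/
def IsRelStability (N : LatticeNorm (Λ₁ × Λ₂)) (N₂ : LatticeNorm Λ₂) (Z : Λ₁ × Λ₂ →+ ℂ)
    (P₁ : Slicing D₁.FullSubcategory) : Prop :=
  ∃ (P : Slicing D) (P₂ : Slicing (orth D₁).FullSubcategory),
    IsStability (sumClass v₁ v₂) N Z P ∧
    (∀ (φ : ℝ) (E : D₁.FullSubcategory), P₁.obj φ E → P.obj φ E.obj) ∧
    (∀ (φ : ℝ) (E : (orth D₁).FullSubcategory), P₂.obj φ E ↔ P.obj φ E.obj) ∧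
    IsStability v₂ N₂ (res₂ Z) P₂ ∧
    ∃ ε δ : ℝ, 0 < ε ∧ ε < δ ∧ δ < 1 ∧
      HeartsGlue D₁ (P₁.interval (Set.Ioo (δ - ε) (1 + δ + ε)))
        (P₂.interval (Set.Ioo (δ - ε) (1 + δ + ε)))

/-- The heart-theoretic data: `A₁` is the heart of a bounded t-structure on `D₁`, and there is a
heart `A ⊇ A₁` of a bounded t-structure on `D` such that
* `Z ∘ v` is a stability function on `A` with the Harder-Narasimhan and support properties;
* `A₂ = A ∩ D₂` is the heart of a bounded t-structure on `D₂`, and the semistable objects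
  of `A₂` are semistable in `A`;
* the hearts contained in `A₁(ε, δ)` and `A₂(ε, δ)` glue, for some `0 < ε < δ < 1`. -/
def IsHeartDatum (N : LatticeNorm (Λ₁ × Λ₂)) (Z : Λ₁ × Λ₂ →+ ℂ)
    (A₁ : ObjectProperty D₁.FullSubcategory) : Prop :=
  IsBoundedHeart A₁ ∧ ∃ A : ObjectProperty D, IsBoundedHeart A ∧
    (∀ E : D₁.FullSubcategory, A₁ E → A E.obj) ∧
    IsStabilityFunction (charge (sumClass v₁ v₂) Z A) ∧
    HasHN (charge (sumClass v₁ v₂) Z A) ∧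
    SupportProperty (sumClass v₁ v₂) N Z (SemistableIn (sumClass v₁ v₂) Z A) ∧
    IsBoundedHeart (A.inverseImage (orth D₁).ι) ∧
    (∀ E : (orth D₁).FullSubcategory,
      SemistableIn v₂ (res₂ Z) (A.inverseImage (orth D₁).ι) E →
        SemistableIn (sumClass v₁ v₂) Z A E.obj) ∧
    ∃ ε δ : ℝ, 0 < ε ∧ ε < δ ∧ δ < 1 ∧
      HeartsGlue D₁ (tiltRange v₁ (res₁ Z) A₁ ε δ)
        (tiltRange v₂ (res₂ Z) (A.inverseImage (orth D₁).ι) ε δ)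

end Relative

end

end RelStab

set_option linter.unusedSectionVars false

/-! A stability condition amounts to a heart with a stability function having the Harder–Narasimhan
property: the heart is `P((0,1])`, and `P φ` for `φ ∈ (0,1]` consists of its semistable objects of
phase `φ` and zero. This already gives injectivity, because `P₁` is determined by its phases in
`(0,1]`. From slicings to hearts one takes `A = P((0,1])`. Phases are detected by vanishing of
morphisms, so `A ∩ D₂ = P₂((0,1])`, and `Aᵢ(ε,δ) ⊆ Pᵢ((δ-ε,1+δ+ε))` transfers the gluing condition
(`IsRelStability.isHeartDatum`).

In the other direction, `A` gives a slicing `P` of `D`, but two facts are not part of the heart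
data.

The first is the existence of Harder–Narasimhan filtrations in `A₁` and `A₂`. The support property
of `A` bounds the classes of all subobjects of `E` in `A` whose phase is at least that of `E`.
Lattice points of bounded norm are finite in number, so only finitely many charges occur
(`finite_destabilizing`). The finiteness is inherited by `A₁` and `A₂`, and splitting off a maximal
destabilizing subobject lowers the number of charges (`filt_heartSlicing_aux`).

The second is `P₁ φ ⊆ P φ`, for which the gluing is needed. The hearts `Pᵢ((δ,δ+1])` glue to a
bounded heart inside `P((0,2])` whose charges lie in the half plane of `P((δ,δ+1])`, and this forces
it to equal `P((δ,δ+1])` (`IsSlicing.heart_eq`). Now let `E ∈ P₁ φ` with `φ ∈ (δ,δ+1]` and let `F`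
be its part of phase `> φ` in `P`. As `F` and `E/F` lie in the glued heart, the `D₂`-component of
`F` vanishes. So `F` comes from `D₁`, with `P₁`-phases at most `φ`; its charge would lie in two
opposite half planes unless `F = 0`. Then `E` has `P`-phases at most `φ` and charge on the ray of
`φ`, hence `E ∈ P φ` (`mem_of_glue`). -/

namespace RelStab

open scoped ZeroObject

/-! ### Extensions, Hom-vanishing and classes in the Grothendieck group -/

section Extension

variable {C : Type u} [Category.{v} C] [Preadditive C] [HasZeroObject C] [HasShift C ℤ]
  [∀ n : ℤ, (shiftFunctor C n).Additive] [Pretriangulated C]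

/-- `Y` is an extension of `Z` by `X`: there is a distinguished triangle `X ⟶ Y ⟶ Z ⟶ X⟦1⟧`. -/
def Tri (X Y Z : C) : Prop :=
  ∃ (f : X ⟶ Y) (g : Y ⟶ Z) (h : Z ⟶ X⟦(1 : ℤ)⟧), Triangle.mk f g h ∈ distTriang C

/-- Every morphism from `X` to `Y` vanishes. -/
def HomZero (X Y : C) : Prop := ∀ f : X ⟶ Y, f = 0

lemma Tri.of_mem (T : Triangle C) (hT : T ∈ distTriang C) : Tri T.obj₁ T.obj₂ T.obj₃ :=
  ⟨T.mor₁, T.mor₂, T.mor₃, hT⟩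

lemma Tri.rot {X Y Z : C} (h : Tri X Y Z) : Tri Y Z (X⟦(1 : ℤ)⟧) := by
  obtain ⟨f, g, k, hT⟩ := h
  exact .of_mem _ (rot_of_distTriang _ hT)

lemma Tri.invRot {X Y Z : C} (h : Tri X Y Z) : Tri (Z⟦(-1 : ℤ)⟧) X Y := by
  obtain ⟨f, g, k, hT⟩ := h
  exact .of_mem _ (inv_rot_of_distTriang _ hT)

lemma Tri.shift {X Y Z : C} (h : Tri X Y Z) (n : ℤ) : Tri (X⟦n⟧) (Y⟦n⟧) (Z⟦n⟧) := by
  obtain ⟨f, g, k, hT⟩ := h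
  exact .of_mem _ (Triangle.shift_distinguished _ hT n)

lemma Tri.iso {X Y Z X' Y' Z' : C} (h : Tri X Y Z) (e₁ : X ≅ X') (e₂ : Y ≅ Y') (e₃ : Z ≅ Z') :
    Tri X' Y' Z' := by
  obtain ⟨f, g, k, hT⟩ := h
  refine ⟨e₁.inv ≫ f ≫ e₂.hom, e₂.inv ≫ g ≫ e₃.hom, e₃.inv ≫ k ≫ e₁.hom⟦1⟧', ?_⟩
  refine isomorphic_distinguished _ hT _
    (Triangle.isoMk _ _ e₁.symm e₂.symm e₃.symm ?_ ?_ ?_)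
  · change (e₁.inv ≫ f ≫ e₂.hom) ≫ e₂.inv = e₁.inv ≫ f
    simp
  · change (e₂.inv ≫ g ≫ e₃.hom) ≫ e₃.inv = e₂.inv ≫ g
    simp
  · change (e₃.inv ≫ k ≫ e₁.hom⟦1⟧') ≫ e₁.inv⟦1⟧' = e₃.inv ≫ k
    simp [← Functor.map_comp]

lemma Tri.map {D : Type u'} [Category.{v'} D] [Preadditive D] [HasZeroObject D] [HasShift D ℤ]
    [∀ n : ℤ, (shiftFunctor D n).Additive] [Pretriangulated D]
    (F : C ⥤ D) [F.CommShift ℤ] [F.IsTriangulated] {X Y Z : C} (h : Tri X Y Z) :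
    Tri (F.obj X) (F.obj Y) (F.obj Z) := by
  obtain ⟨f, g, k, hT⟩ := h
  exact .of_mem _ (F.map_distinguished _ hT)

lemma tri_of_isZero_right {X Y Z : C} (e : X ≅ Y) (hZ : IsZero Z) : Tri X Y Z :=
  (Tri.of_mem _ (contractible_distinguished X)).iso (Iso.refl _) e ((isZero_zero C).iso hZ)

lemma tri_of_isZero_left {X Y Z : C} (hX : IsZero X) (e : Y ≅ Z) : Tri X Y Z :=
  (Tri.of_mem _ (contractible_distinguished₁ Y)).iso ((isZero_zero C).iso hX) (Iso.refl _) e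

lemma tri_biprod (X Y : C) : Tri X (X ⊞ Y) Y :=
  .of_mem _ (binaryBiproductTriangle_distinguished X Y)

lemma Tri.iso_of_isZero₃ {X Y Z : C} (h : Tri X Y Z) (hZ : IsZero Z) : Nonempty (X ≅ Y) := by
  obtain ⟨f, g, k, hT⟩ := h
  have : IsIso f := (Triangle.isZero₃_iff_isIso₁ _ hT).1 hZ
  exact ⟨asIso f⟩

lemma Tri.iso_of_isZero₁ {X Y Z : C} (h : Tri X Y Z) (hX : IsZero X) : Nonempty (Y ≅ Z) := by
  obtain ⟨f, g, k, hT⟩ := h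
  have : IsIso g := (Triangle.isZero₁_iff_isIso₂ _ hT).1 hX
  exact ⟨asIso g⟩

lemma Tri.isZero₂ {X Y Z : C} (h : Tri X Y Z) (hX : IsZero X) (hZ : IsZero Z) : IsZero Y :=
  let ⟨e⟩ := h.iso_of_isZero₁ hX
  hZ.of_iso e

/-- The class of an extension in the Grothendieck group. -/
lemma Tri.k0 {X Y Z : C} (h : Tri X Y Z) : K0.of Y = K0.of X + K0.of Z := by
  obtain ⟨f, g, k, hT⟩ := h
  exact K0.of_triangle _ hT

lemma K0.of_isZero {X : C} (h : IsZero X) : K0.of X = 0 := by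
  simpa using (tri_of_isZero_right (Iso.refl X) h).k0

lemma K0.of_iso {X Y : C} (e : X ≅ Y) : K0.of X = K0.of Y := by
  have h := (tri_of_isZero_right e (isZero_zero C)).k0
  rw [K0.of_isZero (isZero_zero C), add_zero] at h
  exact h.symm

lemma K0.of_shift_one (X : C) : K0.of (X⟦(1 : ℤ)⟧) = -K0.of X := by
  have h := (tri_of_isZero_right (Iso.refl X) (isZero_zero C)).rot.k0
  rw [K0.of_isZero (isZero_zero C)] at h
  exact (neg_eq_of_add_eq_zero_right h.symm).symm

lemma isZero_shift_iff (X : C) (n : ℤ) : IsZero (X⟦n⟧) ↔ IsZero X :=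
  ⟨fun h => ((shiftFunctor C (-n)).map_isZero h).of_iso ((shiftEquiv C n).unitIso.app X),
    fun h => (shiftFunctor C n).map_isZero h⟩

lemma HomZero.iso {X Y X' Y' : C} (h : HomZero X Y) (e : X ≅ X') (e' : Y ≅ Y') :
    HomZero X' Y' := fun f => by
  have := h (e.hom ≫ f ≫ e'.inv)
  rw [← cancel_epi e.hom, ← cancel_mono e'.inv]
  simpa using this

lemma HomZero.isZero {X : C} (h : HomZero X X) : IsZero X :=
  (IsZero.iff_id_eq_zero X).2 (h _)

lemma homZero_of_isZero_left {X : C} (h : IsZero X) (Y : C) : HomZero X Y :=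
  fun _ => h.eq_of_src _ _

lemma homZero_of_isZero_right (X : C) {Y : C} (h : IsZero Y) : HomZero X Y :=
  fun _ => h.eq_of_tgt _ _

lemma homZero_shift_iff (X Y : C) (n : ℤ) : HomZero (X⟦n⟧) (Y⟦n⟧) ↔ HomZero X Y := by
  refine ⟨fun h f => (shiftFunctor C n).map_injective ?_, fun h f => ?_⟩
  · rw [h (f⟦n⟧'), Functor.map_zero]
  · obtain ⟨g, rfl⟩ := (shiftFunctor C n).map_surjective f
    rw [h g, Functor.map_zero]

lemma Tri.homZero_left {X Y Z W : C} (h : Tri X Y Z) (hX : HomZero X W) (hZ : HomZero Z W) :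
    HomZero Y W := fun a => by
  obtain ⟨f, g, k, hT⟩ := h
  obtain ⟨b, rfl⟩ : ∃ b : Z ⟶ W, a = g ≫ b := Triangle.yoneda_exact₂ _ hT a (hX _)
  rw [hZ b, comp_zero]

lemma Tri.homZero_right {X Y Z W : C} (h : Tri X Y Z) (hX : HomZero W X) (hZ : HomZero W Z) :
    HomZero W Y := fun a => by
  obtain ⟨f, g, k, hT⟩ := h
  obtain ⟨b, rfl⟩ : ∃ b : W ⟶ X, a = b ≫ f := Triangle.coyoneda_exact₂ _ hT a (hZ _)
  rw [hX b, zero_comp]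

lemma Tri.isZero₃_of_homZero {X Y Z : C} (h : Tri X Y Z) (h₁ : HomZero Y Z)
    (h₂ : HomZero (X⟦(1 : ℤ)⟧) Z) : IsZero Z :=
  (h.rot.homZero_left h₁ h₂).isZero

lemma Tri.isZero₁_of_homZero {X Y Z : C} (h : Tri X Y Z) (h₁ : HomZero X Y)
    (h₂ : HomZero X (Z⟦(-1 : ℤ)⟧)) : IsZero X :=
  (h.invRot.homZero_right h₂ h₁).isZero

/-- Octahedral axiom: with `Z` regarded as `Y/X`, the object `W` is the preimage in `Y` of the
subobject `A` of `Z`. -/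
lemma Tri.assoc [IsTriangulated C] {X Y Z A B : C} (h : Tri X Y Z) (h' : Tri A Z B) :
    ∃ W, Tri X W A ∧ Tri W Y B := by
  obtain ⟨f, g, k, hT⟩ := h
  obtain ⟨f', g', k', hT'⟩ := h'
  obtain ⟨W, f'', h'', hT''⟩ := distinguished_cocone_triangle₁ (g ≫ g')
  let o := someOctahedron' rfl hT hT' hT''
  exact ⟨W, .of_mem _ o.mem, .of_mem _ hT''⟩

/-- Octahedral axiom: with `A` inside `X` inside `Y`, the object `W` is `Y/A`, an extension of `Y/X`
by `X/A`. -/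
lemma Tri.assoc' [IsTriangulated C] {X Y Z A B : C} (h : Tri X Y Z) (h' : Tri A X B) :
    ∃ W, Tri A Y W ∧ Tri B W Z := by
  obtain ⟨f, g, k, hT⟩ := h
  obtain ⟨f', g', k', hT'⟩ := h'
  obtain ⟨W, g'', h'', hT''⟩ := distinguished_cocone_triangle (f' ≫ f)
  let o := someOctahedron rfl hT' hT hT''
  exact ⟨W, .of_mem _ hT'', .of_mem _ o.mem⟩

end Extension

/-! ### Filtrations with decreasing phases, as an inductive predicate -/

section Filtration

variable {C : Type u} [Category.{v} C] [Preadditive C] [HasZeroObject C] [HasShift C ℤ]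
  [∀ n : ℤ, (shiftFunctor C n).Additive] [Pretriangulated C]

/-- `E` is an iterated extension of objects of `P φ`, `φ ∈ S`, in the order of strictly decreasing
phases. -/
inductive Filt (P : ℝ → ObjectProperty C) : Set ℝ → C → Prop
  | zero (S : Set ℝ) (E : C) (hE : IsZero E) : Filt P S E
  | step (S : Set ℝ) (φ : ℝ) (E₀ E A : C) (h : Tri E₀ E A) (hA : P φ A) (hφ : φ ∈ S)
      (h₀ : Filt P (S ∩ Set.Ioi φ) E₀) : Filt P S E

variable {P : ℝ → ObjectProperty C} {S S' : Set ℝ}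

lemma Filt.mono {E : C} (h : Filt P S E) (hS : S ⊆ S') : Filt P S' E := by
  induction h generalizing S' with
  | zero S E hE => exact .zero _ _ hE
  | step S φ E₀ E A h hA hφ h₀ ih =>
    exact .step _ φ E₀ E A h hA (hS hφ) (ih (Set.inter_subset_inter_left _ hS))

lemma Filt.iso {E E' : C} (h : Filt P S E) (e : E ≅ E') : Filt P S E' := by
  cases h with
  | zero _ _ hE => exact .zero _ _ (hE.of_iso e.symm)
  | step _ φ E₀ _ A h hA hφ h₀ =>
    exact .step _ φ E₀ E' A (h.iso (Iso.refl _) e (Iso.refl _)) hA hφ h₀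

lemma Filt.single {A : C} {φ : ℝ} (hA : P φ A) (hφ : φ ∈ S) : Filt P S A :=
  .step S φ 0 A A (tri_of_isZero_left (isZero_zero C) (Iso.refl A)) hA hφ
    (.zero _ _ (isZero_zero C))

lemma Filt.map {D : Type u'} [Category.{v'} D] [Preadditive D] [HasZeroObject D] [HasShift D ℤ]
    [∀ n : ℤ, (shiftFunctor D n).Additive] [Pretriangulated D]
    (F : C ⥤ D) [F.CommShift ℤ] [F.IsTriangulated] {Q : ℝ → ObjectProperty D}
    {E : C} (h : Filt P S E) (hPQ : ∀ φ ∈ S, ∀ X : C, P φ X → Q φ (F.obj X)) :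
    Filt Q S (F.obj E) := by
  induction h with
  | zero S E hE => exact .zero _ _ (F.map_isZero hE)
  | step S φ E₀ E A h hA hφ h₀ ih =>
    exact .step _ φ _ _ _ (h.map F) (hPQ φ hφ A hA) hφ (ih fun φ hφ => hPQ φ hφ.1)

lemma Filt.shift (n : ℤ) (hP : ∀ φ X, P φ X → P (φ + n) (X⟦n⟧)) {E : C} (h : Filt P S E)
    (hS : ∀ s ∈ S, s + n ∈ S') : Filt P S' (E⟦n⟧) := by
  induction h generalizing S' with
  | zero S E hE => exact .zero _ _ ((isZero_shift_iff E n).2 hE)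
  | step S φ E₀ E A h hA hφ h₀ ih =>
    exact .step _ (φ + n) _ _ _ (h.shift n) (hP φ A hA) (hS φ hφ)
      (ih fun s hs => ⟨hS s hs.1, by simpa using hs.2⟩)

/-- Concatenation of filtrations. -/
lemma Filt.ext [IsTriangulated C] {E' E E'' : C} (h : Tri E' E E'') (h' : Filt P S' E')
    (h'' : Filt P S E'') (hS : ∀ s ∈ S, ∀ s' ∈ S', s < s') : Filt P (S ∪ S') E := by
  induction h'' generalizing E with
  | zero S E'' hE =>
    obtain ⟨e⟩ := h.iso_of_isZero₃ hE
    exact (h'.iso e).mono Set.subset_union_right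
  | step S φ E₀ E'' A h₁ hA hφ h₀ ih =>
    obtain ⟨W, hW, hW'⟩ := h.assoc h₁
    refine .step _ φ W E A hW' hA (Or.inl hφ) ((ih hW fun s hs => hS s hs.1).mono ?_)
    rintro x (hx | hx)
    · exact ⟨Or.inl hx.1, hx.2⟩
    · exact ⟨Or.inr hx, hS φ hφ x hx⟩

/-- Truncation of filtrations. -/
lemma Filt.truncate [IsTriangulated C] {E : C} (h : Filt P S E) (a : ℝ) :
    ∃ E' E'', Tri E' E E'' ∧ Filt P (S ∩ Set.Ioi a) E' ∧ Filt P (S ∩ Set.Iic a) E'' := by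
  induction h with
  | zero S E hE =>
    exact ⟨0, E, tri_of_isZero_left (isZero_zero C) (Iso.refl E), .zero _ _ (isZero_zero C),
      .zero _ _ hE⟩
  | step S φ E₀ E A h hA hφ h₀ ih =>
    by_cases hφa : φ ≤ a
    · obtain ⟨E', E₀'', h', hE', hE₀''⟩ := ih
      obtain ⟨W, hW, hW'⟩ := h.assoc' h'
      refine ⟨E', W, hW, hE'.mono (Set.inter_subset_inter_left _ Set.inter_subset_left),
        .step _ φ _ _ _ hW' hA ⟨hφ, hφa⟩ (hE₀''.mono ?_)⟩
      rintro x ⟨⟨hx, hx'⟩, hx''⟩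
      exact ⟨⟨hx, hx''⟩, hx'⟩
    · refine ⟨E, 0, tri_of_isZero_right (Iso.refl E) (isZero_zero C),
        .step _ φ _ _ _ h hA ⟨hφ, not_le.1 hφa⟩ (h₀.mono ?_), .zero _ _ (isZero_zero C)⟩
      rintro x ⟨hx, hx'⟩
      exact ⟨⟨hx, (not_le.1 hφa).trans hx'⟩, hx'⟩

lemma HNFiltration.filt_obj {E : C} (F : HNFiltration P E) (hS : ∀ i, F.φ i ∈ S)
    (k : Fin (F.n + 1)) : Filt P S (F.obj k) := by
  have key : ∀ (k : ℕ) (hk : k < F.n + 1),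
      Filt P {x | ∃ j : Fin F.n, j.val < k ∧ x = F.φ j} (F.obj ⟨k, hk⟩) := by
    intro k
    induction k with
    | zero => exact fun _ => .zero _ _ F.bot
    | succ k ih =>
      intro hk
      have hk' : k < F.n := by omega
      refine .step _ (F.φ ⟨k, hk'⟩) (F.obj ⟨k, by omega⟩) _ (F.fac ⟨k, hk'⟩)
        (.of_mem _ (F.distinguished ⟨k, hk'⟩)) (F.mem _) ⟨⟨k, hk'⟩, Nat.lt_succ_self k, rfl⟩
        ((ih (by omega)).mono ?_)
      rintro x ⟨j, hj, rfl⟩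
      exact ⟨⟨j, by omega, rfl⟩, F.strictAnti (Fin.lt_def.2 hj)⟩
  refine (key k.val k.isLt).mono ?_
  rintro x ⟨j, -, rfl⟩
  exact hS j

lemma HNFiltration.filt {E : C} (F : HNFiltration P E) (hS : ∀ i, F.φ i ∈ S) : Filt P S E :=
  (F.filt_obj hS (Fin.last F.n)).iso F.top

/-- `Filt` tolerates zero factors, which makes it stable under functors and truncation, whereas
`HNFiltration` forbids them. A step with zero factor is an isomorphism and is absorbed into the
final one. -/
lemma Filt.exists_chain {E : C} (h : Filt P S E) :
    ∃ (n : ℕ) (obj : Fin (n + 1) → C) (fac : Fin n → C) (φ : Fin n → ℝ),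
      (∀ i, Tri (obj i.castSucc) (obj i.succ) (fac i)) ∧ IsZero (obj 0) ∧
      Nonempty (obj (Fin.last n) ≅ E) ∧ (∀ i, P (φ i) (fac i)) ∧ (∀ i, ¬ IsZero (fac i)) ∧
      StrictAnti φ ∧ ∀ i, φ i ∈ S := by
  induction h with
  | zero S E hE =>
    exact ⟨0, fun _ => E, Fin.elim0, Fin.elim0, fun i => i.elim0, hE, ⟨Iso.refl E⟩,
      fun i => i.elim0, fun i => i.elim0, fun i => i.elim0, fun i => i.elim0⟩
  | step S ψ E₀ E A h hA hφ h₀ ih =>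
    obtain ⟨n, obj, fac, φ, h₁, h₂, ⟨e⟩, h₄, h₅, h₆, h₇⟩ := ih
    by_cases hA₀ : IsZero A
    · obtain ⟨e'⟩ := h.iso_of_isZero₃ hA₀
      exact ⟨n, obj, fac, φ, h₁, h₂, ⟨e ≪≫ e'⟩, h₄, h₅, h₆, fun i => (h₇ i).1⟩
    refine ⟨n + 1, Fin.snoc (α := fun _ => C) obj E, Fin.snoc (α := fun _ => C) fac A,
      Fin.snoc (α := fun _ => ℝ) φ ψ, fun i => ?_, ?_, ?_, fun i => ?_, fun i => ?_, ?_,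
      fun i => ?_⟩
    · induction i using Fin.lastCases with
      | last =>
        rw [Fin.succ_last, Fin.snoc_last, Fin.snoc_last, Fin.snoc_castSucc]
        exact h.iso e.symm (Iso.refl _) (Iso.refl _)
      | cast i =>
        rw [Fin.succ_castSucc, Fin.snoc_castSucc, Fin.snoc_castSucc, Fin.snoc_castSucc]
        exact h₁ i
    · rw [← Fin.castSucc_zero, Fin.snoc_castSucc]
      exact h₂
    · rw [Fin.snoc_last]
      exact ⟨Iso.refl _⟩
    · induction i using Fin.lastCases with
      | last => simpa only [Fin.snoc_last] using hA
      | cast i => simpa only [Fin.snoc_castSucc] using h₄ i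
    · induction i using Fin.lastCases with
      | last => simpa only [Fin.snoc_last] using hA₀
      | cast i => simpa only [Fin.snoc_castSucc] using h₅ i
    · intro i j hij
      induction j using Fin.lastCases with
      | last =>
        induction i using Fin.lastCases with
        | last => exact absurd hij (lt_irrefl _)
        | cast i => simpa only [Fin.snoc_last, Fin.snoc_castSucc] using Set.mem_Ioi.1 (h₇ i).2
      | cast j =>
        induction i using Fin.lastCases with
        | last => exact absurd hij (not_lt.2 (Fin.le_last _))
        | cast i =>
          simpa only [Fin.snoc_castSucc] using h₆ (Fin.castSucc_lt_castSucc_iff.1 hij)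
    · induction i using Fin.lastCases with
      | last => simpa only [Fin.snoc_last] using hφ
      | cast i => simpa only [Fin.snoc_castSucc] using (h₇ i).1

lemma Filt.exists_hn {E : C} (h : Filt P S E) :
    ∃ F : HNFiltration P E, ∀ i, F.φ i ∈ S := by
  obtain ⟨n, obj, fac, φ, h₁, h₂, ⟨e⟩, h₄, h₅, h₆, h₇⟩ := h.exists_chain
  choose f g k hT using h₁
  exact ⟨⟨n, obj, fac, φ, f, g, k, hT, h₂, e, h₄, h₅, h₆⟩, h₇⟩

lemma Slicing.interval_iff (P : Slicing C) (I : Set ℝ) (E : C) :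
    P.interval I E ↔ Filt P.obj I E :=
  ⟨fun h => h.elim (.zero _ _) fun ⟨F, hF⟩ => F.filt hF, fun h => Or.inr h.exists_hn⟩

end Filtration

/-! ### Phases of an object detected by Hom-vanishing; the t-structures of a slicing -/

section IsSlicing

variable {C : Type u} [Category.{v} C] [Preadditive C] [HasZeroObject C] [HasShift C ℤ]
  [∀ n : ℤ, (shiftFunctor C n).Additive] [Pretriangulated C]

/-- The defining properties of a slicing, except the closure under direct sums (which follows). -/
structure IsSlicing (P : ℝ → ObjectProperty C) : Prop where
  iso_mem (φ : ℝ) {X Y : C} (e : X ≅ Y) (hX : P φ X) : P φ Y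
  zero_mem (φ : ℝ) {X : C} (hX : IsZero X) : P φ X
  shift_iff (φ : ℝ) (X : C) : P (φ + 1) (X⟦(1 : ℤ)⟧) ↔ P φ X
  hom_zero {φ₁ φ₂ : ℝ} (h : φ₂ < φ₁) {X Y : C} (hX : P φ₁ X) (hY : P φ₂ Y) : HomZero X Y
  filt (E : C) : Filt P Set.univ E

lemma Slicing.isSlicing (P : Slicing C) : IsSlicing P.obj where
  iso_mem := P.iso_mem
  zero_mem := P.zero_mem
  shift_iff := P.shift_iff
  hom_zero h _ _ hX hY f := P.hom_eq_zero h hX hY f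
  filt E := by
    by_cases hE : IsZero E
    · exact .zero _ _ hE
    · obtain ⟨F⟩ := P.exists_hn E hE
      exact F.filt fun _ => Set.mem_univ _

namespace IsSlicing

variable {P : ℝ → ObjectProperty C} (hP : IsSlicing P) {S S' : Set ℝ}
include hP

lemma shift_int_iff (φ : ℝ) (n : ℤ) (X : C) : P (φ + n) (X⟦n⟧) ↔ P φ X := by
  have iso_iff : ∀ {φ : ℝ} {X Y : C}, (X ≅ Y) → (P φ X ↔ P φ Y) := fun e =>
    ⟨hP.iso_mem _ e, hP.iso_mem _ e.symm⟩
  induction n using Int.induction_on with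
  | zero => simpa using iso_iff ((shiftFunctorZero C ℤ).app X)
  | succ n ih =>
    refine Iff.trans ?_ ih
    rw [← hP.shift_iff (φ + (n : ℤ))]
    push_cast
    rw [add_assoc]
    exact iso_iff ((shiftFunctorAdd C (n : ℤ) 1).app X)
  | pred n ih =>
    refine Iff.trans ?_ ih
    rw [← hP.shift_iff (φ + (-(n : ℤ) - 1 : ℤ))]
    push_cast
    rw [add_assoc, sub_add_cancel]
    exact iso_iff ((shiftFunctorAdd' C (-(n : ℤ) - 1) 1 (-n) (by ring)).symm.app X)

lemma filt_shift (n : ℤ) {E : C} (h : Filt P S E) (hS : ∀ s ∈ S, s + n ∈ S') :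
    Filt P S' (E⟦n⟧) :=
  h.shift n (fun φ X => (hP.shift_int_iff φ n X).2) hS

lemma homZero_of_filt_left {E Y : C} {φ : ℝ} (h : Filt P S E) (hY : P φ Y)
    (hS : ∀ s ∈ S, φ < s) : HomZero E Y := by
  induction h with
  | zero S E hE => exact homZero_of_isZero_left hE _
  | step S ψ E₀ E A h hA hψ h₀ ih =>
    exact h.homZero_left (ih fun s hs => hS s hs.1) (hP.hom_zero (hS ψ hψ) hA hY)

lemma homZero_of_filt {E E' : C} (h : Filt P S E) (h' : Filt P S' E')
    (hS : ∀ s ∈ S, ∀ s' ∈ S', s' < s) : HomZero E E' := by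
  induction h' with
  | zero S' E' hE => exact homZero_of_isZero_right _ hE
  | step S' ψ E₀ E' A h₁ hA hψ h₀ ih =>
    exact h₁.homZero_right (ih fun s hs s' hs' => hS s hs s' hs'.1)
      (hP.homZero_of_filt_left h hA fun s hs => hS s hs ψ hψ)

lemma homZero_of_filt_right {E X : C} {φ : ℝ} (h : Filt P S E) (hX : P φ X)
    (hS : ∀ s ∈ S, s < φ) : HomZero X E :=
  hP.homZero_of_filt (.single (S := {φ}) hX rfl) h (by simpa using hS)

/-- The largest phase is witnessed by a nonzero morphism from an object of that phase. Together with
`exists_min` this turns vanishing of morphisms into bounds on phases. -/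
lemma exists_max {E : C} (h : Filt P S E) (hE : ¬ IsZero E) :
    ∃ M ∈ S, ∃ X, P M X ∧ ¬ HomZero X E ∧ Filt P (S ∩ Set.Iic M) E := by
  induction h with
  | zero S E hE' => exact absurd hE' hE
  | step S φ E₀ E A h hA hφ h₀ ih =>
    by_cases hE₀ : IsZero E₀
    · obtain ⟨e⟩ := h.iso_of_isZero₁ hE₀
      have hEφ : P φ E := hP.iso_mem _ e.symm hA
      exact ⟨φ, hφ, E, hEφ, fun h => hE h.isZero, .single hEφ ⟨hφ, Set.mem_Iic.2 le_rfl⟩⟩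
    · obtain ⟨M, hM, X, hX, hXE, hF⟩ := ih hE₀
      -- The map `X ⟶ E₀` stays nonzero in `E`: otherwise it would come from `A⟦-1⟧`, whose phase `φ
      -- - 1` is less than `M`.
      refine ⟨M, hM.1, X, hX, fun h0 => hXE (h.invRot.homZero_right ?_ h0),
        .step _ φ _ _ _ h hA ⟨hφ, Set.mem_Iic.2 (Set.mem_Ioi.1 hM.2).le⟩ (hF.mono ?_)⟩
      · have : P (φ + (-1 : ℤ)) (A⟦(-1 : ℤ)⟧) := (hP.shift_int_iff φ (-1) A).2 hA
        refine hP.hom_zero ?_ hX this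
        have := hM.2
        simp only [Set.mem_Ioi] at this
        push_cast
        linarith
      · rintro x ⟨⟨hx, hx'⟩, hx''⟩
        exact ⟨⟨hx, hx''⟩, hx'⟩

lemma exists_min {E : C} (h : Filt P S E) (hE : ¬ IsZero E) :
    ∃ m ∈ S, ∃ Y, P m Y ∧ ¬ HomZero E Y ∧ Filt P (S ∩ Set.Ici m) E := by
  induction h with
  | zero S E hE' => exact absurd hE' hE
  | step S φ E₀ E A h hA hφ h₀ ih =>
    by_cases hA₀ : IsZero A
    · obtain ⟨e⟩ := h.iso_of_isZero₃ hA₀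
      obtain ⟨m, hm, Y, hY, hYE, hF⟩ := ih fun h => hE (h.of_iso e.symm)
      exact ⟨m, hm.1, Y, hY, fun h0 => hYE (h0.iso e.symm (Iso.refl Y)),
        (hF.iso e).mono (Set.inter_subset_inter_left _ Set.inter_subset_left)⟩
    · refine ⟨φ, hφ, A, hA, fun h0 => hA₀ (h.isZero₃_of_homZero h0 ?_),
        .step _ φ _ _ _ h hA ⟨hφ, Set.mem_Ici.2 le_rfl⟩ (h₀.mono ?_)⟩
      · have : Filt P (Set.Ioi φ) (E₀⟦(1 : ℤ)⟧) := hP.filt_shift 1 h₀ fun s hs => by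
          have := hs.2
          simp only [Set.mem_Ioi] at this ⊢
          push_cast
          linarith
        exact hP.homZero_of_filt_left this hA fun s hs => hs
      · rintro x ⟨hx, hx'⟩
        exact ⟨⟨hx, Set.mem_Ici.2 (Set.mem_Ioi.1 hx').le⟩, hx'⟩

/-- The phases of `E` are determined by the vanishing of morphisms from and to the `P φ`. -/
lemma filt_of_vanish {E : C} {U L : Set ℝ} (hU : IsUpperSet U) (hL : IsLowerSet L)
    (h₁ : ∀ φ ∈ U, ∀ X, P φ X → HomZero X E) (h₂ : ∀ φ ∈ L, ∀ Y, P φ Y → HomZero E Y) :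
    Filt P (Uᶜ ∩ Lᶜ) E := by
  by_cases hE : IsZero E
  · exact .zero _ _ hE
  obtain ⟨M, -, X, hX, hXE, hF⟩ := hP.exists_max (hP.filt E) hE
  obtain ⟨m, -, Y, hY, hYE, hF'⟩ := hP.exists_min hF hE
  refine hF'.mono ?_
  rintro x ⟨⟨-, hx⟩, hx'⟩
  exact ⟨fun hxU => hXE (h₁ M (hU hx hxU) X hX), fun hxL => hYE (h₂ m (hL hx' hxL) Y hY)⟩

/-- Apply the preceding criterion to the phases above all of `I` and below all of `I`; what remains
lies between two elements of `I`. Since vanishing of morphisms passes through triangles, this yields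
closure of `Filt P I` under extensions. -/
lemma filt_of_vanish_of_filt {E : C} {I : Set ℝ} (hI : I.OrdConnected)
    (h₁ : ∀ φ X, P φ X → (∀ i ∈ I, i < φ) → HomZero X E)
    (h₂ : ∀ φ Y, P φ Y → (∀ i ∈ I, φ < i) → HomZero E Y) : Filt P I E := by
  refine (hP.filt_of_vanish (U := {φ | ∀ i ∈ I, i < φ}) (L := {φ | ∀ i ∈ I, φ < i})
    (fun a b hab ha i hi => (ha i hi).trans_le hab) (fun a b hab ha i hi => hab.trans_lt (ha i hi))
    (fun φ hφ X hX => h₁ φ X hX hφ) (fun φ hφ Y hY => h₂ φ Y hY hφ)).mono ?_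
  rintro x ⟨hx, hx'⟩
  simp only [Set.mem_compl_iff, Set.mem_ofPred_eq, not_forall, not_lt] at hx hx'
  obtain ⟨i, hi, hxi⟩ := hx
  obtain ⟨j, hj, hxj⟩ := hx'
  exact hI.out hj hi ⟨hxj, hxi⟩

lemma filt_of_tri {X Y Z : C} {I : Set ℝ} (hI : I.OrdConnected) (h : Tri X Y Z)
    (hX : Filt P I X) (hZ : Filt P I Z) : Filt P I Y :=
  hP.filt_of_vanish_of_filt hI
    (fun _ _ hW hi => h.homZero_right (hP.homZero_of_filt_right hX hW hi)
      (hP.homZero_of_filt_right hZ hW hi))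
    (fun _ _ hW hi => h.homZero_left (hP.homZero_of_filt_left hX hW hi)
      (hP.homZero_of_filt_left hZ hW hi))

lemma filt_Iic_iff {a : ℝ} {E : C} :
    Filt P (Set.Iic a) E ↔ ∀ φ, a < φ → ∀ X, P φ X → HomZero X E := by
  refine ⟨fun h φ hφ X hX => hP.homZero_of_filt_right h hX fun s hs => lt_of_le_of_lt hs hφ,
    fun h => hP.filt_of_vanish_of_filt Set.ordConnected_Iic (fun φ X hX hφ => ?_)
      (fun φ Y _ hφ => ?_)⟩
  · exact h φ (hφ a (Set.mem_Iic.2 le_rfl)) X hX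
  · exact absurd (hφ (min φ a) (Set.mem_Iic.2 (min_le_right _ _))) (not_lt.2 (min_le_left _ _))

/-- Two filtrations of the same object impose their Hom-vanishing simultaneously, so uniqueness of
Harder–Narasimhan filtrations is not needed. -/
lemma filt_inter {E : C} (hS : S.OrdConnected) (hS' : S'.OrdConnected) (h : Filt P S E)
    (h' : Filt P S' E) : Filt P (S ∩ S') E := by
  refine (hP.filt_of_vanish (U := {φ | (∀ i ∈ S, i < φ) ∨ ∀ i ∈ S', i < φ})
    (L := {φ | (∀ i ∈ S, φ < i) ∨ ∀ i ∈ S', φ < i})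
    (fun a b hab ha => ha.imp (fun ha i hi => (ha i hi).trans_le hab)
      fun ha i hi => (ha i hi).trans_le hab)
    (fun a b hab ha => ha.imp (fun ha i hi => hab.trans_lt (ha i hi))
      fun ha i hi => hab.trans_lt (ha i hi))
    (fun φ hφ X hX => hφ.elim (hP.homZero_of_filt_right h hX) (hP.homZero_of_filt_right h' hX))
    (fun φ hφ Y hY => hφ.elim (hP.homZero_of_filt_left h hY)
      (hP.homZero_of_filt_left h' hY))).mono ?_
  rintro x ⟨hx, hx'⟩
  simp only [Set.mem_compl_iff, Set.mem_ofPred_eq, not_or, not_forall, not_lt] at hx hx'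
  obtain ⟨⟨i, hi, hxi⟩, ⟨i', hi', hxi'⟩⟩ := hx
  obtain ⟨⟨j, hj, hxj⟩, ⟨j', hj', hxj'⟩⟩ := hx'
  exact ⟨hS.out hj hi ⟨hxj, hxi⟩, hS'.out hj' hi' ⟨hxj', hxi'⟩⟩

lemma filt_Ioc {E : C} {a b : ℝ} (h : Filt P (Set.Ioi a) E) (h' : Filt P (Set.Iic b) E) :
    Filt P (Set.Ioc a b) E :=
  hP.filt_inter Set.ordConnected_Ioi Set.ordConnected_Iic h h'

lemma of_filt_singleton {E : C} {φ : ℝ} (h : Filt P {φ} E) : P φ E := by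
  cases h with
  | zero _ _ hE => exact hP.zero_mem _ hE
  | step _ ψ E₀ _ A h hA hφ h₀ =>
    obtain rfl : ψ = φ := hφ
    have hE₀ : IsZero E₀ := by
      cases h₀ with
      | zero _ _ hE => exact hE
      | step _ χ _ _ _ _ _ hχ _ =>
        obtain ⟨rfl, hχ'⟩ : χ = ψ ∧ ψ < χ := hχ
        exact absurd hχ' (lt_irrefl _)
    obtain ⟨e⟩ := h.iso_of_isZero₁ hE₀
    exact hP.iso_mem _ e.symm hA

lemma of_tri {X Y Z : C} {φ : ℝ} (h : Tri X Y Z) (hX : P φ X) (hZ : P φ Z) : P φ Y :=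
  hP.of_filt_singleton (hP.filt_of_tri Set.ordConnected_singleton h (.single hX rfl)
    (.single hZ rfl))

/-- The slicing with a given family of subcategories. -/
def toSlicing : Slicing C where
  obj := P
  iso_mem φ _ _ e hX := hP.iso_mem φ e hX
  zero_mem φ _ hX := hP.zero_mem φ hX
  biprod_mem φ {X Y} b hb hX hY := by
    have e : X ⊞ Y ≅ b.pt := biprod.uniqueUpToIso X Y hb.some |>.symm
    exact hP.iso_mem φ e (hP.of_tri (tri_biprod X Y) hX hY)
  shift_iff := hP.shift_iff
  hom_eq_zero h _ _ hX hY f := hP.hom_zero h hX hY f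
  exists_hn E _ := ⟨(hP.filt E).exists_hn.choose⟩

/-- The t-structure of a slicing with heart `P((a, a + 1])`. -/
def tStructure [IsTriangulated C] (a : ℝ) : TStructure C where
  le n := Filt P (Set.Ioi (a - n))
  ge n := Filt P (Set.Iic (a + 1 - n))
  le_isClosedUnderIsomorphisms n := ⟨fun e h => h.iso e⟩
  ge_isClosedUnderIsomorphisms n := ⟨fun e h => h.iso e⟩
  le_shift n k n' h X hX := hP.filt_shift k hX fun s hs => by
    have : (n : ℝ) = k + n' := by exact_mod_cast h.symm
    simp only [Set.mem_Ioi] at hs ⊢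
    linarith
  ge_shift n k n' h X hX := hP.filt_shift k hX fun s hs => by
    have : (n : ℝ) = k + n' := by exact_mod_cast h.symm
    simp only [Set.mem_Iic] at hs ⊢
    linarith
  zero' X Y f hX hY := hP.homZero_of_filt hX hY (fun s hs s' hs' => by
    simp only [Set.mem_Iic, Set.mem_Ioi, Int.cast_zero, Int.cast_one] at hs hs'
    linarith) f
  le_zero_le X hX := hX.mono (Set.Ioi_subset_Ioi (by simp))
  ge_one_le X hX := hX.mono (Set.Iic_subset_Iic.2 (by simp))
  exists_triangle_zero_one E := by
    obtain ⟨E', E'', ⟨f, g, h, hT⟩, h', h''⟩ := (hP.filt E).truncate a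
    exact ⟨E', E'', h'.mono fun x hx => by simpa using hx.2,
      h''.mono fun x hx => by simpa using hx.2, f, g, h, hT⟩

lemma bounded_tStructure [IsTriangulated C] (a : ℝ) (X : C) :
    (hP.tStructure a).bounded X := by
  by_cases hX : IsZero X
  · exact ⟨⟨0, ⟨.zero _ _ hX⟩⟩, ⟨0, ⟨.zero _ _ hX⟩⟩⟩
  obtain ⟨M, -, -, -, -, hF⟩ := hP.exists_max (hP.filt X) hX
  obtain ⟨m, -, -, -, -, hF'⟩ := hP.exists_min (hP.filt X) hX
  -- The largest `n` with `M ≤ a + 1 - n` and the smallest `n` with `a - n < m`.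
  refine ⟨⟨⌊a + 1 - M⌋, ⟨hF.mono fun x hx => ?_⟩⟩, ⟨⌊a - m⌋ + 1, ⟨hF'.mono fun x hx => ?_⟩⟩⟩
  · have h₁ : x ≤ M := hx.2
    have h₂ := Int.floor_le (a + 1 - M)
    simp only [Set.mem_Iic]
    linarith
  · have h₁ : m ≤ x := hx.2
    have h₂ := Int.lt_floor_add_one (a - m)
    simp only [Set.mem_Ioi]
    push_cast
    linarith

lemma heart_tStructure [IsTriangulated C] (a : ℝ) :
    (hP.tStructure a).heart = Filt P (Set.Ioc a (a + 1)) := by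
  ext X
  change Filt P (Set.Ioi (a - (0 : ℤ))) X ∧ Filt P (Set.Iic (a + 1 - (0 : ℤ))) X ↔ _
  rw [Int.cast_zero, sub_zero, sub_zero]
  exact ⟨fun h => hP.filt_Ioc h.1 h.2, fun h => ⟨h.mono fun x hx => hx.1, h.mono fun x hx => hx.2⟩⟩

lemma isBoundedHeart [IsTriangulated C] (a : ℝ) :
    IsBoundedHeart (Filt P (Set.Ioc a (a + 1))) :=
  ⟨hP.tStructure a, hP.bounded_tStructure a, hP.heart_tStructure a⟩

end IsSlicing

end IsSlicing

/-! ### Hearts of t-structures: monomorphisms, images and short exact sequences as triangles -/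

section Heart

variable {C : Type u} [Category.{v} C] [Preadditive C] [HasZeroObject C] [HasShift C ℤ]
  [∀ n : ℤ, (shiftFunctor C n).Additive] [Pretriangulated C] (t : TStructure C)

lemma tri_truncation (E : C) (n : ℤ) :
    ∃ E' E'', Tri E' E E'' ∧ t.le n E' ∧ t.ge (n + 1) E'' := by
  obtain ⟨X, Y, hX, hY, f, g, h, hT⟩ := t.exists_triangle E n (n + 1) rfl
  exact ⟨X, Y, ⟨f, g, h, hT⟩, hX, hY⟩

lemma homZero_of_le_of_ge {X Y : C} {m n : ℤ} (hX : t.le m X) (hY : t.ge n Y) (h : m < n) :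
    HomZero X Y := fun f =>
  t.zero_of_isLE_of_isGE f m n h ⟨hX⟩ ⟨hY⟩

lemma le_of_tri {X Y Z : C} {n : ℤ} (h : Tri X Y Z) (hX : t.le n X) (hZ : t.le n Z) :
    t.le n Y := by
  obtain ⟨f, g, k, hT⟩ := h
  exact (t.isLE₂ _ hT n ⟨hX⟩ ⟨hZ⟩).le

lemma ge_of_tri {X Y Z : C} {n : ℤ} (h : Tri X Y Z) (hX : t.ge n X) (hZ : t.ge n Z) :
    t.ge n Y := by
  obtain ⟨f, g, k, hT⟩ := h
  exact (t.isGE₂ _ hT n ⟨hX⟩ ⟨hZ⟩).ge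

lemma heart_of_tri {X Y Z : C} (h : Tri X Y Z) (hX : t.heart X) (hZ : t.heart Z) : t.heart Y :=
  ⟨le_of_tri t h hX.1 hZ.1, ge_of_tri t h hX.2 hZ.2⟩

lemma heart_of_isZero {X : C} (h : IsZero X) : t.heart X :=
  ⟨(t.isLE_of_isZero h 0).le, (t.isGE_of_isZero h 0).ge⟩

lemma ge_of_shift {X : C} {a n m : ℤ} (h : t.ge n (X⟦a⟧)) (hm : n + a = m) : t.ge m X :=
  (t.ge m).prop_of_iso ((shiftEquiv C a).unitIso.symm.app X) (t.ge_shift n (-a) m (by omega) _ h)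

lemma le_of_shift {X : C} {a n m : ℤ} (h : t.le n (X⟦a⟧)) (hm : n + a = m) : t.le m X :=
  (t.le m).prop_of_iso ((shiftEquiv C a).unitIso.symm.app X) (t.le_shift n (-a) m (by omega) _ h)

lemma isZero_of_le_of_ge {X : C} {m n : ℤ} (h : t.le m X) (h' : t.ge n X) (hmn : m < n) :
    IsZero X :=
  (homZero_of_le_of_ge t h h' hmn).isZero

/-- Bounded objects are iterated extensions of shifts of objects of the heart. -/
lemma bounded_induction {p : ℤ → C → Prop} (a : ℤ) (zero : ∀ b X, IsZero X → p b X)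
    (step : ∀ b X' X X'', a ≤ b → Tri X' X X'' → p (b - 1) X' → t.heart (X''⟦b⟧) → p b X)
    (b : ℤ) (X : C) (hX : t.ge a X) (hX' : t.le b X) : p b X := by
  by_cases hab : b < a
  · exact zero b X (isZero_of_le_of_ge t hX' hX hab)
  obtain ⟨d, hd⟩ := Int.eq_ofNat_of_zero_le (a := b - a) (by omega)
  induction d generalizing b X with
  | zero =>
    obtain rfl : b = a := by omega
    exact step b 0 X X le_rfl (tri_of_isZero_left (isZero_zero C) (Iso.refl X))
      (zero _ _ (isZero_zero C)) ⟨t.le_shift _ _ _ (by omega) _ hX', t.ge_shift _ _ _ (by omega) _ hX⟩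
  | succ d ih =>
    obtain ⟨X', X'', h, h', h''⟩ := tri_truncation t X (b - 1)
    rw [sub_add_cancel] at h''
    have h₁ : t.ge a X' := ge_of_tri t h.invRot
      (TStructure.ge_antitone t (by omega) _ (t.ge_shift b (-1) (b + 1) (by omega) _ h'')) hX
    have h₂ : t.le b X'' := le_of_tri t h.rot hX'
      (TStructure.le_monotone t (by omega) _ (t.le_shift (b - 1) 1 (b - 2) (by omega) _ h'))
    exact step b X' X X'' (by omega) h (ih (b - 1) X' h₁ h' (by omega) (by omega))
      ⟨t.le_shift _ _ _ (by omega) _ h₂, t.ge_shift _ _ _ (by omega) _ h''⟩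

lemma le_of_heart_le {t t' : TStructure C} (h : t.heart ≤ t'.heart) (ht : ∀ X, t.bounded X)
    {n : ℤ} {X : C} (hX : t.le n X) : t'.le n X := by
  obtain ⟨⟨a, ha⟩, -⟩ := ht X
  refine bounded_induction t (p := t'.le) a (fun b X hX => (t'.isLE_of_isZero hX b).le) ?_ n X
    ha.ge hX
  intro b X' X X'' _ hT hX' hX''
  exact le_of_tri t' hT (TStructure.le_monotone t' (by omega) _ hX')
    (le_of_shift t' (h _ hX'').1 (by omega))

lemma ge_of_heart_le {t t' : TStructure C} (h : t.heart ≤ t'.heart) (ht : ∀ X, t.bounded X)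
    {n : ℤ} {X : C} (hX : t.ge n X) : t'.ge n X := by
  obtain ⟨-, ⟨b, hb⟩⟩ := ht X
  refine bounded_induction t (p := fun _ => t'.ge n) n
    (fun b X hX => (t'.isGE_of_isZero hX n).ge) ?_ b X hX hb.le
  intro b X' X X'' hb hT hX' hX''
  exact ge_of_tri t' hT hX' (TStructure.ge_antitone t' hb _
    (ge_of_shift t' (h _ hX'').2 (by omega)))

/-- Two nested hearts of bounded t-structures are equal. -/
lemma IsBoundedHeart.eq_of_le {A B : ObjectProperty C} (hA : IsBoundedHeart A)
    (hB : IsBoundedHeart B) (h : A ≤ B) : A = B := by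
  obtain ⟨t, ht, rfl⟩ := hA
  obtain ⟨t', ht', rfl⟩ := hB
  -- The inclusion of hearts gives inclusions of both halves of the t-structures; the reverse
  -- inclusion follows because each half is the orthogonal of the other.
  refine le_antisymm h fun X hX => ⟨?_, ?_⟩
  · rw [t.le_iff_isLE, t.isLE_iff_orthogonal 0 1 rfl]
    exact fun Y f hY => homZero_of_le_of_ge t' hX.1 (ge_of_heart_le h ht hY.ge) zero_lt_one f
  · rw [t.ge_iff_isGE, t.isGE_iff_orthogonal (-1) 0 rfl]
    exact fun Y f hY => homZero_of_le_of_ge t' (le_of_heart_le h ht hY.le) hX.2 (by omega) f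

lemma isZero_fullSubcategory_iff {A : ObjectProperty C} (X : A.FullSubcategory) :
    IsZero X ↔ IsZero X.obj := by
  refine ⟨fun h => ?_, fun h => IsZero.of_full_of_faithful_of_isZero A.ι X h⟩
  rw [IsZero.iff_id_eq_zero] at h ⊢
  exact congrArg (fun f => f.hom) h

/-- A morphism killed by `f` factors through `Q⟦-1⟧`, which receives no nonzero morphism from the
heart. -/
lemma heart_mono_of_distTriang {F E : t.heart.FullSubcategory} (f : F ⟶ E) {Q : C} (hQ : t.heart Q)
    (g : E.obj ⟶ Q) (h : Q ⟶ F.obj⟦(1 : ℤ)⟧) (hT : Triangle.mk f.hom g h ∈ distTriang C) :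
    Mono f := by
  refine Preadditive.mono_of_cancel_zero f fun {W} k hk => ?_
  have hk' : k.hom ≫ f.hom = 0 := congrArg (fun f => f.hom) hk
  obtain ⟨b, hb⟩ := Triangle.coyoneda_exact₂ _ (inv_rot_of_distTriang _ hT) k.hom hk'
  have hb0 : b = 0 := homZero_of_le_of_ge t W.property.1
    (t.ge_shift 0 (-1) 1 (by omega) _ hQ.2) zero_lt_one b
  ext
  rw [hb, hb0]
  exact zero_comp

lemma heart_epi_of_distTriang {E Q : t.heart.FullSubcategory} (g : E ⟶ Q) {F : C} (hF : t.heart F)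
    (f : F ⟶ E.obj) (h : Q.obj ⟶ F⟦(1 : ℤ)⟧) (hT : Triangle.mk f g.hom h ∈ distTriang C) :
    Epi g := by
  refine Preadditive.epi_of_cancel_zero g fun {W} k hk => ?_
  have hk' : g.hom ≫ k.hom = 0 := congrArg (fun f => f.hom) hk
  obtain ⟨b, hb⟩ := Triangle.yoneda_exact₃ _ hT k.hom hk'
  have hb0 : b = 0 := homZero_of_le_of_ge t (t.le_shift 0 1 (-1) (by omega) _ hF.1)
    W.property.2 (by omega) b
  ext
  rw [hb, hb0]
  exact comp_zero

/-- The cone of a monomorphism of the heart lies in the heart. -/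
lemma exists_distTriang_of_mono {F E : t.heart.FullSubcategory} (f : F ⟶ E) [Mono f] :
    ∃ (Q : C) (g : E.obj ⟶ Q) (h : Q ⟶ F.obj⟦(1 : ℤ)⟧), t.heart Q ∧
      Triangle.mk f.hom g h ∈ distTriang C := by
  obtain ⟨Q, g, h, hT⟩ := distinguished_cocone_triangle f.hom
  refine ⟨Q, g, h, ?_, hT⟩
  have hQ := (Tri.of_mem _ hT).rot
  have hF₁ : t.le (-1) (F.obj⟦(1 : ℤ)⟧) := t.le_shift 0 1 (-1) (by omega) _ F.property.1
  have hF₂ : t.ge (-1) (F.obj⟦(1 : ℤ)⟧) := t.ge_shift 0 1 (-1) (by omega) _ F.property.2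
  have hle : t.le 0 Q := le_of_tri t hQ E.property.1
    (TStructure.le_monotone t (by omega) _ hF₁)
  have hge : t.ge (-1) Q := ge_of_tri t hQ (TStructure.ge_antitone t (by omega) _ E.property.2) hF₂
  obtain ⟨Q', Q'', hQQ, hQ', hQ''⟩ := tri_truncation t Q (-1)
  have hQ'ge : t.ge (-1) Q' := ge_of_tri t hQQ.invRot
    (TStructure.ge_antitone t (by omega) _ (t.ge_shift 0 (-1) 1 (by omega) _ hQ'')) hge
  -- `Q'⟦-1⟧` plays the role of the kernel of `f`: its map to `F` is killed by `f`, hence zero as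
  -- `f` is a monomorphism. So `Q' ⟶ Q` lifts to `E`, and there is no nonzero map from degrees `≤
  -- -1` to the heart.
  have hz : HomZero Q' Q := by
    intro k
    have hW : t.heart (Q'⟦(-1 : ℤ)⟧) :=
      ⟨t.le_shift (-1) (-1) 0 (by omega) _ hQ', t.ge_shift (-1) (-1) 0 (by omega) _ hQ'ge⟩
    let e : (Q'⟦(-1 : ℤ)⟧)⟦(1 : ℤ)⟧ ≅ Q' := (shiftEquiv C (1 : ℤ)).counitIso.app Q'
    have hhf : h ≫ f.hom⟦1⟧' = 0 := comp_distTriang_mor_zero₃₁ _ hT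
    have hkh : k ≫ h = 0 := by
      obtain ⟨w, hw⟩ := (shiftFunctor C (1 : ℤ)).map_surjective (e.hom ≫ k ≫ h)
      let w' : (⟨_, hW⟩ : t.heart.FullSubcategory) ⟶ F := ⟨w⟩
      have hw' : w' ≫ f = 0 := by
        ext
        apply (shiftFunctor C (1 : ℤ)).map_injective
        change (shiftFunctor C (1 : ℤ)).map (w ≫ f.hom) = (shiftFunctor C (1 : ℤ)).map 0
        rw [Functor.map_comp, hw, Category.assoc, Category.assoc, hhf, comp_zero, comp_zero,
          Functor.map_zero]
      have hw0 : w = 0 := congrArg (fun f => f.hom) (zero_of_comp_mono f hw')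
      rw [← cancel_epi e.hom, ← hw, hw0, Functor.map_zero, comp_zero]
    obtain ⟨b, hb⟩ := Triangle.coyoneda_exact₃ _ hT k hkh
    have : b = 0 := homZero_of_le_of_ge t hQ' E.property.2 (by omega) b
    rw [hb, this]
    exact zero_comp
  have hQ'0 : IsZero Q' := hQQ.isZero₁_of_homZero hz
    (homZero_of_le_of_ge t hQ' (t.ge_shift 0 (-1) 1 (by omega) _ hQ'') (by omega))
  obtain ⟨e⟩ := hQQ.iso_of_isZero₁ hQ'0
  exact ⟨hle, (t.ge 0).prop_of_iso e.symm hQ''⟩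

/-- A nonzero morphism of the heart factors through a nonzero image. -/
lemma exists_image [IsTriangulated C] {X Y : C} (hX : t.heart X) (hY : t.heart Y) (f : X ⟶ Y)
    (hf : f ≠ 0) : ∃ K I Q, t.heart K ∧ t.heart I ∧ t.heart Q ∧ Tri K X I ∧ Tri I Y Q ∧
      ¬ IsZero I := by
  obtain ⟨Z, g, h, hT⟩ := distinguished_cocone_triangle f
  have hZ := (Tri.of_mem _ hT).rot
  have hle : t.le 0 Z := le_of_tri t hZ hY.1 (TStructure.le_monotone t (by omega) _
    (t.le_shift 0 1 (-1) (by omega) _ hX.1))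
  have hge : t.ge (-1) Z := ge_of_tri t hZ (TStructure.ge_antitone t (by omega) _ hY.2)
    (t.ge_shift 0 1 (-1) (by omega) _ hX.2)
  -- Truncating the cone separates kernel and cokernel: `Z'⟦-1⟧` is the kernel and `Q` the cokernel.
  -- The image is the fibre of `Y ⟶ Q`, and the octahedron exhibits it as a quotient of `X`.
  obtain ⟨Z', Q, hZ', hQ, a, b, c, hT'⟩ := t.exists_triangle Z (-1) 0 rfl
  have hZQ : Tri Z' Z Q := .of_mem _ hT'
  have hZ'ge : t.ge (-1) Z' := ge_of_tri t hZQ.invRot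
    (TStructure.ge_antitone t (by omega) _ (t.ge_shift 0 (-1) 1 (by omega) _ hQ)) hge
  have hQle : t.le 0 Q := le_of_tri t hZQ.rot hle
    (TStructure.le_monotone t (by omega) _ (t.le_shift (-1) 1 (-2) (by omega) _ hZ'))
  obtain ⟨I, i, j, hT''⟩ := distinguished_cocone_triangle₁ (g ≫ b)
  have hXI : Tri X I Z' := .of_mem _ (someOctahedron' rfl hT hT' hT'').mem
  have hIY : Tri I Y Q := .of_mem _ hT''
  have hI : t.heart I := ⟨le_of_tri t hXI hX.1 (TStructure.le_monotone t (by omega) _ hZ'),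
    ge_of_tri t hIY.invRot (TStructure.ge_antitone t (by omega) _
      (t.ge_shift 0 (-1) 1 (by omega) _ hQ)) hY.2⟩
  refine ⟨Z'⟦(-1 : ℤ)⟧, I, Q, ⟨t.le_shift (-1) (-1) 0 (by omega) _ hZ',
    t.ge_shift (-1) (-1) 0 (by omega) _ hZ'ge⟩, hI, ⟨hQle, hQ⟩, hXI.invRot, hIY, fun h0 => hf ?_⟩
  have hfg : f ≫ g = 0 := comp_distTriang_mor_zero₁₂ _ hT
  obtain ⟨k, hk⟩ : ∃ k : X ⟶ I, f = k ≫ i :=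
    Triangle.coyoneda_exact₂ _ hT'' f (by
      change f ≫ g ≫ b = 0
      rw [reassoc_of% hfg, zero_comp])
  rw [hk, h0.eq_of_tgt k 0, zero_comp]

/-- The triangle makes `f` a kernel of `g` and `g` a cokernel of `f`. The heart is used only as a
preadditive category, so exactness is given by explicit left and right homology data with zero
homology. -/
lemma shortExact_of_distTriang {X Y Z : t.heart.FullSubcategory} (f : X ⟶ Y) (g : Y ⟶ Z)
    (h : Z.obj ⟶ X.obj⟦(1 : ℤ)⟧) (hT : Triangle.mk f.hom g.hom h ∈ distTriang C)
    (hfg : f ≫ g = 0) : (ShortComplex.mk f g hfg).ShortExact := by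
  have hm : Mono f := heart_mono_of_distTriang t f Z.property g.hom h hT
  have he : Epi g := heart_epi_of_distTriang t g X.property f.hom h hT
  have hk : ∀ {W : t.heart.FullSubcategory} (k : W ⟶ Y), k ≫ g = 0 → ∃ l, l ≫ f = k := by
    intro W k hk
    obtain ⟨l, hl⟩ := Triangle.coyoneda_exact₂ _ hT k.hom (congrArg (fun f => f.hom) hk)
    exact ⟨⟨l⟩, by ext; exact hl.symm⟩
  have hc : ∀ {W : t.heart.FullSubcategory} (k : Y ⟶ W), f ≫ k = 0 → ∃ l, g ≫ l = k := by
    intro W k hk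
    obtain ⟨l, hl⟩ := Triangle.yoneda_exact₂ _ hT k.hom (congrArg (fun f => f.hom) hk)
    exact ⟨⟨l⟩, by ext; exact hl.symm⟩
  let O : t.heart.FullSubcategory := ⟨0, heart_of_isZero t (isZero_zero C)⟩
  have hO : IsZero O := (isZero_fullSubcategory_iff _).2 (isZero_zero C)
  let hf : IsLimit (KernelFork.ofι f hfg) :=
    KernelFork.IsLimit.ofι' f hfg fun k hk' => ⟨(hk k hk').choose, (hk k hk').choose_spec⟩
  let hg : IsColimit (CokernelCofork.ofπ g hfg) :=
    CokernelCofork.IsColimit.ofπ' g hfg fun k hk' => ⟨(hc k hk').choose, (hc k hk').choose_spec⟩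
  let a : X ⟶ X := hf.lift (KernelFork.ofι f hfg)
  have ha : a = 𝟙 X := by
    rw [← cancel_mono f, Category.id_comp]
    exact hf.fac (KernelFork.ofι f hfg) WalkingParallelPair.zero
  let c : Z ⟶ Z := hg.desc (CokernelCofork.ofπ g hfg)
  have hc : c = 𝟙 Z := by
    rw [← cancel_epi g, Category.comp_id]
    exact hg.fac (CokernelCofork.ofπ g hfg) WalkingParallelPair.one
  have : Epi (0 : X ⟶ O) := ⟨fun _ _ _ => hO.eq_of_src _ _⟩
  have : Mono (0 : O ⟶ Z) := ⟨fun _ _ _ => hO.eq_of_tgt _ _⟩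
  let l : (ShortComplex.mk f g hfg).LeftHomologyData :=
    { K := X, H := O, i := f, π := 0, wi := hfg, hi := hf, wπ := comp_zero
      hπ := CokernelCofork.IsColimit.ofπ' _ _ fun k hk' => ⟨0, by
        have hk'' : a ≫ k = 0 := hk'
        rw [ha, Category.id_comp] at hk''
        rw [hk'', comp_zero]⟩ }
  let r : (ShortComplex.mk f g hfg).RightHomologyData :=
    { Q := Z, H := O, p := g, ι := 0, wp := hfg, hp := hg, wι := zero_comp
      hι := KernelFork.IsLimit.ofι' _ _ fun k hk' => ⟨0, by
        have hk'' : k ≫ c = 0 := hk'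
        rw [hc, Category.comp_id] at hk''
        rw [hk'', zero_comp]⟩ }
  exact { exact := ⟨⟨⟨l, r, Iso.refl O, by
            change (0 : X ⟶ O) ≫ 𝟙 O ≫ (0 : O ⟶ Z) = f ≫ g
            rw [hfg, zero_comp]⟩, hO⟩⟩
          mono_f := hm, epi_g := he }

/-- An epimorphism with cone in the heart has zero cone. Balancedness is what makes the second map
of a short exact sequence a cokernel in `tri_of_shortExact`. -/
instance : Balanced t.heart.FullSubcategory where
  isIso_of_mono_of_epi {X Y} f _ _ := by
    obtain ⟨Q, g, h, hQ, hT⟩ := exists_distTriang_of_mono t f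
    let g' : Y ⟶ ⟨Q, hQ⟩ := ⟨g⟩
    have hg' : f ≫ g' = 0 := by
      ext
      exact comp_distTriang_mor_zero₁₂ _ hT
    have hg : g = 0 := congrArg (fun f => f.hom) (zero_of_epi_comp f hg')
    have hQ0 : IsZero Q := (IsZero.iff_id_eq_zero Q).2 <| by
      obtain ⟨b, hb⟩ := Triangle.yoneda_exact₃ _ hT (𝟙 Q) (by
        change g ≫ 𝟙 Q = 0
        rw [hg, zero_comp])
      have hb0 : b = 0 := homZero_of_le_of_ge t (t.le_shift 0 1 (-1) (by omega) _ X.property.1)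
        hQ.2 (by omega) b
      rw [hb, hb0]
      exact comp_zero
    have : IsIso f.hom := (Triangle.isZero₃_iff_isIso₁ _ hT).1 hQ0
    have : IsIso (t.heart.ι.map f) := this
    exact isIso_of_fully_faithful t.heart.ι f

lemma tri_of_shortExact {X Y Z : t.heart.FullSubcategory} (f : X ⟶ Y) (g : Y ⟶ Z)
    (hfg : f ≫ g = 0) (hS : (ShortComplex.mk f g hfg).ShortExact) : Tri X.obj Y.obj Z.obj := by
  have hm : Mono f := hS.mono_f
  have he : Epi g := hS.epi_g
  obtain ⟨Q, p, h, hQ, hT⟩ := exists_distTriang_of_mono t f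
  let Q' : t.heart.FullSubcategory := ⟨Q, hQ⟩
  let p' : Y ⟶ Q' := ⟨p⟩
  have hp' : f ≫ p' = 0 := by
    ext
    exact comp_distTriang_mor_zero₁₂ _ hT
  have hpe : Epi p' := heart_epi_of_distTriang t p' X.property f.hom h hT
  -- `Z` and the cone `Q` are both cokernels of `f`; `a` and `b` are the resulting mutually inverse
  -- comparison maps.
  obtain ⟨a, ha⟩ : ∃ a : Z ⟶ Q', g ≫ a = p' :=
    ⟨_, hS.gIsCokernel.fac (CokernelCofork.ofπ p' hp') WalkingParallelPair.one⟩
  obtain ⟨b, hb⟩ : ∃ b : Q ⟶ Z.obj, g.hom = p ≫ b :=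
    Triangle.yoneda_exact₂ _ hT g.hom (congrArg (fun f => f.hom) hfg)
  let b' : Q' ⟶ Z := ⟨b⟩
  have hb' : p' ≫ b' = g := by
    ext
    exact hb.symm
  let e : Q' ≅ Z := ⟨b', a, by rw [← cancel_epi p', reassoc_of% hb', ha, Category.comp_id],
    by rw [← cancel_epi g, reassoc_of% ha, hb', Category.comp_id]⟩
  exact Tri.iso ⟨f.hom, p, h, hT⟩ (Iso.refl _) (Iso.refl _) (t.heart.ι.mapIso e)

end Heart

/-! ### Phases in the strict upper half plane -/

section UpperHalf

/-- The complex number `exp(iπφ)`. -/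
noncomputable def unitPhase (φ : ℝ) : ℂ := Complex.exp (Real.pi * φ * Complex.I)

lemma unitPhase_re (φ : ℝ) : (unitPhase φ).re = Real.cos (Real.pi * φ) := by
  rw [unitPhase, ← Complex.ofReal_mul, Complex.exp_ofReal_mul_I_re]

lemma unitPhase_im (φ : ℝ) : (unitPhase φ).im = Real.sin (Real.pi * φ) := by
  rw [unitPhase, ← Complex.ofReal_mul, Complex.exp_ofReal_mul_I_im]

lemma unitPhase_add (φ ψ : ℝ) : unitPhase (φ + ψ) = unitPhase φ * unitPhase ψ := by
  rw [unitPhase, unitPhase, unitPhase, ← Complex.exp_add]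
  push_cast
  ring_nf

lemma unitPhase_one : unitPhase 1 = -1 := by
  simp [unitPhase, Complex.exp_pi_mul_I]

lemma unitPhase_zero : unitPhase 0 = 1 := by
  simp [unitPhase]

lemma phase_polar {m φ : ℝ} (hm : 0 < m) (h₀ : -1 < φ) (h₁ : φ ≤ 1) :
    phase (m * unitPhase φ) = φ := by
  have h : (m * unitPhase φ : ℂ) =
      m * (Complex.cos ((Real.pi * φ : ℝ) : ℂ) + Complex.sin ((Real.pi * φ : ℝ) : ℂ) * Complex.I) := by
    rw [unitPhase, ← Complex.ofReal_mul, Complex.exp_mul_I]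
  rw [phase, h, Complex.arg_mul_cos_add_sin_mul_I hm]
  · field_simp
  · constructor <;> nlinarith [Real.pi_pos]

lemma exists_polar {z : ℂ} (hz : z ∈ upperHalf) :
    ∃ m : ℝ, 0 < m ∧ 0 < phase z ∧ phase z ≤ 1 ∧ z = m * unitPhase (phase z) := by
  obtain ⟨m, φ, hm, h₀, h₁, rfl⟩ := hz
  have := phase_polar hm (by linarith) h₁
  rw [unitPhase] at this
  rw [this]
  exact ⟨m, hm, h₀, h₁, rfl⟩

lemma polar_mem_upperHalf {m φ : ℝ} (hm : 0 < m) (h₀ : 0 < φ) (h₁ : φ ≤ 1) :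
    (m * unitPhase φ : ℂ) ∈ upperHalf :=
  ⟨m, φ, hm, h₀, h₁, rfl⟩

lemma unitPhase_mem_upperHalf {φ : ℝ} (h₀ : 0 < φ) (h₁ : φ ≤ 1) : unitPhase φ ∈ upperHalf := by
  simpa using polar_mem_upperHalf one_pos h₀ h₁

lemma phase_unitPhase {φ : ℝ} (h₀ : 0 < φ) (h₁ : φ ≤ 1) : phase (unitPhase φ) = φ := by
  simpa using phase_polar one_pos (by linarith) h₁

/-- The oriented area of the parallelogram spanned by `z` and `w`. -/
def cross (z w : ℂ) : ℝ := z.re * w.im - z.im * w.re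

lemma cross_add_left (x y w : ℂ) : cross (x + y) w = cross x w + cross y w := by
  simp [cross]; ring

lemma cross_add_right (w x y : ℂ) : cross w (x + y) = cross w x + cross w y := by
  simp [cross]; ring

lemma cross_polar (m n φ ψ : ℝ) :
    cross (m * unitPhase φ) (n * unitPhase ψ) = m * n * Real.sin (Real.pi * (ψ - φ)) := by
  simp only [cross, Complex.mul_re, Complex.mul_im, Complex.ofReal_re, Complex.ofReal_im,
    unitPhase_re, unitPhase_im]
  rw [mul_sub Real.pi, Real.sin_sub]
  ring

lemma sin_pi_mul_nonneg_iff {x : ℝ} (h : -1 < x) (h' : x < 1) :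
    0 ≤ Real.sin (Real.pi * x) ↔ 0 ≤ x := by
  refine ⟨fun hs => ?_, fun hx => Real.sin_nonneg_of_nonneg_of_le_pi
    (mul_nonneg Real.pi_pos.le hx) (by nlinarith [Real.pi_pos])⟩
  by_contra! hx
  exact absurd (Real.sin_neg_of_neg_of_neg_pi_lt (mul_neg_of_pos_of_neg Real.pi_pos hx)
    (by nlinarith [Real.pi_pos])) (not_lt.2 hs)

/-- Two phases in `(0,1]` differ by less than `1`, so `sin (π (ψ - φ))` has the sign of `ψ - φ`. As
`cross` is biadditive, see-saw arguments on phases become linear inequalities. -/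
lemma phase_le_iff {z w : ℂ} (hz : z ∈ upperHalf) (hw : w ∈ upperHalf) :
    phase z ≤ phase w ↔ 0 ≤ cross z w := by
  obtain ⟨m, hm, h₀, h₁, hz'⟩ := exists_polar hz
  obtain ⟨n, hn, h₂, h₃, hw'⟩ := exists_polar hw
  rw [hz', hw', cross_polar, ← hz', ← hw', mul_nonneg_iff_of_pos_left (mul_pos hm hn),
    sin_pi_mul_nonneg_iff (by linarith) (by linarith), sub_nonneg]

lemma cross_swap (z w : ℂ) : cross z w = -cross w z := by
  simp [cross]; ring

lemma phase_lt_iff {z w : ℂ} (hz : z ∈ upperHalf) (hw : w ∈ upperHalf) :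
    phase z < phase w ↔ 0 < cross z w := by
  rw [← not_le, phase_le_iff hw hz, cross_swap, not_le, neg_lt_zero]

lemma mem_upperHalf_iff {z : ℂ} : z ∈ upperHalf ↔ 0 < z.im ∨ (z.im = 0 ∧ z.re < 0) := by
  constructor
  · intro hz
    obtain ⟨m, hm, h₀, h₁, hz'⟩ := exists_polar hz
    have him : z.im = m * Real.sin (Real.pi * phase z) := by
      conv_lhs => rw [hz']
      simp [unitPhase_im, unitPhase_re]
    have hre : z.re = m * Real.cos (Real.pi * phase z) := by
      conv_lhs => rw [hz']
      simp [unitPhase_im, unitPhase_re]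
    rcases h₁.lt_or_eq with h₁ | h₁
    · left
      rw [him]
      exact mul_pos hm (Real.sin_pos_of_pos_of_lt_pi (mul_pos Real.pi_pos h₀)
        (by nlinarith [Real.pi_pos]))
    · right
      rw [him, hre, h₁]
      simp [hm]
  · intro h
    have hz0 : z ≠ 0 := by
      rintro rfl
      simp at h
    have h0 : 0 < Complex.arg z := by
      rcases h with h | ⟨h, h'⟩
      · exact lt_of_le_of_ne (Complex.arg_nonneg_iff.2 h.le) fun h0 =>
          h.ne' (Complex.arg_eq_zero_iff.1 h0.symm).2
      · rw [Complex.arg_eq_pi_iff.2 ⟨h', h⟩]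
        exact Real.pi_pos
    refine ⟨‖z‖, Complex.arg z / Real.pi, norm_pos_iff.2 hz0, div_pos h0 Real.pi_pos,
      (div_le_one Real.pi_pos).2 (Complex.arg_le_pi z), ?_⟩
    have : (Real.pi : ℂ) * ((Complex.arg z / Real.pi : ℝ) : ℂ) = Complex.arg z := by
      rw [← Complex.ofReal_mul]
      congr 1
      field_simp
    rw [this, Complex.norm_mul_exp_arg_mul_I]

lemma upperHalf_add {z w : ℂ} (hz : z ∈ upperHalf) (hw : w ∈ upperHalf) : z + w ∈ upperHalf := by
  rw [mem_upperHalf_iff] at *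
  simp only [Complex.add_re, Complex.add_im]
  rcases hz with hz | ⟨hz, hz'⟩ <;> rcases hw with hw | ⟨hw, hw'⟩
  · left; linarith
  · left; linarith
  · left; linarith
  · right; constructor <;> linarith

lemma neg_notMem_upperHalf {z : ℂ} (hz : z ∈ upperHalf) : -z ∉ upperHalf := by
  intro hw
  rw [mem_upperHalf_iff] at *
  simp only [Complex.neg_re, Complex.neg_im] at hw
  rcases hz with hz | ⟨hz, hz'⟩ <;> rcases hw with hw | ⟨hw, hw'⟩ <;> linarith

lemma ne_zero_of_mem_upperHalf {z : ℂ} (hz : z ∈ upperHalf) : z ≠ 0 := by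
  rintro rfl
  simp [mem_upperHalf_iff] at hz

lemma phase_pos {z : ℂ} (hz : z ∈ upperHalf) : 0 < phase z := (exists_polar hz).choose_spec.2.1

lemma phase_le_one {z : ℂ} (hz : z ∈ upperHalf) : phase z ≤ 1 :=
  (exists_polar hz).choose_spec.2.2.1

lemma phase_add_le {z w : ℂ} {b : ℝ} (hz : z ∈ upperHalf) (hw : w ∈ upperHalf)
    (hzb : phase z ≤ b) (hwb : phase w ≤ b) : phase (z + w) ≤ b := by
  rcases lt_or_ge 1 b with hb | hb
  · exact (phase_le_one (upperHalf_add hz hw)).trans hb.le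
  have hb₀ : 0 < b := (phase_pos hz).trans_le hzb
  have hβ := unitPhase_mem_upperHalf hb₀ hb
  rw [← phase_unitPhase hb₀ hb] at hzb hwb ⊢
  rw [phase_le_iff hz hβ] at hzb
  rw [phase_le_iff hw hβ] at hwb
  rw [phase_le_iff (upperHalf_add hz hw) hβ, cross_add_left]
  exact add_nonneg hzb hwb

lemma lt_phase_add {z w : ℂ} {a : ℝ} (hz : z ∈ upperHalf) (hw : w ∈ upperHalf)
    (hza : a < phase z) (hwa : a < phase w) : a < phase (z + w) := by
  rcases le_or_gt a 0 with ha | ha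
  · exact ha.trans_lt (phase_pos (upperHalf_add hz hw))
  have ha₁ : a ≤ 1 := hza.le.trans (phase_le_one hz)
  have hα := unitPhase_mem_upperHalf ha ha₁
  rw [← phase_unitPhase ha ha₁] at hza hwa ⊢
  rw [phase_lt_iff hα hz] at hza
  rw [phase_lt_iff hα hw] at hwa
  rw [phase_lt_iff hα (upperHalf_add hz hw), cross_add_right]
  exact add_pos hza hwa

end UpperHalf

/-! ### Charges of objects with phases in a given interval -/

section Charge

variable {C : Type u} [Category.{v} C] [Preadditive C] [HasZeroObject C] [HasShift C ℤ]
  [∀ n : ℤ, (shiftFunctor C n).Additive] [Pretriangulated C]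

/-- The charge of a nonzero object of `P φ` lies on the ray of phase `φ`. -/
def PreStab (W : K0 C →+ ℂ) (P : ℝ → ObjectProperty C) : Prop :=
  ∀ (φ : ℝ) (E : C), P φ E → ¬ IsZero E → ∃ m : ℝ, 0 < m ∧ W (K0.of E) = m * unitPhase φ

variable {W : K0 C →+ ℂ} {P : ℝ → ObjectProperty C} {S : Set ℝ}

/-- The charge is the sum of those of the nonzero factors. Zero factors must be skipped because `K`
is not assumed to contain `0`; in the main uses it is a half plane or sector without it. -/
lemma Filt.charge_mem {K : Set ℂ} (hK : ∀ x ∈ K, ∀ y ∈ K, x + y ∈ K) {E : C} (h : Filt P S E)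
    (hS : ∀ φ ∈ S, ∀ A, P φ A → ¬ IsZero A → W (K0.of A) ∈ K) (hE : ¬ IsZero E) :
    W (K0.of E) ∈ K := by
  induction h with
  | zero S E hE' => exact absurd hE' hE
  | step S φ E₀ E A h hA hφ h₀ ih =>
    by_cases hA₀ : IsZero A
    · obtain ⟨e⟩ := h.iso_of_isZero₃ hA₀
      rw [← K0.of_iso e]
      exact ih (fun φ hφ => hS φ hφ.1) fun h => hE (h.of_iso e.symm)
    by_cases hE₀ : IsZero E₀
    · obtain ⟨e⟩ := h.iso_of_isZero₁ hE₀
      rw [K0.of_iso e]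
      exact hS φ hφ A hA hA₀
    · rw [h.k0, map_add]
      exact hK _ (ih (fun φ hφ => hS φ hφ.1) hE₀) _ (hS φ hφ A hA hA₀)

lemma polar_mul_unitPhase (m φ ψ : ℝ) :
    (m * unitPhase φ * unitPhase ψ : ℂ) = m * unitPhase (φ + ψ) := by
  rw [unitPhase_add, mul_assoc]

namespace PreStab

variable (hW : PreStab W P)
include hW

/-- Multiplication by `exp(-iπφ)` carries the rays of phase in `(φ, φ+1]` into the strict upper half
plane, which is closed under addition. -/
lemma rotate_mem {φ : ℝ} {E : C} (h : Filt P (Set.Ioc φ (φ + 1)) E) (hE : ¬ IsZero E) :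
    W (K0.of E) * unitPhase (-φ) ∈ upperHalf := by
  refine h.charge_mem (K := {z | z * unitPhase (-φ) ∈ upperHalf}) (fun x hx y hy => ?_)
    (fun ψ hψ A hA hA₀ => ?_) hE
  · simp only [Set.mem_ofPred_eq] at hx hy ⊢
    rw [add_mul]
    exact upperHalf_add hx hy
  · obtain ⟨m, hm, hm'⟩ := hW ψ A hA hA₀
    rw [Set.mem_ofPred_eq, hm', polar_mul_unitPhase]
    exact polar_mem_upperHalf hm (by linarith [hψ.1]) (by linarith [hψ.2])

lemma neg_rotate_mem {φ : ℝ} {E : C} (h : Filt P (Set.Ioc (φ - 1) φ) E) (hE : ¬ IsZero E) :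
    -(W (K0.of E) * unitPhase (-φ)) ∈ upperHalf := by
  have := hW.rotate_mem (φ := φ - 1) (by rwa [sub_add_cancel]) hE
  rwa [neg_sub, sub_eq_neg_add, unitPhase_add, unitPhase_one, mul_neg, mul_neg, mul_one] at this

lemma phase_mem {a b : ℝ} {E : C} (h : Filt P (Set.Ioc a b) E) (ha : 0 ≤ a) (hb : b ≤ 1)
    (hE : ¬ IsZero E) :
    W (K0.of E) ∈ upperHalf ∧ phase (W (K0.of E)) ∈ Set.Ioc a b := by
  refine h.charge_mem (K := {z | z ∈ upperHalf ∧ phase z ∈ Set.Ioc a b})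
    (fun x hx y hy => ?_) (fun ψ hψ A hA hA₀ => ?_) hE
  · exact ⟨upperHalf_add hx.1 hy.1, lt_phase_add hx.1 hy.1 hx.2.1 hy.2.1,
      phase_add_le hx.1 hy.1 hx.2.2 hy.2.2⟩
  · obtain ⟨m, hm, hm'⟩ := hW ψ A hA hA₀
    change _ ∈ upperHalf ∧ _
    have h₀ : 0 < ψ := ha.trans_lt hψ.1
    have h₁ : ψ ≤ 1 := hψ.2.trans hb
    rw [hm', phase_polar hm (by linarith) h₁]
    exact ⟨polar_mem_upperHalf hm h₀ h₁, hψ⟩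

/-- After rotation by `-φ` each nonzero factor has imaginary part `≤ 0`, with equality only for
phase `φ`. If the sum vanishes, all other factors are zero. -/
lemma filt_of_im_eq_zero {φ : ℝ} {E : C} (h : Filt P S E) (hS : S ⊆ Set.Ioc (φ - 1) φ)
    (hE : (W (K0.of E) * unitPhase (-φ)).im = 0) : Filt P (S ∩ {φ}) E := by
  have key : ∀ {S' : Set ℝ} (E' : C), Filt P S' E' → S' ⊆ Set.Ioc (φ - 1) φ →
      (W (K0.of E') * unitPhase (-φ)).im ≤ 0 := fun E' h' hS' => by
    by_cases hE' : IsZero E'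
    · simp [K0.of_isZero hE']
    · have := mem_upperHalf_iff.1 (hW.neg_rotate_mem (h'.mono hS') hE')
      rw [Complex.neg_im] at this
      rcases this with h | h <;> linarith
  induction h with
  | zero S E hE' => exact .zero _ _ hE'
  | step S ψ E₀ E A h hA hψ h₀ ih =>
    have hS₀ : S ∩ Set.Ioi ψ ⊆ Set.Ioc (φ - 1) φ := Set.inter_subset_left.trans hS
    have h₁ := key E₀ h₀ hS₀
    have h₂ := key A (.single (S := {ψ}) hA rfl) (by simpa using hS hψ)
    rw [h.k0, map_add, add_mul, Complex.add_im] at hE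
    rcases (hS hψ).2.lt_or_eq with hlt | rfl
    · have hA₀ : IsZero A := by
        by_contra hA₀
        obtain ⟨m, hm, hm'⟩ := hW ψ A hA hA₀
        have h₃ : Real.sin (Real.pi * (ψ + -φ)) < 0 := by
          have := (hS hψ).1
          exact Real.sin_neg_of_neg_of_neg_pi_lt (by nlinarith [Real.pi_pos])
            (by nlinarith [Real.pi_pos])
        rw [hm', polar_mul_unitPhase, Complex.im_ofReal_mul, unitPhase_im] at hE
        nlinarith
      obtain ⟨e⟩ := h.iso_of_isZero₃ hA₀
      refine ((ih hS₀ (by linarith)).iso e).mono ?_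
      rintro x ⟨⟨hx, -⟩, hx'⟩
      exact ⟨hx, hx'⟩
    · refine .step _ ψ _ _ _ h hA ⟨hψ, rfl⟩ (h₀.mono ?_)
      rintro x ⟨hx, hx'⟩
      exact absurd (hS hx).2 (not_le.2 hx')

lemma mem_of_im_eq_zero (hP : IsSlicing P) {φ : ℝ} {E : C} (h : Filt P (Set.Ioc (φ - 1) φ) E)
    (hE : (W (K0.of E) * unitPhase (-φ)).im = 0) : P φ E :=
  hP.of_filt_singleton ((hW.filt_of_im_eq_zero h le_rfl hE).mono Set.inter_subset_right)

end PreStab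

lemma im_rotate_polar (m φ : ℝ) : ((m * unitPhase φ * unitPhase (-φ) : ℂ)).im = 0 := by
  rw [polar_mul_unitPhase, add_neg_cancel, unitPhase_zero]
  simp

end Charge

/-! ### Semistable objects of `P((0,1])` -/

section Semistable

variable {C : Type u} [Category.{v} C] [Preadditive C] [HasZeroObject C] [HasShift C ℤ]
  [∀ n : ℤ, (shiftFunctor C n).Additive] [Pretriangulated C]

/-- Semistability in a heart `A` in terms of distinguished triangles. -/
def SemistableTri (W : K0 C →+ ℂ) (A : ObjectProperty C) (E : C) : Prop :=
  A E ∧ ¬ IsZero E ∧ ∀ F Q, A F → A Q → Tri F E Q → ¬ IsZero F →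
    phase (W (K0.of F)) ≤ phase (W (K0.of E))

/-- Monomorphisms of a heart are exactly the first maps of triangles with all three vertices in the
heart. -/
lemma semistableIn_iff {Λ : Type*} [AddCommGroup Λ] (v : K0 C →+ Λ) (Z : Λ →+ ℂ)
    {A : ObjectProperty C} (hA : IsBoundedHeart A) (E : C) :
    SemistableIn v Z A E ↔ SemistableTri (Z.comp v) A E := by
  obtain ⟨t, -, rfl⟩ := hA
  constructor
  · rintro ⟨hE, h₀, h⟩
    refine ⟨hE, fun h => h₀ ((isZero_fullSubcategory_iff _).2 h), fun F Q hF hQ hT hF₀ => ?_⟩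
    obtain ⟨f, g, k, hT⟩ := hT
    let f' : (⟨F, hF⟩ : t.heart.FullSubcategory) ⟶ ⟨E, hE⟩ := ⟨f⟩
    exact h f' (heart_mono_of_distTriang t f' hQ g k hT)
      fun h => hF₀ ((isZero_fullSubcategory_iff _).1 h)
  · rintro ⟨hE, h₀, h⟩
    refine ⟨hE, fun h => h₀ ((isZero_fullSubcategory_iff _).1 h), fun F f hf hF₀ => ?_⟩
    obtain ⟨Q, g, k, hQ, hT⟩ := exists_distTriang_of_mono t f
    exact h F.obj Q F.property hQ ⟨f.hom, g, k, hT⟩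
      fun h => hF₀ ((isZero_fullSubcategory_iff _).2 h)

/-- In the heart `P((0,1])` the semistable objects of phase `φ` are the nonzero objects
of `P φ`. -/
lemma mem_iff_semistableTri [IsTriangulated C] {W : K0 C →+ ℂ} {P : ℝ → ObjectProperty C}
    (hP : IsSlicing P) (hW : PreStab W P) {φ : ℝ} (hφ : φ ∈ Set.Ioc (0 : ℝ) 1) (E : C) :
    (P φ E ∧ ¬ IsZero E) ↔
      SemistableTri W (Filt P (Set.Ioc 0 1)) E ∧ phase (W (K0.of E)) = φ := by
  constructor
  · rintro ⟨hE, hE₀⟩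
    obtain ⟨m, hm, hm'⟩ := hW φ E hE hE₀
    have hphase : phase (W (K0.of E)) = φ := by
      rw [hm']; exact phase_polar hm (by linarith [hφ.1]) hφ.2
    refine ⟨⟨.single hE hφ, hE₀, fun F Q hF hQ hT hF₀ => ?_⟩, hphase⟩
    rw [hphase]
    -- A morphism to `F` from phase `> φ` vanishes in `E`, and `Q⟦-1⟧` has phases at most `0`, so it
    -- is already zero.
    have hF' : Filt P (Set.Iic φ) F := hP.filt_Iic_iff.2 fun ψ hψ X hX =>
      hT.invRot.homZero_right
        (hP.homZero_of_filt_right (hP.filt_shift (S' := Set.Iic 0) (-1) hQ fun s hs => by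
          have := hs.2
          simp only [Set.mem_Iic]
          push_cast
          linarith) hX fun s hs => (Set.mem_Iic.1 hs).trans_lt (hφ.1.trans hψ))
        (hP.hom_zero hψ hX hE)
    exact (hW.phase_mem (hP.filt_Ioc (hF.mono fun x hx => hx.1) hF') le_rfl hφ.2 hF₀).2.2
  · rintro ⟨⟨hE, hE₀, h⟩, rfl⟩
    refine ⟨?_, hE₀⟩
    obtain ⟨m, hm, -, -, hm'⟩ := exists_polar (hW.phase_mem hE le_rfl le_rfl hE₀).1
    -- Truncate at the phase of `E` itself: the part of larger phase would destabilize `E`, so all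
    -- phases are at most that of `E`. As the charge of `E` lies on the extreme ray, only that phase
    -- occurs.
    obtain ⟨E', E'', hT, hE', hE''⟩ := hE.truncate (phase (W (K0.of E)))
    have hz : IsZero E' := by
      by_contra hz
      have h₁ := h E' E'' (hE'.mono Set.inter_subset_left) (hE''.mono Set.inter_subset_left) hT hz
      have h₂ := (hW.phase_mem (a := phase (W (K0.of E))) (b := 1)
        (hE'.mono fun x hx => ⟨hx.2, hx.1.2⟩) hφ.1.le le_rfl hz).2.1
      exact absurd h₁ (not_le.2 h₂)
    obtain ⟨e⟩ := hT.iso_of_isZero₁ hz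
    refine hW.mem_of_im_eq_zero hP ((hE''.iso e.symm).mono fun x hx =>
      ⟨by linarith [hx.1.1, hφ.2], hx.2⟩) ?_
    have := im_rotate_polar m (phase (W (K0.of E)))
    rwa [← hm'] at this

end Semistable

/-! ### The slicing attached to a heart with stability function -/

section HeartSlicing

variable {C : Type u} [Category.{v} C] [Preadditive C] [HasZeroObject C] [HasShift C ℤ]
  [∀ n : ℤ, (shiftFunctor C n).Additive] [Pretriangulated C]

lemma charge_shift (W : K0 C →+ ℂ) (X : C) (n : ℤ) :
    W (K0.of (X⟦n⟧)) = unitPhase n * W (K0.of X) := by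
  induction n using Int.induction_on with
  | zero =>
    rw [K0.of_iso ((shiftFunctorZero C ℤ).app X), Int.cast_zero, unitPhase_zero, one_mul]
    rfl
  | succ n ih =>
    rw [K0.of_iso ((shiftFunctorAdd C (n : ℤ) 1).app X)]
    change W (K0.of ((X⟦(n : ℤ)⟧)⟦(1 : ℤ)⟧)) = _
    rw [K0.of_shift_one, map_neg, ih, Int.cast_add, unitPhase_add, Int.cast_one, unitPhase_one]
    ring
  | pred n ih =>
    rw [K0.of_iso ((shiftFunctorAdd' C (-(n : ℤ) - 1) 1 (-n) (by ring)).app X)] at ih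
    change W (K0.of ((X⟦-(n : ℤ) - 1⟧)⟦(1 : ℤ)⟧)) = _ at ih
    have h : unitPhase ((-(n : ℤ) : ℤ) : ℝ) = -unitPhase ((-(n : ℤ) - 1 : ℤ) : ℝ) := by
      rw [← sub_add_cancel (-(n : ℤ)) 1, Int.cast_add, unitPhase_add, Int.cast_one, unitPhase_one,
        add_sub_cancel_right]
      ring
    rw [K0.of_shift_one, map_neg, h, neg_mul, neg_inj] at ih
    exact ih

lemma SemistableTri.iso {W : K0 C →+ ℂ} {A : ObjectProperty C} [A.IsClosedUnderIsomorphisms]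
    {X Y : C} (h : SemistableTri W A X) (e : X ≅ Y) : SemistableTri W A Y := by
  refine ⟨A.prop_of_iso e h.1, fun h0 => h.2.1 (h0.of_iso e), fun F Q hF hQ hT hF₀ => ?_⟩
  rw [← K0.of_iso e]
  exact h.2.2 F Q hF hQ (hT.iso (Iso.refl _) e.symm (Iso.refl _)) hF₀

/-- The family `P` with `P φ` the semistable objects of phase `φ` of the heart `A`
for `φ ∈ (0,1]` and `P (φ + 1) = P φ⟦1⟧`. -/
def heartSlicing (W : K0 C →+ ℂ) (A : ObjectProperty C) (φ : ℝ) : ObjectProperty C := fun E =>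
  IsZero E ∨ (SemistableTri W A (E⟦-(⌈φ⌉ - 1)⟧) ∧
    phase (W (K0.of (E⟦-(⌈φ⌉ - 1)⟧))) = φ - (⌈φ⌉ - 1 : ℤ))

variable {W : K0 C →+ ℂ} {A : ObjectProperty C}

/-- `⌈φ⌉ - 1` is the integer `n` with `φ - n ∈ (0,1]`; writing the phase as `φ + n` removes the
ceiling from the later arguments. -/
lemma heartSlicing_add_int_iff {φ : ℝ} (hφ : φ ∈ Set.Ioc (0 : ℝ) 1) (n : ℤ) (E : C) :
    heartSlicing W A (φ + n) E ↔
      IsZero E ∨ (SemistableTri W A (E⟦-n⟧) ∧ phase (W (K0.of (E⟦-n⟧))) = φ) := by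
  have h : ⌈φ + n⌉ - 1 = n := by
    have : ⌈φ⌉ = 1 := Int.ceil_eq_iff.2 ⟨by simpa using hφ.1, by simpa using hφ.2⟩
    rw [Int.ceil_add_intCast, this]
    ring
  rw [heartSlicing, h, add_sub_cancel_right]

lemma exists_eq_add_int (φ : ℝ) : ∃ ψ ∈ Set.Ioc (0 : ℝ) 1, ∃ n : ℤ, φ = ψ + n := by
  refine ⟨φ - (⌈φ⌉ - 1 : ℤ), ⟨?_, ?_⟩, ⌈φ⌉ - 1, by ring⟩
  · push_cast
    linarith [Int.ceil_lt_add_one φ]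
  · push_cast
    linarith [Int.le_ceil φ]

lemma heartSlicing_iff [A.IsClosedUnderIsomorphisms] {φ : ℝ} (hφ : φ ∈ Set.Ioc (0 : ℝ) 1) (E : C) :
    heartSlicing W A φ E ↔ IsZero E ∨ (SemistableTri W A E ∧ phase (W (K0.of E)) = φ) := by
  have h := heartSlicing_add_int_iff (W := W) (A := A) hφ 0 E
  have e : E⟦-(0 : ℤ)⟧ ≅ E := (shiftFunctorZero' C (-(0 : ℤ)) neg_zero).app E
  rw [Int.cast_zero, add_zero, K0.of_iso e] at h
  rw [h]
  exact or_congr_right (and_congr_left fun _ => ⟨fun h => h.iso e, fun h => h.iso e.symm⟩)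

lemma heartSlicing_shift [A.IsClosedUnderIsomorphisms] (n : ℤ) (φ : ℝ) (E : C)
    (h : heartSlicing W A φ E) : heartSlicing W A (φ + n) (E⟦n⟧) := by
  obtain ⟨ψ, hψ, k, rfl⟩ := exists_eq_add_int φ
  rw [heartSlicing_add_int_iff hψ] at h
  rw [add_assoc, ← Int.cast_add, heartSlicing_add_int_iff hψ]
  have e : E⟦-k⟧ ≅ (E⟦n⟧)⟦-(k + n)⟧ := (shiftFunctorAdd' C n (-(k + n)) (-k) (by ring)).app E
  rw [← K0.of_iso e]
  exact h.imp (isZero_shift_iff E n).2 fun h => ⟨h.1.iso e, h.2⟩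

lemma heartSlicing_iso [A.IsClosedUnderIsomorphisms] (φ : ℝ) {X Y : C} (e : X ≅ Y)
    (h : heartSlicing W A φ X) : heartSlicing W A φ Y := by
  have e' := (shiftFunctor C (-(⌈φ⌉ - 1))).mapIso e
  rw [heartSlicing, ← K0.of_iso e']
  exact h.imp (fun h => h.of_iso e.symm) fun h => ⟨h.1.iso e', h.2⟩

variable (t : TStructure C)

/-- The image of a nonzero morphism is a quotient of `X`, so of phase at least that of `X`, and a
subobject of `Y`, so of phase at most that of `Y`. -/
lemma homZero_of_semistableTri [IsTriangulated C]
    (hW : ∀ E, t.heart E → ¬ IsZero E → W (K0.of E) ∈ upperHalf) {X Y : C}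
    (hX : SemistableTri W t.heart X) (hY : SemistableTri W t.heart Y)
    (h : phase (W (K0.of Y)) < phase (W (K0.of X))) : HomZero X Y := by
  intro f
  by_contra hf
  obtain ⟨K, I, Q, hK, hI, hQ, hT, hT', hI₀⟩ := exists_image t hX.1 hY.1 f hf
  have h₁ := hY.2.2 I Q hI hQ hT' hI₀
  have h₂ : phase (W (K0.of X)) ≤ phase (W (K0.of I)) := by
    by_cases hK₀ : IsZero K
    · obtain ⟨e⟩ := hT.iso_of_isZero₁ hK₀
      rw [K0.of_iso e]
    · have h₃ := hX.2.2 K I hK hI hT hK₀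
      have hX' := hW X hX.1 hX.2.1
      rw [phase_le_iff (hW K hK hK₀) hX', hT.k0, map_add, cross_add_right] at h₃
      rw [phase_le_iff hX' (hW I hI hI₀), hT.k0, map_add, cross_add_left]
      simp only [cross] at h₃ ⊢
      linarith
  linarith

/-- Morphisms vanish by the t-structure when the integer parts of the phases differ, and by
semistability when they agree. The filtration of `E` concatenates shifted filtrations of its
cohomology objects: the piece in degree `b` has phases in `(-b, 1-b]`, the earlier ones phases above
`1-b`. -/
lemma isSlicing_heartSlicing [IsTriangulated C] (ht : ∀ X, t.bounded X)
    (hW : ∀ E, t.heart E → ¬ IsZero E → W (K0.of E) ∈ upperHalf)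
    (hF : ∀ E, t.heart E → Filt (heartSlicing W t.heart) (Set.Ioc 0 1) E) :
    IsSlicing (heartSlicing W t.heart) where
  iso_mem φ _ _ e h := heartSlicing_iso φ e h
  zero_mem φ _ h := Or.inl h
  shift_iff φ X := by
    refine ⟨fun h => ?_, fun h => by simpa using heartSlicing_shift 1 φ X h⟩
    have h' := heartSlicing_shift (-1) _ _ h
    rw [Int.cast_neg, Int.cast_one, add_neg_cancel_right] at h'
    exact heartSlicing_iso φ ((shiftEquiv C (1 : ℤ)).unitIso.symm.app X) h'
  hom_zero {φ₁ φ₂} h X Y hX hY := by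
    obtain ⟨ψ₁, hψ₁, n₁, rfl⟩ := exists_eq_add_int φ₁
    obtain ⟨ψ₂, hψ₂, n₂, rfl⟩ := exists_eq_add_int φ₂
    rw [heartSlicing_add_int_iff hψ₁] at hX
    rw [heartSlicing_add_int_iff hψ₂] at hY
    rcases hX with hX | ⟨hX, hX'⟩
    · exact homZero_of_isZero_left hX _
    rcases hY with hY | ⟨hY, hY'⟩
    · exact homZero_of_isZero_right _ hY
    have hn : n₂ ≤ n₁ := by
      have : (n₂ : ℝ) < n₁ + 1 := by linarith [hψ₁.2, hψ₂.1]
      exact Int.lt_add_one_iff.1 (by exact_mod_cast this)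
    rcases hn.lt_or_eq with hn | rfl
    · exact homZero_of_le_of_ge t (le_of_shift t hX.1.1 (zero_add _))
        (ge_of_shift t hY.1.2 (zero_add _)) (by omega)
    · rw [← homZero_shift_iff X Y (-n₂)]
      exact homZero_of_semistableTri t hW hX hY (by rw [hX', hY']; linarith)
  filt E := by
    obtain ⟨⟨a, ha⟩, ⟨b, hb⟩⟩ := ht E
    refine (bounded_induction t
      (p := fun b X => Filt (heartSlicing W t.heart) (Set.Ioi (-(b : ℝ))) X) a
      (fun b X hX => .zero _ _ hX) ?_ b E ha.ge hb.le).mono (Set.subset_univ _)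
    intro b X' X X'' _ hT hX' hX''
    have h := (hF _ hX'').shift (S' := Set.Ioc (-(b : ℝ)) (1 - b)) (-b)
      (heartSlicing_shift (-b)) fun s hs => by
        push_cast
        exact ⟨by linarith [hs.1], by linarith [hs.2]⟩
    have h' := h.iso ((shiftEquiv C b).unitIso.symm.app X'')
    refine (Filt.ext hT hX' h' fun s hs s' hs' => ?_).mono ?_
    · simp only [Set.mem_Ioi, Int.cast_sub, Int.cast_one] at hs'
      linarith [hs.2]
    · rintro x (hx | hx)
      · exact hx.1
      · simp only [Set.mem_Ioi, Int.cast_sub, Int.cast_one] at hx ⊢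
        linarith

lemma preStab_heartSlicing (hW : ∀ E, A E → ¬ IsZero E → W (K0.of E) ∈ upperHalf) :
    PreStab W (heartSlicing W A) := by
  intro φ E hE hE₀
  obtain ⟨ψ, hψ, n, rfl⟩ := exists_eq_add_int φ
  rw [heartSlicing_add_int_iff hψ] at hE
  obtain ⟨h, h'⟩ := hE.resolve_left hE₀
  obtain ⟨m, hm, -, -, hm'⟩ := exists_polar (hW _ h.1 h.2.1)
  refine ⟨m, hm, ?_⟩
  rw [h', charge_shift] at hm'
  have h1 : unitPhase n * unitPhase ((-n : ℤ) : ℝ) = 1 := by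
    rw [← unitPhase_add, Int.cast_neg, add_neg_cancel, unitPhase_zero]
  calc W (K0.of E) = unitPhase n * (unitPhase ((-n : ℤ) : ℝ) * W (K0.of E)) := by
        rw [← mul_assoc, h1, one_mul]
    _ = m * unitPhase (ψ + n) := by rw [hm', unitPhase_add]; ring

lemma heart_of_filt_heartSlicing {S : Set ℝ} (hS : S ⊆ Set.Ioc 0 1) {E : C}
    (h : Filt (heartSlicing W t.heart) S E) : t.heart E := by
  induction h with
  | zero S E hE => exact heart_of_isZero t hE
  | step S φ E₀ E A hT hA hφ h₀ ih =>
    refine heart_of_tri t hT (ih (Set.inter_subset_left.trans hS)) ?_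
    rw [heartSlicing_iff (hS hφ)] at hA
    exact hA.elim (heart_of_isZero t) fun h => h.1.1

lemma HNChain.filt_heartSlicing {Λ : Type*} [AddCommGroup Λ] {v : K0 C →+ Λ} {Z : Λ →+ ℂ}
    (hW : IsStabilityFunction (charge v Z t.heart)) {E : t.heart.FullSubcategory}
    (F : HNChain (charge v Z t.heart) E) (ht : IsBoundedHeart t.heart) :
    Filt (heartSlicing (Z.comp v) t.heart) (Set.Ioc 0 1) E.obj := by
  have hmem : ∀ j, phase (charge v Z t.heart (F.fac j)) ∈ Set.Ioc (0 : ℝ) 1 := fun j =>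
    have := hW (F.fac j) (F.semistable j).1
    ⟨phase_pos this, phase_le_one this⟩
  have key : ∀ (k : ℕ) (hk : k < F.n + 1), Filt (heartSlicing (Z.comp v) t.heart)
      {x | ∃ j : Fin F.n, j.val < k ∧ x = phase (charge v Z t.heart (F.fac j))}
        (F.obj ⟨k, hk⟩).obj := by
    intro k
    induction k with
    | zero => exact fun _ => .zero _ _ ((isZero_fullSubcategory_iff _).1 F.bot)
    | succ k ih =>
      intro hk
      have hk' : k < F.n := by omega
      refine .step _ (phase (charge v Z t.heart (F.fac ⟨k, hk'⟩))) (F.obj ⟨k, by omega⟩).obj _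
        (F.fac ⟨k, hk'⟩).obj (tri_of_shortExact t _ _ _ (F.shortExact ⟨k, hk'⟩)) ?_
        ⟨⟨k, hk'⟩, Nat.lt_succ_self k, rfl⟩ ((ih (by omega)).mono ?_)
      · rw [heartSlicing_iff (hmem _)]
        exact Or.inr ⟨(semistableIn_iff v Z ht _).1 ⟨_, F.semistable _⟩, rfl⟩
      · rintro x ⟨j, hj, rfl⟩
        exact ⟨⟨j, by omega, rfl⟩, F.strictAnti (Fin.lt_def.2 hj)⟩
  refine ((key F.n (Nat.lt_succ_self _)).iso (t.heart.ι.mapIso F.top)).mono ?_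
  rintro x ⟨j, -, rfl⟩
  exact hmem j

lemma hasHN_of_isSlicing [IsTriangulated C] {Λ : Type*} [AddCommGroup Λ] {v : K0 C →+ Λ}
    {Z : Λ →+ ℂ} {P : ℝ → ObjectProperty C} (hP : IsSlicing P) (hW : PreStab (Z.comp v) P)
    {A : ObjectProperty C} (hA : IsBoundedHeart A) (hAP : A = Filt P (Set.Ioc 0 1)) :
    HasHN (charge v Z A) := by
  have hA' := hA
  obtain ⟨t, -, rfl⟩ := hA
  have hAP' : ∀ X, t.heart X ↔ Filt P (Set.Ioc 0 1) X := fun X => by rw [hAP]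
  have hss' : ∀ φ X, φ ∈ Set.Ioc (0 : ℝ) 1 → P φ X → ¬ IsZero X →
      SemistableTri (Z.comp v) t.heart X ∧ phase (Z.comp v (K0.of X)) = φ := by
    rw [hAP]
    exact fun φ X hφ hX hX₀ => (mem_iff_semistableTri hP hW hφ X).1 ⟨hX, hX₀⟩
  intro E hE
  have hE' : Filt P (Set.Ioc 0 1) E.obj := (hAP' _).1 E.property
  obtain ⟨F, hF⟩ := hE'.exists_hn
  have hobj : ∀ i, t.heart (F.obj i) := fun i => (hAP' _).2 (F.filt_obj hF i)
  have hfac : ∀ i, t.heart (F.fac i) := fun i => (hAP' _).2 (.single (F.mem i) (hF i))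
  have hss : ∀ i, SemistableTri (Z.comp v) t.heart (F.fac i) ∧
      phase (Z.comp v (K0.of (F.fac i))) = F.φ i := fun i =>
    hss' _ _ (hF i) (F.mem i) (F.ne_zero i)
  refine ⟨{ n := F.n, obj := fun i => ⟨F.obj i, hobj i⟩, fac := fun i => ⟨F.fac i, hfac i⟩
            incl := fun i => ⟨F.incl i⟩, proj := fun i => ⟨F.proj i⟩
            incl_proj := fun i => ?_, shortExact := fun i => ?_
            bot := (isZero_fullSubcategory_iff _).2 F.bot
            top := ⟨⟨F.top.hom⟩, ⟨F.top.inv⟩, ?_, ?_⟩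
            semistable := fun i => ?_, strictAnti := ?_ }⟩
  · ext
    exact comp_distTriang_mor_zero₁₂ _ (F.distinguished i)
  · exact shortExact_of_distTriang t _ _ (F.conn i) (F.distinguished i) _
  · ext
    exact F.top.hom_inv_id
  · ext
    exact F.top.inv_hom_id
  · exact ((semistableIn_iff v Z hA' _).2 (hss i).1).choose_spec
  · have : (fun i => phase (charge v Z t.heart ⟨F.fac i, hfac i⟩)) = F.φ :=
      funext fun i => (hss i).2
    rw [this]
    exact F.strictAnti

end HeartSlicing

lemma norm_unitPhase (φ : ℝ) : ‖unitPhase φ‖ = 1 := by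
  rw [unitPhase]
  convert Complex.norm_exp_ofReal_mul_I (Real.pi * φ) using 2
  push_cast
  ring

/-! ### Harder–Narasimhan filtrations from finiteness of destabilizing charges -/

section ExistsHN

variable {C : Type u} [Category.{v} C] [Preadditive C] [HasZeroObject C] [HasShift C ℤ]
  [∀ n : ℤ, (shiftFunctor C n).Additive] [Pretriangulated C]

/-- The charges of the nonzero subobjects of `E` in `A` of phase at least that of `E`. -/
def destabilizing (W : K0 C →+ ℂ) (A : ObjectProperty C) (E : C) : Set ℂ :=
  {w | ∃ F Q, A F ∧ A Q ∧ Tri F E Q ∧ ¬ IsZero F ∧ W (K0.of F) = w ∧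
    phase (W (K0.of E)) ≤ phase w}

lemma exists_max_phase_norm {S : Set ℂ} (hS : S.Finite) (hne : S.Nonempty) :
    ∃ w ∈ S, ∀ z ∈ S, phase z ≤ phase w ∧ (phase z = phase w → ‖z‖ ≤ ‖w‖) := by
  obtain ⟨w₀, hw₀, hmax⟩ := hS.exists_maximalFor phase S hne
  obtain ⟨w, hw, hmax'⟩ := (hS.subset (Set.inter_subset_left (t := {z | phase z = phase w₀}))
    ).exists_maximalFor (‖·‖) _ ⟨w₀, hw₀, rfl⟩
  have hle : ∀ z ∈ S, phase z ≤ phase w₀ := fun z hz => by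
    rcases le_total (phase z) (phase w₀) with h | h
    · exact h
    · exact hmax hz h
  refine ⟨w, hw.1, fun z hz => ⟨(hle z hz).trans_eq hw.2.symm, fun h => ?_⟩⟩
  rcases le_total ‖z‖ ‖w‖ with h' | h'
  · exact h'
  · exact hmax' ⟨hz, h.trans hw.2⟩ h'

variable (t : TStructure C) {W : K0 C →+ ℂ}

/-- Let `F` be a subobject whose charge has maximal phase and, among those, maximal norm. Then `F`
is semistable and `E/F` has fewer destabilizing charges than `E`, so induction applies to `E/F`.
Recording that all phases are at most the phase of some subobject is what allows the strict bound
`hlt` to order the concatenation. -/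
lemma filt_heartSlicing_aux [IsTriangulated C]
    (hW : ∀ E, t.heart E → ¬ IsZero E → W (K0.of E) ∈ upperHalf)
    (hfin : ∀ E, t.heart E → (destabilizing W t.heart E).Finite) (n : ℕ) :
    ∀ E, t.heart E → ¬ IsZero E → (destabilizing W t.heart E).ncard = n →
      ∃ F Q, t.heart F ∧ t.heart Q ∧ Tri F E Q ∧ ¬ IsZero F ∧
        Filt (heartSlicing W t.heart) (Set.Ioc 0 (phase (W (K0.of F)))) E := by
  induction n using Nat.strong_induction_on with
  | h n ih =>
  intro E hE hE₀ hn
  have hid : Tri E E (0 : C) := tri_of_isZero_right (Iso.refl E) (isZero_zero C)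
  have hE' : W (K0.of E) ∈ destabilizing W t.heart E :=
    ⟨E, 0, hE, heart_of_isZero t (isZero_zero C), hid, hE₀, rfl, le_rfl⟩
  obtain ⟨w, ⟨F, Q, hF, hQ, hT, hF₀, rfl, hFE⟩, hmax⟩ :=
    exists_max_phase_norm (hfin E hE) ⟨_, hE'⟩
  have hsub : ∀ G R, t.heart G → t.heart R → Tri G E R → ¬ IsZero G →
      phase (W (K0.of G)) ≤ phase (W (K0.of F)) := by
    intro G R hG hR hT' hG₀
    rcases le_total (phase (W (K0.of E))) (phase (W (K0.of G))) with h | h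
    · exact (hmax _ ⟨G, R, hG, hR, hT', hG₀, rfl, h⟩).1
    · exact h.trans hFE
  have hFu := hW F hF hF₀
  have hFs : heartSlicing W t.heart (phase (W (K0.of F))) F := by
    rw [heartSlicing_iff ⟨phase_pos hFu, phase_le_one hFu⟩]
    refine Or.inr ⟨⟨hF, hF₀, fun G R hG hR hT' hG₀ => ?_⟩, rfl⟩
    obtain ⟨R', h₁, h₂⟩ := hT.assoc' hT'
    exact hsub G R' hG (heart_of_tri t h₂ hR hQ) h₁ hG₀
  refine ⟨F, Q, hF, hQ, hT, hF₀, ?_⟩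
  by_cases hQ₀ : IsZero Q
  · obtain ⟨e⟩ := hT.iso_of_isZero₃ hQ₀
    exact .single (heartSlicing_iso _ e hFs) ⟨phase_pos hFu, le_rfl⟩
  -- If a subobject `G` of `E/F` had phase at least that of `F`, its preimage `H` in `E` would have
  -- that of `F` as well by maximality. Then the charges of `F` and `G` lie on one ray, and that of
  -- `H` is strictly longer than that of `F`, against the choice of `F`.
  have hlt : ∀ G R, t.heart G → t.heart R → Tri G Q R → ¬ IsZero G →
      phase (W (K0.of G)) < phase (W (K0.of F)) := by
    intro G R hG hR hT' hG₀
    by_contra! hle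
    obtain ⟨H, h₁, h₂⟩ := hT.assoc hT'
    have hH := heart_of_tri t h₁ hF hG
    have hH₀ : ¬ IsZero H := fun h => by
      have h3 : W (K0.of F) + W (K0.of G) = 0 := by
        rw [← map_add, ← h₁.k0, K0.of_isZero h, map_zero]
      exact ne_zero_of_mem_upperHalf (upperHalf_add hFu (hW G hG hG₀)) h3
    have hHu := hW H hH hH₀
    have hk : W (K0.of H) = W (K0.of F) + W (K0.of G) := by rw [h₁.k0, map_add]
    have hFH : phase (W (K0.of F)) ≤ phase (W (K0.of H)) := by
      rw [phase_le_iff hFu hHu, hk, cross_add_right]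
      have := (phase_le_iff hFu (hW G hG hG₀)).1 hle
      simp only [cross] at this ⊢
      linarith
    have heq := le_antisymm (hsub H R hH hR h₂ hH₀) hFH
    have hnorm := (hmax _ ⟨H, R, hH, hR, h₂, hH₀, rfl, hFE.trans hFH⟩).2 heq
    have hGF : phase (W (K0.of G)) = phase (W (K0.of F)) := by
      refine le_antisymm ?_ hle
      rw [phase_le_iff (hW G hG hG₀) hFu]
      have h4 := (phase_le_iff hHu hFu).1 heq.le
      rw [hk, cross_add_left] at h4
      simp only [cross] at h4 ⊢
      linarith
    obtain ⟨m, hm, -, -, hm'⟩ := exists_polar hFu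
    obtain ⟨m', hm₀', -, -, hm''⟩ := exists_polar (hW G hG hG₀)
    rw [hGF] at hm''
    have hu : ‖unitPhase (phase (W (K0.of F)))‖ = 1 := norm_unitPhase _
    rw [hk, hm', hm'', ← add_mul, norm_mul, norm_mul, ← Complex.ofReal_add, Complex.norm_real,
      Complex.norm_real] at hnorm
    rw [hu, Real.norm_of_nonneg (by positivity), Real.norm_of_nonneg hm.le] at hnorm
    linarith
  -- Adding the charge of `F` sends destabilizing charges of `E/F` to those of the preimages in `E`.
  -- This is injective and misses the charge of `F` itself, since nonzero objects have nonzero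
  -- charge.
  have hcard : (destabilizing W t.heart Q).ncard < n := by
    rw [← hn]
    have hinj : Function.Injective (fun z : ℂ => W (K0.of F) + z) := add_right_injective _
    rw [← Set.ncard_image_of_injective _ hinj]
    refine Set.ncard_lt_ncard ⟨?_, fun hle => ?_⟩ (hfin E hE)
    · rintro _ ⟨_, ⟨G, R, hG, hR, hT', hG₀, rfl, hQG⟩, rfl⟩
      obtain ⟨H, h₁, h₂⟩ := hT.assoc hT'
      have hH := heart_of_tri t h₁ hF hG
      have hGu := hW G hG hG₀
      have hk : W (K0.of H) = W (K0.of F) + W (K0.of G) := by rw [h₁.k0, map_add]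
      have hHu : W (K0.of H) ∈ upperHalf := hk ▸ upperHalf_add hFu hGu
      have hH₀ : ¬ IsZero H := fun h => by
        rw [K0.of_isZero h, map_zero] at hHu
        exact ne_zero_of_mem_upperHalf hHu rfl
      refine ⟨H, R, hH, hR, h₂, hH₀, hk, ?_⟩
      change _ ≤ phase (W (K0.of F) + W (K0.of G))
      rw [← hk, phase_le_iff (hW E hE hE₀) hHu, h₂.k0, map_add, cross_add_left]
      have h0 : cross (W (K0.of H)) (W (K0.of H)) = 0 := by simp only [cross]; ring
      rw [h0, zero_add]
      by_cases hR₀ : IsZero R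
      · rw [K0.of_isZero hR₀, map_zero]
        simp [cross]
      have hRu := hW R hR hR₀
      have hRG : phase (W (K0.of R)) ≤ phase (W (K0.of G)) := by
        rw [phase_le_iff hRu hGu]
        have := (phase_le_iff (hW Q hQ hQ₀) hGu).1 hQG
        rw [hT'.k0, map_add, cross_add_left] at this
        simp only [cross] at this ⊢
        linarith
      rw [hk, cross_add_right]
      exact add_nonneg ((phase_le_iff hRu hFu).1 (hRG.trans (hlt G R hG hR hT' hG₀).le))
        ((phase_le_iff hRu hGu).1 hRG)
    · obtain ⟨z, ⟨G, R, hG, -, -, hG₀, rfl, -⟩, hz⟩ :=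
        hle (⟨F, Q, hF, hQ, hT, hF₀, rfl, hFE⟩ : W (K0.of F) ∈ destabilizing W t.heart E)
      exact ne_zero_of_mem_upperHalf (hW G hG hG₀) (by simpa using hz)
  obtain ⟨G, R, hG, hR, hT', hG₀, hfilt⟩ := ih _ hcard Q hQ hQ₀ rfl
  have hGF := hlt G R hG hR hT' hG₀
  refine (Filt.ext hT (.single hFs (Set.mem_singleton _)) hfilt ?_).mono ?_
  · rintro s hs _ rfl
    exact hs.2.trans_lt hGF
  · rintro x (hx | rfl)
    · exact ⟨hx.1, hx.2.trans hGF.le⟩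
    · exact ⟨phase_pos hFu, le_rfl⟩

/-- A stability function for which every object has only finitely many charges of destabilizing
subobjects has the Harder-Narasimhan property. -/
lemma filt_heartSlicing_of_finite [IsTriangulated C]
    (hW : ∀ E, t.heart E → ¬ IsZero E → W (K0.of E) ∈ upperHalf)
    (hfin : ∀ E, t.heart E → (destabilizing W t.heart E).Finite) (E : C) (hE : t.heart E) :
    Filt (heartSlicing W t.heart) (Set.Ioc 0 1) E := by
  by_cases hE₀ : IsZero E
  · exact .zero _ _ hE₀
  obtain ⟨F, Q, hF, hQ, -, hF₀, h⟩ := filt_heartSlicing_aux t hW hfin _ E hE hE₀ rfl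
  exact h.mono (Set.Ioc_subset_Ioc_right (phase_le_one (hW F hF hF₀)))

end ExistsHN

/-! ### Norms on lattices -/

section LatticeNorm

/-- With `p` as the norm, the coordinate functionals of a basis are bounded, and `q` is at most the
sum of the coordinates weighted by its values on the basis. -/
lemma exists_seminorm_le {V : Type*} [AddCommGroup V] [Module ℝ V] [FiniteDimensional ℝ V]
    (p q : Seminorm ℝ V) (hp : ∀ x, p x = 0 → x = 0) :
    ∃ K : ℝ, 0 < K ∧ ∀ x, q x ≤ K * p x := by
  let _ : NormedAddCommGroup V := AddGroupNorm.toNormedAddCommGroup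
    { p.toAddGroupSeminorm with eq_zero_of_map_eq_zero' := hp }
  let _ : NormedSpace ℝ V := ⟨fun a x => (map_smul_eq_mul p a x).le⟩
  let b := Module.finBasis ℝ V
  let f : Fin (Module.finrank ℝ V) → (V →L[ℝ] ℝ) := fun i => (b.coord i).toContinuousLinearMap
  have hsum : 0 ≤ ∑ i, ‖f i‖ * q (b i) :=
    Finset.sum_nonneg fun i _ => mul_nonneg (norm_nonneg _) (apply_nonneg q _)
  refine ⟨∑ i, ‖f i‖ * q (b i) + 1, by positivity, fun x => ?_⟩
  have hpx : ‖x‖ = p x := rfl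
  calc q x = q (∑ i, b.repr x i • b i) := by rw [b.sum_repr]
    _ ≤ ∑ i, q (b.repr x i • b i) :=
        Finset.le_sum_of_subadditive q (map_zero q).le (map_add_le_add q) _ _
    _ ≤ ∑ i, ‖f i‖ * q (b i) * p x := by
        refine Finset.sum_le_sum fun i _ => ?_
        rw [map_smul_eq_mul]
        have h : ‖b.repr x i‖ ≤ ‖f i‖ * ‖x‖ := (f i).le_opNorm x
        rw [hpx] at h
        calc _ ≤ ‖f i‖ * p x * q (b i) := mul_le_mul_of_nonneg_right h (apply_nonneg q _)
          _ = _ := by ring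
    _ ≤ _ := by
        rw [← Finset.sum_mul]
        exact mul_le_mul_of_nonneg_right (by linarith) (apply_nonneg p x)

variable {Λ : Type*} [AddCommGroup Λ]

lemma LatticeNorm.norm_add_le (N : LatticeNorm Λ) (x y : Λ) :
    N.norm (x + y) ≤ N.norm x + N.norm y := by
  rw [LatticeNorm.norm, TensorProduct.tmul_add]
  exact map_add_le_add N.toSeminorm _ _

lemma LatticeNorm.norm_zero (N : LatticeNorm Λ) : N.norm (0 : Λ) = 0 := by
  rw [LatticeNorm.norm, TensorProduct.tmul_zero]
  exact map_zero N.toSeminorm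

variable [Module.Free ℤ Λ] [Module.Finite ℤ Λ]

lemma LatticeNorm.exists_comp_le {Λ' : Type*} [AddCommGroup Λ'] (N : LatticeNorm Λ)
    (N' : LatticeNorm Λ') (g : Λ →+ Λ') :
    ∃ K : ℝ, 0 < K ∧ ∀ x, N'.norm (g x) ≤ K * N.norm x := by
  let G : ℝ ⊗[ℤ] Λ →ₗ[ℝ] ℝ ⊗[ℤ] Λ' := g.toIntLinearMap.baseChange ℝ
  obtain ⟨K, hK, h⟩ := exists_seminorm_le N.toSeminorm (N'.toSeminorm.comp G) N.eq_zero
  refine ⟨K, hK, fun x => ?_⟩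
  have := h (1 ⊗ₜ x)
  rw [Seminorm.comp_apply] at this
  simpa [G, LatticeNorm.norm] using this

/-- A bound on the norm bounds each integral coordinate. -/
lemma LatticeNorm.finite_le (N : LatticeNorm Λ) (M : ℝ) : {x : Λ | N.norm x ≤ M}.Finite := by
  let b := Module.Free.chooseBasis ℤ Λ
  have hcoord : ∀ i, ∃ K : ℝ, 0 < K ∧ ∀ x, |(b.repr x i : ℝ)| ≤ K * N.norm x := by
    intro i
    let B := Algebra.TensorProduct.basis ℝ b
    obtain ⟨K, hK, h⟩ := exists_seminorm_le N.toSeminorm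
      ((normSeminorm ℝ ℝ).comp (B.coord i)) N.eq_zero
    refine ⟨K, hK, fun x => ?_⟩
    have := h (1 ⊗ₜ x)
    rw [Seminorm.comp_apply] at this
    simpa [B, LatticeNorm.norm] using this
  choose K hK hcoord using hcoord
  have hinj : Function.Injective (fun x : Λ => (fun i => b.repr x i : _ → ℤ)) := fun x y h =>
    b.repr.injective (Finsupp.ext fun i => congrFun h i)
  refine Set.Finite.of_finite_image (f := fun x : Λ => (fun i => b.repr x i : _ → ℤ)) ?_
    hinj.injOn
  refine (Set.Finite.pi' (t := fun i => Set.Icc (-⌈K i * M⌉) ⌈K i * M⌉)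
    fun i => Set.finite_Icc _ _).subset ?_
  rintro _ ⟨x, hx, rfl⟩ i
  have h : |(b.repr x i : ℝ)| ≤ ⌈K i * M⌉ :=
    ((hcoord i x).trans (mul_le_mul_of_nonneg_left hx (hK i).le)).trans (Int.le_ceil _)
  rw [abs_le] at h
  exact ⟨by exact_mod_cast h.1, by exact_mod_cast h.2⟩

end LatticeNorm

/-! ### The support property bounds destabilizing subobjects -/

section Finiteness

variable {C : Type u} [Category.{v} C] [Preadditive C] [HasZeroObject C] [HasShift C ℤ]
  [∀ n : ℤ, (shiftFunctor C n).Additive] [Pretriangulated C]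

lemma Tri.exists_hom {X E Z X' : C} (f : X ⟶ E) (g : E ⟶ Z) (h : Z ⟶ X⟦(1 : ℤ)⟧)
    (hT : Triangle.mk f g h ∈ distTriang C) (u : X' ⟶ E) (hX' : HomZero X' Z) :
    ∃ w : X' ⟶ X, w ≫ f = u := by
  obtain ⟨w, hw⟩ := Triangle.coyoneda_exact₂ _ hT u (hX' _)
  exact ⟨w, hw.symm⟩

lemma Tri.hom_ext {X E Z X' : C} (f : X ⟶ E) (g : E ⟶ Z) (h : Z ⟶ X⟦(1 : ℤ)⟧)
    (hT : Triangle.mk f g h ∈ distTriang C) {w w' : X' ⟶ X} (hw : w ≫ f = w' ≫ f)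
    (hX' : HomZero X' (Z⟦(-1 : ℤ)⟧)) : w = w' := by
  rw [← sub_eq_zero]
  obtain ⟨k, hk⟩ := Triangle.coyoneda_exact₂ _ (inv_rot_of_distTriang _ hT) (w - w')
    (by change (w - w') ≫ f = 0; rw [Preadditive.sub_comp, hw, sub_self])
  rw [hk, hX' k]
  exact zero_comp

/-- Uniqueness of truncation: the Hom-vanishing makes each of `X ⟶ E` and `X' ⟶ E` lift uniquely
through the other. -/
lemma Tri.nonempty_iso₁ {X E Z X' Z' : C} (h : Tri X E Z) (h' : Tri X' E Z')
    (h₁ : HomZero X Z') (h₂ : HomZero X' Z) (h₃ : HomZero X (Z⟦(-1 : ℤ)⟧))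
    (h₄ : HomZero X' (Z'⟦(-1 : ℤ)⟧)) : Nonempty (X ≅ X') := by
  obtain ⟨f, g, k, hT⟩ := h
  obtain ⟨f', g', k', hT'⟩ := h'
  obtain ⟨u, hu⟩ := Tri.exists_hom f' g' k' hT' f h₁
  obtain ⟨w, hw⟩ := Tri.exists_hom f g k hT f' h₂
  exact ⟨⟨u, w, Tri.hom_ext f g k hT (by rw [Category.assoc, hw, hu, Category.id_comp]) h₃,
    Tri.hom_ext f' g' k' hT' (by rw [Category.assoc, hu, hw, Category.id_comp]) h₄⟩⟩

lemma IsSlicing.nonempty_iso_truncation {P : ℝ → ObjectProperty C} (hP : IsSlicing P) {a : ℝ}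
    {X E Z X' Z' : C} (h : Tri X E Z) (h' : Tri X' E Z') (hX : Filt P (Set.Ioi a) X)
    (hX' : Filt P (Set.Ioi a) X') (hZ : Filt P (Set.Iic a) Z) (hZ' : Filt P (Set.Iic a) Z') :
    Nonempty (X ≅ X') := by
  have key : ∀ {X Z : C}, Filt P (Set.Ioi a) X → Filt P (Set.Iic a) Z →
      HomZero X Z ∧ HomZero X (Z⟦(-1 : ℤ)⟧) := fun {X Z} hX hZ =>
    ⟨hP.homZero_of_filt hX hZ fun s hs s' hs' => (Set.mem_Iic.1 hs').trans_lt (Set.mem_Ioi.1 hs),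
      hP.homZero_of_filt hX (hP.filt_shift (S' := Set.Iic (a - 1)) (-1) hZ fun s hs => by
        have := Set.mem_Iic.1 hs
        refine Set.mem_Iic.2 ?_
        push_cast
        linarith) fun s hs s' hs' => by
        have := Set.mem_Iic.1 hs'
        have := Set.mem_Ioi.1 hs
        linarith⟩
  exact h.nonempty_iso₁ h' (key hX hZ').1 (key hX' hZ).1 (key hX hZ).2 (key hX' hZ').2

variable {Λ : Type*} [AddCommGroup Λ] {v : K0 C →+ Λ} {Z : Λ →+ ℂ} {P : ℝ → ObjectProperty C}

/-- If the real part of the charge has constant sign `s` on `P S`, the support property extends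
from the semistable objects to `P S`. -/
lemma Filt.norm_le {N : LatticeNorm Λ} (hW : PreStab (Z.comp v) P) {c : ℝ}
    (hc : ∀ φ E, P φ E → ¬ IsZero E → N.norm (v (K0.of E)) ≤ c * ‖Z (v (K0.of E))‖) (hc₀ : 0 ≤ c)
    {s : ℝ} {S : Set ℝ}
    (hS : ∀ φ ∈ S, |(unitPhase φ).re| ≤ s * (unitPhase φ).re ∧ 0 ≤ (unitPhase φ).im) {E : C}
    (h : Filt P S E) :
    N.norm (v (K0.of E)) ≤ c * (s * (Z (v (K0.of E))).re + (Z (v (K0.of E))).im) := by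
  induction h with
  | zero S E hE => simp [K0.of_isZero hE, N.norm_zero]
  | step S φ E₀ E A hT hA hφ h₀ ih =>
    have h₁ := ih fun ψ hψ => hS ψ hψ.1
    have h₂ : N.norm (v (K0.of A)) ≤ c * (s * (Z (v (K0.of A))).re + (Z (v (K0.of A))).im) := by
      by_cases hA₀ : IsZero A
      · simp [K0.of_isZero hA₀, N.norm_zero]
      refine (hc φ A hA hA₀).trans (mul_le_mul_of_nonneg_left ?_ hc₀)
      obtain ⟨m, hm, hm'⟩ := hW φ A hA hA₀
      change Z (v (K0.of A)) = _ at hm'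
      refine (Complex.norm_le_abs_re_add_abs_im _).trans ?_
      rw [hm', Complex.re_ofReal_mul, Complex.im_ofReal_mul, abs_mul, abs_mul, abs_of_pos hm,
        abs_of_nonneg (hS φ hφ).2]
      nlinarith [(hS φ hφ).1]
    rw [hT.k0, map_add, map_add, Complex.add_re, Complex.add_im]
    refine (N.norm_add_le _ _).trans ?_
    linarith

lemma re_unitPhase_nonneg {φ : ℝ} (h : φ ∈ Set.Ioc (0 : ℝ) (1 / 2)) : 0 ≤ (unitPhase φ).re := by
  rw [unitPhase_re]
  exact Real.cos_nonneg_of_mem_Icc ⟨by nlinarith [Real.pi_pos, h.1], by nlinarith [Real.pi_pos, h.2]⟩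

lemma re_unitPhase_nonpos {φ : ℝ} (h : φ ∈ Set.Ioc (1 / 2 : ℝ) 1) : (unitPhase φ).re ≤ 0 := by
  rw [unitPhase_re]
  exact Real.cos_nonpos_of_pi_div_two_le_of_le (by nlinarith [Real.pi_pos, h.1])
    (by nlinarith [Real.pi_pos, h.2])

lemma im_unitPhase_nonneg {φ : ℝ} (h : φ ∈ Set.Ioc (0 : ℝ) 1) : 0 ≤ (unitPhase φ).im := by
  rw [unitPhase_im]
  exact Real.sin_nonneg_of_nonneg_of_le_pi (by nlinarith [Real.pi_pos, h.1])
    (by nlinarith [Real.pi_pos, h.2])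

variable {W : K0 C →+ ℂ}

lemma Filt.im_nonneg (hW : PreStab W P) {E : C} (h : Filt P (Set.Ioc 0 1) E) :
    0 ≤ (W (K0.of E)).im := by
  by_cases hE : IsZero E
  · simp [K0.of_isZero hE]
  · rcases mem_upperHalf_iff.1 (hW.phase_mem h le_rfl le_rfl hE).1 with h | h
    · exact h.le
    · exact h.1.ge

lemma Filt.re_nonpos (hW : PreStab W P) {E : C} (h : Filt P (Set.Ioc (1 / 2) 1) E) :
    (W (K0.of E)).re ≤ 0 := by
  by_cases hE : IsZero E
  · simp [K0.of_isZero hE]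
  · refine Filt.charge_mem (K := {z | z.re ≤ 0}) (fun x hx y hy => ?_) h
      (fun φ hφ A hA hA₀ => ?_) hE
    · exact add_nonpos (α := ℝ) hx hy
    · obtain ⟨m, hm, hm'⟩ := hW φ A hA hA₀
      rw [hm']
      change (m * unitPhase φ : ℂ).re ≤ 0
      rw [Complex.re_ofReal_mul]
      exact mul_nonpos_of_nonneg_of_nonpos hm.le (re_unitPhase_nonpos hφ)

/-- `f` lies to the left of the ray through `e` and no higher than `e`, so its real part cannot
exceed `|e.re|`. -/
lemma re_le_abs_re_of_phase_le {e f : ℂ} (he : e ∈ upperHalf) (hf : f ∈ upperHalf)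
    (h : phase e ≤ phase f) (him : f.im ≤ e.im) : f.re ≤ |e.re| := by
  rw [phase_le_iff he hf] at h
  simp only [cross] at h
  rcases mem_upperHalf_iff.1 hf with h' | ⟨-, h'⟩
  · have he' : 0 < e.im := h'.trans_le him
    by_contra! hlt
    have h0 := abs_nonneg e.re
    nlinarith [le_abs_self e.re, mul_le_mul_of_nonneg_left him h0,
      mul_le_mul_of_nonneg_right (le_abs_self e.re) h'.le]
  · exact h'.le.trans (abs_nonneg _)

/-- The support property bounds the classes of the destabilizing subobjects of an object of
`P((0,1])`. -/
lemma finite_destabilizing [IsTriangulated C] [Module.Free ℤ Λ] [Module.Finite ℤ Λ]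
    {N : LatticeNorm Λ} (hP : IsSlicing P) (hW : PreStab (Z.comp v) P) {c : ℝ}
    (hc : ∀ φ E, P φ E → ¬ IsZero E → N.norm (v (K0.of E)) ≤ c * ‖Z (v (K0.of E))‖) (hc₀ : 0 ≤ c)
    {E : C} (hE : Filt P (Set.Ioc 0 1) E) :
    (destabilizing (Z.comp v) (Filt P (Set.Ioc 0 1)) E).Finite := by
  by_cases hE₀ : IsZero E
  · refine (Set.finite_singleton (0 : ℂ)).subset ?_
    rintro _ ⟨F, Q, hF, hQ, hT, hF₀, rfl, -⟩
    exfalso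
    have h1 := (hW.phase_mem hF le_rfl le_rfl hF₀).1
    have h2 := hT.k0
    rw [K0.of_isZero hE₀] at h2
    by_cases hQ₀ : IsZero Q
    · rw [K0.of_isZero hQ₀, add_zero] at h2
      rw [← h2, map_zero] at h1
      exact ne_zero_of_mem_upperHalf h1 rfl
    · have h3 := upperHalf_add h1 (hW.phase_mem hQ le_rfl le_rfl hQ₀).1
      rw [← map_add, ← h2, map_zero] at h3
      exact ne_zero_of_mem_upperHalf h3 rfl
  have hEu := (hW.phase_mem hE le_rfl le_rfl hE₀).1
  obtain ⟨E', E'', hTE, hE', hE''⟩ := hE.truncate (1 / 2)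
  -- Split `F` at phase `1/2` into `F'` and `F''`, where the real part of the charge has constant
  -- sign. The support property bounds the norm of `v(F)` by `c (Im Z(F) + Re Z(F) - 2 Re Z(F'))`,
  -- and `M` arises from bounding the three terms through `E`.
  set M : ℝ := c * ((Z (v (K0.of E))).im + |(Z (v (K0.of E))).re| - 2 * (Z (v (K0.of E'))).re)
  refine ((N.finite_le M).image Z).subset ?_
  rintro _ ⟨F, Q, hF, hQ, hT, hF₀, rfl, hph⟩
  refine ⟨v (K0.of F), ?_, rfl⟩
  change N.norm (v (K0.of F)) ≤ M
  have hFu := (hW.phase_mem hF le_rfl le_rfl hF₀).1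
  have him : (Z (v (K0.of F))).im ≤ (Z (v (K0.of E))).im := by
    have h1 := hQ.im_nonneg hW
    change 0 ≤ (Z (v (K0.of Q))).im at h1
    rw [hT.k0, map_add, map_add, Complex.add_im]
    linarith
  have hre : (Z (v (K0.of F))).re ≤ |(Z (v (K0.of E))).re| :=
    re_le_abs_re_of_phase_le hEu hFu hph him
  obtain ⟨F', F'', hTF, hF', hF''⟩ := hF.truncate (1 / 2)
  have hsub₁ : Set.Ioc (0 : ℝ) 1 ∩ Set.Ioi (1 / 2) ⊆ Set.Ioc (1 / 2) 1 := fun x hx => ⟨hx.2, hx.1.2⟩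
  have hsub₂ : Set.Ioc (0 : ℝ) 1 ∩ Set.Iic (1 / 2) ⊆ Set.Ioc 0 (1 / 2) := fun x hx => ⟨hx.1.1, hx.2⟩
  have hb₁ := (hF'.mono hsub₁).norm_le hW hc hc₀ (s := -1) fun φ hφ =>
    ⟨by rw [abs_of_nonpos (re_unitPhase_nonpos hφ)]; linarith,
      im_unitPhase_nonneg ⟨by linarith [hφ.1], hφ.2⟩⟩
  have hb₂ := (hF''.mono hsub₂).norm_le hW hc hc₀ (s := 1) fun φ hφ =>
    ⟨by rw [abs_of_nonneg (re_unitPhase_nonneg hφ)]; linarith,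
      im_unitPhase_nonneg ⟨hφ.1, by linarith [hφ.2]⟩⟩
  -- `F'` is a subobject of `E'` with quotient `Y'`, the part of `E/F'` of phase `> 1/2`: the
  -- preimage `G` of `Y'` in `E` is `E'` by uniqueness of truncation. The real part of the charge of
  -- `Y'` is nonpositive.
  have hkey : (Z (v (K0.of E'))).re ≤ (Z (v (K0.of F'))).re := by
    obtain ⟨Y, h₁, h₂⟩ := hT.assoc' hTF
    have hord : (Set.Ioc (0 : ℝ) 1).OrdConnected := Set.ordConnected_Ioc
    have hY : Filt P (Set.Ioc 0 1) Y := hP.filt_of_tri hord h₂ (hF''.mono Set.inter_subset_left) hQ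
    obtain ⟨Y', Y'', hTY, hY', hY''⟩ := hY.truncate (1 / 2)
    obtain ⟨G, h₃, h₄⟩ := h₁.assoc hTY
    have hG : Filt P (Set.Ioi (1 / 2)) G := hP.filt_of_tri Set.ordConnected_Ioi h₃
      (hF'.mono Set.inter_subset_right) (hY'.mono Set.inter_subset_right)
    obtain ⟨e⟩ := hP.nonempty_iso_truncation hTE h₄ (hE'.mono Set.inter_subset_right) hG
      (hE''.mono Set.inter_subset_right) (hY''.mono Set.inter_subset_right)
    have h5 := (hY'.mono hsub₁).re_nonpos hW
    change (Z (v (K0.of Y'))).re ≤ 0 at h5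
    rw [K0.of_iso e, h₃.k0, map_add, map_add, Complex.add_re]
    linarith
  have hk : Z (v (K0.of F)) = Z (v (K0.of F')) + Z (v (K0.of F'')) := by
    rw [hTF.k0, map_add, map_add]
  have hk₁ := congrArg Complex.re hk
  have hk₂ := congrArg Complex.im hk
  rw [Complex.add_re] at hk₁
  rw [Complex.add_im] at hk₂
  calc N.norm (v (K0.of F)) ≤ N.norm (v (K0.of F')) + N.norm (v (K0.of F'')) := by
        rw [hTF.k0, map_add]
        exact N.norm_add_le _ _
    _ ≤ c * ((Z (v (K0.of F))).im + (Z (v (K0.of F))).re - 2 * (Z (v (K0.of F'))).re) := by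
        rw [hk₁, hk₂]
        linarith
    _ ≤ M := mul_le_mul_of_nonneg_left (by linarith) hc₀

/-- Finiteness of the set of destabilizing charges passes to hearts of subcategories. -/
lemma finite_destabilizing_map {D : Type u'} [Category.{v'} D] [Preadditive D] [HasZeroObject D]
    [HasShift D ℤ] [∀ n : ℤ, (shiftFunctor D n).Additive] [Pretriangulated D]
    (F : D ⥤ C) [F.CommShift ℤ] [F.IsTriangulated] (hF₀ : ∀ X, IsZero (F.obj X) → IsZero X)
    {W' : K0 D →+ ℂ} (hW' : ∀ X, W' (K0.of X) = W (K0.of (F.obj X))) {A : ObjectProperty C}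
    {A' : ObjectProperty D} (hA : ∀ X, A' X → A (F.obj X)) {E : D}
    (h : (destabilizing W A (F.obj E)).Finite) : (destabilizing W' A' E).Finite := by
  refine h.subset ?_
  rintro _ ⟨X, Q, hX, hQ, hT, hX₀, rfl, hph⟩
  rw [hW'] at hph
  exact ⟨F.obj X, F.obj Q, hA X hX, hA Q hQ, hT.map F, fun h => hX₀ (hF₀ X h), (hW' X).symm, hph⟩

end Finiteness

/-! ### Recognizing the heart `P((δ,δ+1])` -/

section TStructure

variable {C : Type u} [Category.{v} C] [Preadditive C] [HasZeroObject C] [HasShift C ℤ]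
  [∀ n : ℤ, (shiftFunctor C n).Additive] [Pretriangulated C] (t : TStructure C)

lemma ge_of_homZero {X : C} {n m : ℤ} (hnm : n + 1 = m) (h : ∀ L, t.le n L → HomZero L X) :
    t.ge m X := by
  subst hnm
  obtain ⟨L, G, hT, hL, hG⟩ := tri_truncation t X n
  have hL₀ : IsZero L := hT.isZero₁_of_homZero (h L hL)
    (homZero_of_le_of_ge t hL (t.ge_shift (n + 1) (-1) (n + 2) (by ring) _ hG) (by omega))
  obtain ⟨e⟩ := hT.iso_of_isZero₁ hL₀
  exact (t.ge (n + 1)).prop_of_iso e.symm hG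

lemma le_of_homZero {X : C} {n : ℤ} (h : ∀ G, t.ge (n + 1) G → HomZero X G) : t.le n X := by
  obtain ⟨L, G, hT, hL, hG⟩ := tri_truncation t X n
  have hG₀ : IsZero G := hT.isZero₃_of_homZero (h G hG)
    (homZero_of_le_of_ge t (t.le_shift n 1 (n - 1) (by ring) _ hL) hG (by omega))
  obtain ⟨e⟩ := hT.iso_of_isZero₃ hG₀
  exact (t.le n).prop_of_iso e hL

variable {P : ℝ → ObjectProperty C} (hP : IsSlicing P) {t} (ht : ∀ X, t.bounded X)
include hP ht

/-- Cohomology in degree `b` contributes phases `> a - b`, and only degrees `b ≤ n` occur. -/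
lemma IsSlicing.filt_of_le {a : ℝ} (h : t.heart ≤ Filt P (Set.Ioi a)) {n : ℤ} {X : C}
    (hX : t.le n X) : Filt P (Set.Ioi (a - n)) X := by
  obtain ⟨⟨m, hm⟩, -⟩ := ht X
  refine bounded_induction t (p := fun b X => Filt P (Set.Ioi (a - b)) X) m
    (fun b X hX => .zero _ _ hX) (fun b X' X X'' _ hT hX' hX'' => ?_) n X hm.ge hX
  refine hP.filt_of_tri Set.ordConnected_Ioi hT (hX'.mono fun x hx => ?_) ?_
  · have := Set.mem_Ioi.1 hx
    push_cast at this
    exact Set.mem_Ioi.2 (by linarith)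
  · refine (hP.filt_shift (S' := Set.Ioi (a - b)) (-b) (h _ hX'') fun s hs => ?_).iso
      ((shiftEquiv C b).unitIso.symm.app X'')
    have := Set.mem_Ioi.1 hs
    push_cast
    exact Set.mem_Ioi.2 (by linarith)

lemma IsSlicing.filt_of_ge {a : ℝ} (h : t.heart ≤ Filt P (Set.Iic a)) {n : ℤ} {X : C}
    (hX : t.ge n X) : Filt P (Set.Iic (a - n)) X := by
  obtain ⟨-, ⟨m, hm⟩⟩ := ht X
  refine bounded_induction t (p := fun _ X => Filt P (Set.Iic (a - n)) X) n
    (fun b X hX => .zero _ _ hX) (fun b X' X X'' hb hT hX' hX'' => ?_) m X hX hm.le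
  refine hP.filt_of_tri Set.ordConnected_Iic hT hX' ?_
  refine (hP.filt_shift (S' := Set.Iic (a - n)) (-b) (h _ hX'') fun s hs => ?_).iso
      ((shiftEquiv C b).unitIso.symm.app X'')
  have := Set.mem_Iic.1 hs
  have : (n : ℝ) ≤ b := by exact_mod_cast hb
  push_cast
  exact Set.mem_Iic.2 (by linarith)

/-- A bounded heart contained in `P((0,2])` all of whose charges lie in the half plane of
`P((δ,δ+1])` is equal to `P((δ,δ+1])`. -/
lemma IsSlicing.heart_eq [IsTriangulated C] {W : K0 C →+ ℂ} (hW : PreStab W P) {δ : ℝ}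
    (hδ₀ : 0 < δ) (hδ₁ : δ < 1) (h : t.heart ≤ Filt P (Set.Ioc 0 2))
    (hH : ∀ E, t.heart E → ¬ IsZero E → W (K0.of E) * unitPhase (-δ) ∈ upperHalf) :
    t.heart = Filt P (Set.Ioc δ (δ + 1)) := by
  have hle := fun {n : ℤ} {X : C} (hX : t.le n X) =>
    hP.filt_of_le ht (fun E hE => (h E hE).mono fun x hx => hx.1) hX
  have hge := fun {n : ℤ} {X : C} (hX : t.ge n X) =>
    hP.filt_of_ge ht (fun E hE => (h E hE).mono fun x hx => hx.2) hX
  refine IsBoundedHeart.eq_of_le ⟨t, ht, rfl⟩ (hP.isBoundedHeart δ) fun E hE => ?_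
  refine hP.filt_Ioc ?_ ?_
  · obtain ⟨E', E'', hT, hE', hE''⟩ := (h E hE).truncate δ
    -- Objects of `t.le (-1)` have phases `> 1`, while those of `E''` are at most `δ < 1`.
    have hge₀ : t.ge 0 E'' := ge_of_homZero t (n := -1) rfl fun L hL =>
      hP.homZero_of_filt (hle hL) hE'' fun s hs s' hs' => by
        have h1 := Set.mem_Ioi.1 hs
        have h2 := Set.mem_Iic.1 hs'.2
        push_cast at h1
        linarith
    -- `H` is the degree-zero cohomology of `E''`. It inherits phases in `(0,δ]`, so a nonzero `H`
    -- would have charge opposite to the half plane prescribed on the heart. Hence `E''` lies in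
    -- degrees `≥ 1`, the map `E ⟶ E''` is zero, and `E''` vanishes.
    obtain ⟨H, G, hT', hH', hG⟩ := tri_truncation t E'' 0
    have hG' : t.ge 2 (G⟦(-1 : ℤ)⟧) := t.ge_shift (0 + 1) (-1) 2 (by ring) _ hG
    have hH₀ : IsZero H := by
      by_contra hH₀
      have hHH : t.heart H := ⟨hH', ge_of_tri t hT'.invRot (t.ge_antitone (by omega) _ hG') hge₀⟩
      have hHδ : Filt P (Set.Iic δ) H := hP.filt_of_tri Set.ordConnected_Iic hT'.invRot
        ((hge hG').mono fun x hx => by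
          have := Set.mem_Iic.1 hx
          push_cast at this
          exact Set.mem_Iic.2 (by linarith)) (hE''.mono Set.inter_subset_right)
      have hHδ' : Filt P (Set.Ioc (δ - 1) δ) H :=
        hP.filt_Ioc ((h H hHH).mono fun x hx => Set.mem_Ioi.2 (by linarith [hx.1])) hHδ
      exact neg_notMem_upperHalf (hH H hHH hH₀) (hW.neg_rotate_mem hHδ' hH₀)
    obtain ⟨e⟩ := hT'.iso_of_isZero₁ hH₀
    have hE₀ : IsZero E'' := by
      refine hT.isZero₃_of_homZero ?_ ?_
      · exact (homZero_of_le_of_ge t hE.1 hG (by omega)).iso (Iso.refl E) e.symm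
      · refine hP.homZero_of_filt (hP.filt_shift (S' := Set.Ioi (δ + 1)) 1 hE' fun s hs => ?_) hE''
          fun s hs s' hs' => ?_
        · have := Set.mem_Ioi.1 hs.2
          push_cast
          exact Set.mem_Ioi.2 (by linarith)
        · have := Set.mem_Ioi.1 hs
          have := Set.mem_Iic.1 hs'.2
          linarith
    obtain ⟨e'⟩ := hT.iso_of_isZero₃ hE₀
    exact (hE'.iso e').mono Set.inter_subset_right
  -- The dual argument: the part of phase `> δ + 1` lies in degrees `≤ 0`, and its degree-zero
  -- cohomology would have phases in `(δ+1, 2]`.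
  · obtain ⟨E', E'', hT, hE', hE''⟩ := (h E hE).truncate (δ + 1)
    have hle₀ : t.le 0 E' := le_of_homZero t fun G hG =>
      hP.homZero_of_filt hE' (hge hG) fun s hs s' hs' => by
        have h1 := Set.mem_Ioi.1 hs.2
        have h2 := Set.mem_Iic.1 hs'
        push_cast at h2
        linarith
    obtain ⟨L, H, hT', hL, hH'⟩ := tri_truncation t E' (-1)
    have hL' : t.le (-2) (L⟦(1 : ℤ)⟧) := t.le_shift (-1) 1 (-2) (by ring) _ hL
    have hH₀ : IsZero H := by
      by_contra hH₀
      have hHH : t.heart H := ⟨le_of_tri t hT'.rot hle₀ (t.le_monotone (by omega) _ hL'), hH'⟩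
      have hHδ : Filt P (Set.Ioi (δ + 1)) H := hP.filt_of_tri Set.ordConnected_Ioi hT'.rot
        (hE'.mono Set.inter_subset_right) ((hle hL').mono fun x hx => by
          have := Set.mem_Ioi.1 hx
          push_cast at this
          exact Set.mem_Ioi.2 (by linarith))
      have hHδ' : Filt P (Set.Ioc (δ + 1) (δ + 1 + 1)) H :=
        hP.filt_Ioc hHδ ((h H hHH).mono fun x hx => Set.mem_Iic.2 (by linarith [hx.2]))
      have h1 := hW.rotate_mem hHδ' hH₀
      have h2 : unitPhase (-(δ + 1)) = -unitPhase (-δ) := by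
        have := unitPhase_add (-(δ + 1)) 1
        rw [unitPhase_one, neg_add, neg_add_cancel_right, ← neg_add] at this
        rw [this]
        ring
      rw [h2, mul_neg] at h1
      exact neg_notMem_upperHalf (hH H hHH hH₀) h1
    obtain ⟨e⟩ := hT'.iso_of_isZero₃ hH₀
    have hE₀ : IsZero E' := by
      refine hT.isZero₁_of_homZero ?_ ?_
      · exact (homZero_of_le_of_ge t hL hE.2 (by omega)).iso e (Iso.refl E)
      · refine hP.homZero_of_filt hE' (hP.filt_shift (S' := Set.Iic δ) (-1) hE'' fun s hs => ?_)
          fun s hs s' hs' => ?_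
        · have := Set.mem_Iic.1 hs.2
          push_cast
          exact Set.mem_Iic.2 (by linarith)
        · have := Set.mem_Ioi.1 hs.2
          have := Set.mem_Iic.1 hs'
          linarith
    obtain ⟨e'⟩ := hT.iso_of_isZero₁ hE₀
    exact (hE''.iso e'.symm).mono Set.inter_subset_right

end TStructure

/-! ### The semiorthogonal decomposition and compatibility of slicings -/

section Semiorthogonal

variable {D : Type u} [Category.{v} D] [Preadditive D] [HasZeroObject D] [HasShift D ℤ]
  [∀ n : ℤ, (shiftFunctor D n).Additive] [Pretriangulated D]
  (D₁ : ObjectProperty D) [D₁.IsTriangulated] [LeftAdmissible D₁]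

lemma nonempty_iso_proj₁ (E : D₁.FullSubcategory) : Nonempty ((proj₁ D₁).obj E.obj ≅ E) :=
  ⟨asIso ((adj₁ D₁).counit.app E)⟩

lemma nonempty_iso_proj₂ (E : (orth D₁).FullSubcategory) : Nonempty ((proj₂ D₁).obj E.obj ≅ E) :=
  ⟨(asIso ((adj₂ D₁).unit.app E)).symm⟩

lemma isZero_proj₁ {E : D} (h : orth D₁ E) : IsZero ((proj₁ D₁).obj E) := by
  refine HomZero.isZero fun f => ((adj₁ D₁).homEquiv _ _).injective ?_
  exact (h _ ((proj₁ D₁).obj E).property).trans (h _ ((proj₁ D₁).obj E).property).symm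

lemma isZero_proj₂ {E : D} (h : D₁ E) : IsZero ((proj₂ D₁).obj E) := by
  refine HomZero.isZero fun f => ((adj₂ D₁).homEquiv _ _).symm.injective ?_
  exact (((proj₂ D₁).obj E).property _ h).trans (((proj₂ D₁).obj E).property _ h).symm

/-- Applying each projection to a triangle with vertices in `D₂` and `D₁` kills one vertex and
identifies the other with the projection of `E`. -/
lemma tri_proj (E : D) : Tri ((proj₂ D₁).obj E).obj E ((proj₁ D₁).obj E).obj := by
  obtain ⟨K, L, hK, hL, k, η, h, hT⟩ := exists_unit_triangle D₁ E
  have hT' : Tri K E L := ⟨k, η, h, hT⟩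
  obtain ⟨e₁⟩ := (hT'.map (proj₁ D₁)).iso_of_isZero₁ (isZero_proj₁ D₁ hK)
  obtain ⟨e₂⟩ := (hT'.map (proj₂ D₁)).iso_of_isZero₃ (isZero_proj₂ D₁ hL)
  obtain ⟨e₃⟩ := nonempty_iso_proj₁ D₁ ⟨L, hL⟩
  obtain ⟨e₄⟩ := nonempty_iso_proj₂ D₁ ⟨K, hK⟩
  exact hT'.iso ((orth D₁).ι.mapIso (e₄.symm ≪≫ e₂)) (Iso.refl E)
    (D₁.ι.mapIso (e₃.symm ≪≫ e₁.symm))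

variable {D₁} {Λ₁ Λ₂ : Type*} [AddCommGroup Λ₁] [AddCommGroup Λ₂]
  (v₁ : K0 D₁.FullSubcategory →+ Λ₁) (v₂ : K0 (orth D₁).FullSubcategory →+ Λ₂)
  (Z : Λ₁ × Λ₂ →+ ℂ)

lemma sumClass_of (E : D) : sumClass v₁ v₂ (K0.of E) =
    (v₁ (K0.of ((proj₁ D₁).obj E)), v₂ (K0.of ((proj₂ D₁).obj E))) := by
  exact Prod.ext (congrArg v₁ (K0.lift_of _ _ E)) (congrArg v₂ (K0.lift_of _ _ E))

lemma sumClass_of_left (E : D₁.FullSubcategory) :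
    sumClass v₁ v₂ (K0.of E.obj) = (v₁ (K0.of E), 0) := by
  obtain ⟨e⟩ := nonempty_iso_proj₁ D₁ E
  rw [sumClass_of, K0.of_iso e, K0.of_isZero (isZero_proj₂ D₁ E.property), map_zero]

lemma sumClass_of_right (E : (orth D₁).FullSubcategory) :
    sumClass v₁ v₂ (K0.of E.obj) = (0, v₂ (K0.of E)) := by
  obtain ⟨e⟩ := nonempty_iso_proj₂ D₁ E
  rw [sumClass_of, K0.of_iso e, K0.of_isZero (isZero_proj₁ D₁ E.property), map_zero]

lemma res₁_charge (E : D₁.FullSubcategory) :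
    (res₁ Z).comp v₁ (K0.of E) = Z.comp (sumClass v₁ v₂) (K0.of E.obj) := by
  rw [AddMonoidHom.comp_apply, AddMonoidHom.comp_apply, sumClass_of_left]
  rfl

lemma res₂_charge (E : (orth D₁).FullSubcategory) :
    (res₂ Z).comp v₂ (K0.of E) = Z.comp (sumClass v₁ v₂) (K0.of E.obj) := by
  rw [AddMonoidHom.comp_apply, AddMonoidHom.comp_apply, sumClass_of_right]
  rfl

variable {v₁ v₂ Z} {P : ℝ → ObjectProperty D} {P₁ : ℝ → ObjectProperty D₁.FullSubcategory}
  {P₂ : ℝ → ObjectProperty (orth D₁).FullSubcategory}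

/-- Phases in `(δ,1]` lie in the heart of `D₁`, those in `(1,δ+1]` in its shift. Only the inclusion
of hearts is used, not compatibility of individual phases. -/
lemma filt_Ioc_zero_two [IsTriangulated D] (hP : IsSlicing P) (hP₁ : IsSlicing P₁) {δ : ℝ}
    (hδ₀ : 0 ≤ δ) (hδ₁ : δ ≤ 1)
    (h : ∀ E, Filt P₁ (Set.Ioc 0 1) E → Filt P (Set.Ioc 0 1) E.obj) {E : D₁.FullSubcategory}
    (hE : Filt P₁ (Set.Ioc δ (δ + 1)) E) : Filt P (Set.Ioc 0 2) E.obj := by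
  obtain ⟨E', E'', hT, hE', hE''⟩ := hE.truncate 1
  refine hP.filt_of_tri Set.ordConnected_Ioc (hT.map D₁.ι) ?_ ?_
  · have h1 := hP₁.filt_shift (S' := Set.Ioc 0 1) (-1) hE' fun s hs => by
      have := Set.mem_Ioi.1 hs.2
      push_cast
      exact ⟨by linarith, by linarith [hs.1.2]⟩
    have h2 := hP.filt_shift (S' := Set.Ioc 0 2) 1 (h _ h1) fun s hs => by
      push_cast
      exact ⟨by linarith [hs.1], by linarith [hs.2]⟩
    refine h2.iso ?_
    exact (((shiftFunctor D (1 : ℤ)).mapIso ((D₁.ι.commShiftIso (-1 : ℤ)).app E')) ≪≫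
      (shiftFunctorCompIsoId D (-1 : ℤ) 1 (by norm_num)).app E'.obj)
  · refine (h _ (hE''.mono fun x hx => ⟨?_, hx.2⟩)).mono (Set.Ioc_subset_Ioc_right (by norm_num))
    linarith [hx.1.1]

/-- Gluing at `δ` forces the slicing of `D₁` to be compatible with that of `D`. -/
lemma mem_of_glue [IsTriangulated D] (hP : IsSlicing P) (hP₁ : IsSlicing P₁) (hP₂ : IsSlicing P₂)
    (hW : PreStab (Z.comp (sumClass v₁ v₂)) P) (hW₁ : PreStab ((res₁ Z).comp v₁) P₁)
    (hW₂ : PreStab ((res₂ Z).comp v₂) P₂) {δ : ℝ} (hδ₀ : 0 < δ) (hδ₁ : δ < 1)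
    (h₁ : ∀ E, Filt P₁ (Set.Ioc 0 1) E → Filt P (Set.Ioc 0 1) E.obj)
    (h₂ : ∀ φ E, P₂ φ E → P φ E.obj)
    (hH : IsBoundedHeart (glue D₁ (Filt P₁ (Set.Ioc δ (δ + 1))) (Filt P₂ (Set.Ioc δ (δ + 1)))))
    {φ : ℝ} {E : D₁.FullSubcategory} (hE : P₁ φ E) : P φ E.obj := by
  -- By the decomposition triangle, objects of the glued heart have phases in `(0,2]`, and their
  -- charge is a sum of charges in the half plane of `(δ,δ+1]`.
  have hglue : glue D₁ (Filt P₁ (Set.Ioc δ (δ + 1))) (Filt P₂ (Set.Ioc δ (δ + 1))) =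
      Filt P (Set.Ioc δ (δ + 1)) := by
    obtain ⟨t, ht, hH⟩ := hH
    rw [← hH]
    refine hP.heart_eq ht hW hδ₀ hδ₁ (fun X hX => ?_) fun X hX hX₀ => ?_
    · rw [hH] at hX
      refine hP.filt_of_tri Set.ordConnected_Ioc (tri_proj D₁ X) ?_
        (filt_Ioc_zero_two hP hP₁ hδ₀.le hδ₁.le h₁ hX.1)
      exact (hX.2.map (orth D₁).ι fun φ _ Y hY => h₂ φ Y hY).mono
        (Set.Ioc_subset_Ioc hδ₀.le (by linarith))
    · rw [hH] at hX
      have hk : Z.comp (sumClass v₁ v₂) (K0.of X) = (res₂ Z).comp v₂ (K0.of ((proj₂ D₁).obj X)) +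
          (res₁ Z).comp v₁ (K0.of ((proj₁ D₁).obj X)) := by
        rw [res₁_charge v₁ v₂, res₂_charge v₁ v₂, ← map_add, ← (tri_proj D₁ X).k0]
      rw [hk, add_mul]
      by_cases h1 : IsZero ((proj₁ D₁).obj X)
      · by_cases h2 : IsZero ((proj₂ D₁).obj X)
        · exact (hX₀ ((tri_proj D₁ X).isZero₂ ((isZero_fullSubcategory_iff _).1 h2)
            ((isZero_fullSubcategory_iff _).1 h1))).elim
        · rw [K0.of_isZero h1, map_zero, zero_mul, add_zero]
          exact hW₂.rotate_mem hX.2 h2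
      · by_cases h2 : IsZero ((proj₂ D₁).obj X)
        · rw [K0.of_isZero h2, map_zero, zero_mul, zero_add]
          exact hW₁.rotate_mem hX.1 h1
        · exact upperHalf_add (hW₂.rotate_mem hX.2 h2) (hW₁.rotate_mem hX.1 h1)
  have hglue' : ∀ X, Filt P (Set.Ioc δ (δ + 1)) X ↔
      Filt P₁ (Set.Ioc δ (δ + 1)) ((proj₁ D₁).obj X) ∧
      Filt P₂ (Set.Ioc δ (δ + 1)) ((proj₂ D₁).obj X) := fun X => by rw [← hglue]; rfl
  have key : ∀ φ ∈ Set.Ioc δ (δ + 1), ∀ E, P₁ φ E → P φ E.obj := by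
    intro φ hφ E hE
    obtain ⟨e⟩ := nonempty_iso_proj₁ D₁ E
    have hE₂ := isZero_proj₂ D₁ E.property
    have hEδ : Filt P (Set.Ioc δ (δ + 1)) E.obj :=
      (hglue' _).2 ⟨.single (hP₁.iso_mem φ e.symm hE) hφ, .zero _ _ hE₂⟩
    obtain ⟨F, Q, hT, hF, hQ⟩ := hEδ.truncate φ
    have hF' := (hglue' _).1 (hF.mono Set.inter_subset_left)
    have hQ' := (hglue' _).1 (hQ.mono Set.inter_subset_left)
    -- The `D₂`-component of `E` is zero, so that of `F` is the shift by `-1` of that of `Q`. The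
    -- former has phases `> δ`, the latter phases `≤ δ`.
    have hF₂ : IsZero ((proj₂ D₁).obj F) := by
      refine (hT.map (proj₂ D₁)).isZero₁_of_homZero (homZero_of_isZero_right _ hE₂) ?_
      refine hP₂.homZero_of_filt hF'.2 (hP₂.filt_shift (S' := Set.Iic δ) (-1) hQ'.2 fun s hs => ?_)
        fun s hs s' hs' => (Set.mem_Iic.1 hs').trans_lt hs.1
      push_cast
      exact Set.mem_Iic.2 (by linarith [hs.2])
    obtain ⟨eF⟩ := (tri_proj D₁ F).iso_of_isZero₁ ((isZero_fullSubcategory_iff _).1 hF₂)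
    -- `F` now comes from `D₁`. Its `P₁`-phases lie in `(δ,φ]` and its `P`-phases in `(φ,δ+1]`, so
    -- its charge would lie in opposite half planes.
    have hF₀ : IsZero F := by
      by_contra hF₀
      have hF₁ : ¬ IsZero ((proj₁ D₁).obj F) := fun h =>
        hF₀ (((isZero_fullSubcategory_iff _).1 h).of_iso eF)
      have h3 : Filt P₁ (Set.Iic φ) ((proj₁ D₁).obj F) := by
        refine hP₁.filt_of_tri Set.ordConnected_Iic (hT.map (proj₁ D₁)).invRot
          (hP₁.filt_shift (-1) hQ'.1 fun s hs => ?_)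
          (.single (hP₁.iso_mem φ e.symm hE) Set.self_mem_Iic)
        push_cast
        exact Set.mem_Iic.2 (by linarith [hs.2, hφ.1])
      have h4 := hW₁.neg_rotate_mem (hP₁.filt_Ioc (a := φ - 1) (hF'.1.mono fun x hx =>
        Set.mem_Ioi.2 (by linarith [hx.1, hφ.2])) h3) hF₁
      have h5 := hW.rotate_mem (φ := φ) (hF.mono fun x hx =>
        ⟨hx.2, by linarith [hx.1.2, hφ.1]⟩) hF₀
      rw [res₁_charge v₁ v₂, ← K0.of_iso eF] at h4
      exact neg_notMem_upperHalf h5 h4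
    obtain ⟨eE⟩ := hT.iso_of_isZero₁ hF₀
    refine hW.mem_of_im_eq_zero hP ((hQ.iso eE.symm).mono fun x hx =>
      ⟨by linarith [hx.1.1, hφ.2], hx.2⟩) ?_
    by_cases hE₀ : IsZero E
    · rw [← res₁_charge v₁ v₂, K0.of_isZero hE₀]
      simp
    · obtain ⟨m, hm, hm'⟩ := hW₁ φ E hE hE₀
      rw [← res₁_charge v₁ v₂, hm']
      exact im_rotate_polar m φ
  -- Any phase is moved into `(δ,δ+1]` by a shift.
  obtain ⟨ψ, hψ, n, hn⟩ := exists_eq_add_int (φ - δ)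
  have hφ : φ = (δ + ψ) + n := by linarith
  have h3 : P₁ (δ + ψ) (E⟦-n⟧) := by
    have := (hP₁.shift_int_iff φ (-n) E).2 hE
    rwa [hφ, Int.cast_neg, add_neg_cancel_right] at this
  have h4 := key _ ⟨by linarith [hψ.1], by linarith [hψ.2]⟩ _ h3
  have h5 := hP.iso_mem _ ((D₁.ι.commShiftIso (-n)).app E) h4
  rw [← hP.shift_int_iff φ (-n), hφ, Int.cast_neg, add_neg_cancel_right]
  exact h5

end Semiorthogonal

/-! ### Comparison of `A(ε,δ)` with intervals of phases -/

section Slicing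

variable {C : Type u} [Category.{v} C] [Preadditive C] [HasZeroObject C] [HasShift C ℤ]
  [∀ n : ℤ, (shiftFunctor C n).Additive] [Pretriangulated C]

lemma Slicing.interval_eq (P : Slicing C) (I : Set ℝ) : P.interval I = Filt P.obj I :=
  funext fun E => propext (P.interval_iff I E)

lemma K0.of_shift (X : C) (n : ℤ) : K0.of (X⟦n⟧) = K0.of X ∨ K0.of (X⟦n⟧) = -K0.of X := by
  induction n using Int.induction_on with
  | zero => exact Or.inl (K0.of_iso ((shiftFunctorZero C ℤ).app X))
  | succ n ih =>
    have h : K0.of (X⟦(n : ℤ) + 1⟧) = -K0.of (X⟦(n : ℤ)⟧) := by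
      rw [← K0.of_shift_one]
      exact K0.of_iso ((shiftFunctorAdd C (n : ℤ) 1).app X)
    rw [h, neg_inj, neg_eq_iff_eq_neg]
    exact ih.symm
  | pred n ih =>
    have h : K0.of (X⟦-(n : ℤ)⟧) = -K0.of (X⟦-(n : ℤ) - 1⟧) := by
      rw [← K0.of_shift_one]
      exact K0.of_iso ((shiftFunctorAdd' C (-(n : ℤ) - 1) 1 (-n) (by ring)).app X)
    rw [h, neg_inj, neg_eq_iff_eq_neg] at ih
    exact ih.symm

lemma LatticeNorm.norm_neg {Λ : Type*} [AddCommGroup Λ] (N : LatticeNorm Λ) (x : Λ) :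
    N.norm (-x) = N.norm x := by
  rw [LatticeNorm.norm, TensorProduct.tmul_neg]
  exact map_neg_eq_map N.toSeminorm _

lemma Slicing.ext_obj {P P' : Slicing C} (h : P.obj = P'.obj) : P = P' := by
  cases P
  cases P'
  congr

lemma IsSlicing.isBoundedHeart_zero [IsTriangulated C] {P : ℝ → ObjectProperty C}
    (hP : IsSlicing P) : IsBoundedHeart (Filt P (Set.Ioc 0 1)) := by
  have := hP.isBoundedHeart 0
  rwa [zero_add] at this

/-- A slicing is determined by its phases in `(0,1]`. -/
lemma IsSlicing.le_of_le {P P' : ℝ → ObjectProperty C} (hP : IsSlicing P) (hP' : IsSlicing P')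
    (h : ∀ φ ∈ Set.Ioc (0 : ℝ) 1, P φ ≤ P' φ) (φ : ℝ) : P φ ≤ P' φ := by
  intro E hE
  obtain ⟨ψ, hψ, n, rfl⟩ := exists_eq_add_int φ
  have key : ψ + n + ((-n : ℤ) : ℝ) = ψ := by push_cast; ring
  rw [← hP'.shift_int_iff _ (-n), key]
  refine h ψ hψ _ ?_
  have := (hP.shift_int_iff _ (-n) E).2 hE
  rwa [key] at this

variable {Λ : Type*} [AddCommGroup Λ] {v : K0 C →+ Λ} {Z : Λ →+ ℂ}

lemma IsSlicing.mem_iff_semistableIn [IsTriangulated C] {P : ℝ → ObjectProperty C}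
    (hP : IsSlicing P) (hW : PreStab (Z.comp v) P) {φ : ℝ} (hφ : φ ∈ Set.Ioc (0 : ℝ) 1) (E : C) :
    P φ E ↔ IsZero E ∨ (SemistableIn v Z (Filt P (Set.Ioc 0 1)) E ∧
      phase (Z (v (K0.of E))) = φ) := by
  rw [semistableIn_iff v Z hP.isBoundedHeart_zero]
  by_cases hE : IsZero E
  · exact ⟨fun _ => Or.inl hE, fun _ => hP.zero_mem φ hE⟩
  · have := mem_iff_semistableTri hP hW hφ E
    exact ⟨fun h => Or.inr (this.1 ⟨h, hE⟩), fun h => (this.2 (h.resolve_left hE)).1⟩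

lemma IsSlicing.mem_of_semistableIn [IsTriangulated C] {P : ℝ → ObjectProperty C}
    (hP : IsSlicing P) (hW : PreStab (Z.comp v) P) {E : C}
    (h : SemistableIn v Z (Filt P (Set.Ioc 0 1)) E) : P (phase (Z (v (K0.of E)))) E := by
  have h' := (semistableIn_iff v Z hP.isBoundedHeart_zero E).1 h
  exact (hP.mem_iff_semistableIn hW (hW.phase_mem h'.1 le_rfl le_rfl h'.2.1).2 E).2 (Or.inr ⟨h, rfl⟩)

/-- The generators have phases in `(δ-ε,1]` and `(1,1+δ+ε)`, and subcategories of phases in an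
interval are closed under extensions. -/
lemma tiltRange_le [IsTriangulated C] {P : ℝ → ObjectProperty C}
    (hP : IsSlicing P) (hW : PreStab (Z.comp v) P) {ε δ : ℝ} (hε : 0 < ε) (hεδ : ε < δ)
    (hδ : δ < 1) :
    tiltRange v Z (Filt P (Set.Ioc 0 1)) ε δ ≤ Filt P (Set.Ioo (δ - ε) (1 + δ + ε)) := by
  intro E hE
  induction hE with
  | zero X hX => exact .zero _ _ hX
  | of X hX =>
    rcases hX with ⟨hX, hφ⟩ | ⟨hX, hφ⟩
    · exact .single (hP.mem_of_semistableIn hW hX) ⟨hφ.1, by linarith [hφ.2]⟩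
    · have h := (hP.shift_iff _ _).2 (hP.mem_of_semistableIn hW hX)
      refine .single (hP.iso_mem _ ((shiftFunctorCompIsoId C (-1 : ℤ) 1 (by norm_num)).app X) h)
        ⟨by linarith [hφ.1], by linarith [hφ.2]⟩
  | ext T hT _ _ h₁ h₃ => exact hP.filt_of_tri Set.ordConnected_Ioo (.of_mem T hT) h₁ h₃

/-- The bounds `0 < φ ≤ 2` are needed beyond those of `ε` and `δ`: a factor must lie in the heart or
in its first shift to be a generator. -/
lemma le_tiltRange [IsTriangulated C] {P : ℝ → ObjectProperty C}
    (hP : IsSlicing P) (hW : PreStab (Z.comp v) P) {ε δ : ℝ} {S : Set ℝ}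
    (hS : ∀ φ ∈ S, 0 < φ ∧ δ - ε < φ ∧ φ - 1 < δ + ε ∧ φ ≤ 2) :
    Filt P S ≤ tiltRange v Z (Filt P (Set.Ioc 0 1)) ε δ := by
  intro E hE
  induction hE with
  | zero S E hE => exact .zero _ hE
  | step S φ E₀ E A hT hA hφ h₀ ih =>
    obtain ⟨f, g, h, hT⟩ := hT
    refine ExtClosure.ext _ hT (ih fun ψ hψ => hS ψ hψ.1) ?_
    change tiltRange v Z _ ε δ A
    obtain ⟨h₁, h₂, h₃, h₄⟩ := hS φ hφ
    by_cases hA₀ : IsZero A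
    · exact .zero _ hA₀
    rcases le_or_gt φ 1 with hle | hlt
    · obtain ⟨hs, hs'⟩ := ((hP.mem_iff_semistableIn hW ⟨h₁, hle⟩ A).1 hA).resolve_left hA₀
      exact .of _ (Or.inl ⟨hs, by rw [hs']; exact ⟨h₂, hle⟩⟩)
    · have hA' := (hP.shift_int_iff φ (-1) A).2 hA
      have hφ' : φ + ((-1 : ℤ) : ℝ) ∈ Set.Ioc (0 : ℝ) 1 := by
        push_cast
        exact ⟨by linarith, by linarith⟩
      obtain ⟨hs, hs'⟩ := ((hP.mem_iff_semistableIn hW hφ' _).1 hA').resolve_left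
        fun h => hA₀ ((isZero_shift_iff A (-1)).1 h)
      refine .of _ (Or.inr ⟨hs, ?_⟩)
      rw [hs']
      push_cast
      exact ⟨by linarith, by linarith⟩

end Slicing

/-! ### Passing between relative stability conditions and hearts -/

section Relative

variable {D : Type u} [Category.{v} D] [Preadditive D] [HasZeroObject D] [HasShift D ℤ]
  [∀ n : ℤ, (shiftFunctor D n).Additive] [Pretriangulated D] [IsTriangulated D]
  {D₁ : ObjectProperty D} [D₁.IsTriangulated] [LeftAdmissible D₁]

lemma HeartsGlue.mono {R₁ R₁' : ObjectProperty D₁.FullSubcategory}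
    {R₂ R₂' : ObjectProperty (orth D₁).FullSubcategory} (h : HeartsGlue D₁ R₁ R₂) (h₁ : R₁' ≤ R₁)
    (h₂ : R₂' ≤ R₂) : HeartsGlue D₁ R₁' R₂' :=
  fun B₁ B₂ hB₁ hB₂ hR₁ hR₂ => h B₁ B₂ hB₁ hB₂ (hR₁.trans h₁) (hR₂.trans h₂)

variable {Λ₁ Λ₂ : Type*} [AddCommGroup Λ₁] [AddCommGroup Λ₂]
  {v₁ : K0 D₁.FullSubcategory →+ Λ₁} {v₂ : K0 (orth D₁).FullSubcategory →+ Λ₂}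
  {N : LatticeNorm (Λ₁ × Λ₂)} {N₂ : LatticeNorm Λ₂} {Z : Λ₁ × Λ₂ →+ ℂ}

lemma IsRelStability.preStab {P₁ : Slicing D₁.FullSubcategory}
    (h : IsRelStability v₁ v₂ N N₂ Z P₁) : PreStab ((res₁ Z).comp v₁) P₁.obj := by
  obtain ⟨P, P₂, ⟨hP, -⟩, h₁, -⟩ := h
  intro φ E hE hE₀
  rw [res₁_charge v₁ v₂]
  exact hP φ _ (h₁ φ E hE) fun h => hE₀ ((isZero_fullSubcategory_iff _).2 h)

lemma IsRelStability.mem_iff {P₁ : Slicing D₁.FullSubcategory}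
    (h : IsRelStability v₁ v₂ N N₂ Z P₁) {φ : ℝ} (hφ : φ ∈ Set.Ioc (0 : ℝ) 1)
    (E : D₁.FullSubcategory) : P₁.obj φ E ↔ IsZero E ∨
      (SemistableIn v₁ (res₁ Z) (P₁.interval (Set.Ioc 0 1)) E ∧
        phase (res₁ Z (v₁ (K0.of E))) = φ) := by
  rw [P₁.interval_eq]
  exact P₁.isSlicing.mem_iff_semistableIn h.preStab hφ E

lemma IsRelStability.isHeartDatum {P₁ : Slicing D₁.FullSubcategory}
    (h : IsRelStability v₁ v₂ N N₂ Z P₁) :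
    IsHeartDatum v₁ v₂ N Z (P₁.interval (Set.Ioc 0 1)) := by
  have hW₁ := h.preStab
  obtain ⟨P, P₂, ⟨hW, c, hc₀, hc⟩, h₁, h₂, ⟨hW₂, -⟩, ε, δ, hε, hεδ, hδ, hglue⟩ := h
  have hW : PreStab (Z.comp (sumClass v₁ v₂)) P.obj := hW
  have hW₂ : PreStab ((res₂ Z).comp v₂) P₂.obj := hW₂
  have hP := P.isSlicing
  have hP₁ := P₁.isSlicing
  have hP₂ := P₂.isSlicing
  rw [P₁.interval_eq] at hglue ⊢
  rw [P₂.interval_eq] at hglue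
  -- Since `P₂` is the restriction of `P`, an object of `D₂` with `P`-phases in `(0,1]` passes the
  -- Hom-vanishing test against `P₂`.
  have hA₂ : ObjectProperty.inverseImage (Filt P.obj (Set.Ioc 0 1)) (orth D₁).ι =
      Filt P₂.obj (Set.Ioc 0 1) := by
    ext E
    refine ⟨fun h => ?_, fun h => h.map (orth D₁).ι fun φ _ X hX => (h₂ φ X).1 hX⟩
    have h : Filt P.obj (Set.Ioc 0 1) E.obj := h
    refine hP₂.filt_of_vanish_of_filt Set.ordConnected_Ioc (fun φ X hX hφ f => ?_)
      fun φ Y hY hφ f => ?_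
    · ext
      exact hP.homZero_of_filt_right h ((h₂ φ X).1 hX) hφ f.hom
    · ext
      exact hP.homZero_of_filt_left h ((h₂ φ Y).1 hY) hφ f.hom
  refine ⟨hP₁.isBoundedHeart_zero, Filt P.obj (Set.Ioc 0 1), hP.isBoundedHeart_zero,
    fun E hE => hE.map D₁.ι fun φ _ X hX => h₁ φ X hX, fun E hE => ?_,
    hasHN_of_isSlicing hP hW hP.isBoundedHeart_zero rfl,
    ⟨c, hc₀, fun E hE hE₀ => hc E ⟨_, hP.mem_of_semistableIn hW hE⟩ hE₀⟩, ?_, ?_, ε, δ, hε, hεδ,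
    hδ, ?_⟩
  · exact (hW.phase_mem E.property le_rfl le_rfl
      fun h => hE ((isZero_fullSubcategory_iff _).2 h)).1
  · rw [hA₂]
    exact hP₂.isBoundedHeart_zero
  · rw [hA₂]
    intro E hE
    have h3 := (semistableIn_iff v₂ (res₂ Z) hP₂.isBoundedHeart_zero E).1 hE
    have h4 := (h₂ _ E).1 (hP₂.mem_of_semistableIn hW₂ hE)
    have h5 := (hW₂.phase_mem h3.1 le_rfl le_rfl h3.2.1).2
    exact (((hP.mem_iff_semistableIn hW h5 E.obj).1 h4).resolve_left
      fun h => h3.2.1 ((isZero_fullSubcategory_iff _).2 h)).1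
  · rw [hA₂]
    exact hglue.mono (tiltRange_le hP₁ hW₁ hε hεδ hδ) (tiltRange_le hP₂ hW₂ hε hεδ hδ)

lemma filt_heartSlicing_iff {C : Type u} [Category.{v} C] [Preadditive C] [HasZeroObject C]
    [HasShift C ℤ] [∀ n : ℤ, (shiftFunctor C n).Additive] [Pretriangulated C] (t : TStructure C)
    {W : K0 C →+ ℂ} (hF : ∀ E, t.heart E → Filt (heartSlicing W t.heart) (Set.Ioc 0 1) E) :
    Filt (heartSlicing W t.heart) (Set.Ioc 0 1) = t.heart :=
  funext fun E => propext ⟨heart_of_filt_heartSlicing t le_rfl, hF E⟩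

/-- The restriction of a support property to the heart of a subcategory produces a slicing. -/
lemma isSlicing_heartSlicing_of_functor {C : Type u} [Category.{v} C] [Preadditive C]
    [HasZeroObject C] [HasShift C ℤ] [∀ n : ℤ, (shiftFunctor C n).Additive] [Pretriangulated C]
    [IsTriangulated C] (F : C ⥤ D) [F.CommShift ℤ] [F.IsTriangulated]
    (hF₀ : ∀ X, IsZero (F.obj X) → IsZero X) {Λ : Type*} [AddCommGroup Λ]
    [Module.Free ℤ Λ] [Module.Finite ℤ Λ] {N : LatticeNorm Λ} {v : K0 D →+ Λ} {Z : Λ →+ ℂ}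
    {P : ℝ → ObjectProperty D} (hP : IsSlicing P) (hW : PreStab (Z.comp v) P) {c : ℝ}
    (hc : ∀ φ E, P φ E → ¬ IsZero E → N.norm (v (K0.of E)) ≤ c * ‖Z (v (K0.of E))‖) (hc₀ : 0 ≤ c)
    {W' : K0 C →+ ℂ} (hW' : ∀ X, W' (K0.of X) = Z.comp v (K0.of (F.obj X))) (t : TStructure C)
    (ht : ∀ X, t.bounded X) (hA : ∀ X, t.heart X → Filt P (Set.Ioc 0 1) (F.obj X)) :
    IsSlicing (heartSlicing W' t.heart) ∧ PreStab W' (heartSlicing W' t.heart) ∧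
      Filt (heartSlicing W' t.heart) (Set.Ioc 0 1) = t.heart := by
  have hWt : ∀ E, t.heart E → ¬ IsZero E → W' (K0.of E) ∈ upperHalf := fun E hE hE₀ => by
    rw [hW']
    exact (hW.phase_mem (hA E hE) le_rfl le_rfl fun h => hE₀ (hF₀ E h)).1
  have hfilt := filt_heartSlicing_of_finite t hWt fun E hE =>
    finite_destabilizing_map F hF₀ hW' hA (finite_destabilizing hP hW hc hc₀ (hA E hE))
  exact ⟨isSlicing_heartSlicing t ht hWt hfilt, preStab_heartSlicing hWt,
    filt_heartSlicing_iff t hfilt⟩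

/-- All three slicings are built from hearts. For `P` the Harder–Narasimhan property is assumed; for
`P₁` and `P₂` it comes from the support property on `D`. Gluing is used at `δ` to prove `P₁ φ ⊆ P
φ`. -/
lemma IsHeartDatum.exists_slicing [Module.Free ℤ Λ₁] [Module.Finite ℤ Λ₁] [Module.Free ℤ Λ₂]
    [Module.Finite ℤ Λ₂] {A₁ : ObjectProperty D₁.FullSubcategory}
    (h : IsHeartDatum v₁ v₂ N Z A₁) :
    ∃ P₁ : Slicing D₁.FullSubcategory, IsRelStability v₁ v₂ N N₂ Z P₁ ∧
      P₁.interval (Set.Ioc 0 1) = A₁ := by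
  obtain ⟨⟨t₁, ht₁, rfl⟩, A, ⟨t, ht, rfl⟩, hA₁, hWA, hHN, ⟨c, hc₀, hc⟩, ⟨t₂, ht₂, hA₂⟩, hss, ε, δ,
    hε, hεδ, hδ, hglue⟩ := h
  set W := Z.comp (sumClass v₁ v₂) with hWdef
  have hheart : IsBoundedHeart t.heart := ⟨t, ht, rfl⟩
  have hWt : ∀ E, t.heart E → ¬ IsZero E → W (K0.of E) ∈ upperHalf := fun E hE hE₀ =>
    hWA ⟨E, hE⟩ fun h => hE₀ ((isZero_fullSubcategory_iff _).1 h)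
  have hfilt : ∀ E, t.heart E → Filt (heartSlicing W t.heart) (Set.Ioc 0 1) E := by
    intro E hE
    by_cases hE₀ : IsZero E
    · exact .zero _ _ hE₀
    · obtain ⟨F⟩ := hHN ⟨E, hE⟩ fun h => hE₀ ((isZero_fullSubcategory_iff _).1 h)
      exact F.filt_heartSlicing t hWA hheart
  have hP := isSlicing_heartSlicing t ht hWt hfilt
  have hW : PreStab W (heartSlicing W t.heart) := preStab_heartSlicing hWt
  have hPA := filt_heartSlicing_iff t hfilt
  set P := heartSlicing W t.heart with hPdef
  have hmem : ∀ φ ∈ Set.Ioc (0 : ℝ) 1, ∀ E, P φ E ↔ IsZero E ∨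
      (SemistableIn (sumClass v₁ v₂) Z t.heart E ∧ phase (W (K0.of E)) = φ) := fun φ hφ E => by
    rw [semistableIn_iff _ _ hheart]
    exact heartSlicing_iff hφ E
  -- Every object of `P φ` is a shift of a semistable object of the heart or zero; shifting changes
  -- its class only by a sign.
  have hsupp : ∀ φ E, P φ E → ¬ IsZero E → N.norm (sumClass v₁ v₂ (K0.of E)) ≤
      c * ‖Z (sumClass v₁ v₂ (K0.of E))‖ := by
    intro φ E hE hE₀
    obtain ⟨ψ, hψ, n, rfl⟩ := exists_eq_add_int φ
    have h1 := ((heartSlicing_add_int_iff hψ n E).1 hE).resolve_left hE₀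
    have h2 := hc _ ((semistableIn_iff _ _ hheart _).2 h1.1) h1.1.2.1
    rcases K0.of_shift E (-n) with h3 | h3
    · rwa [h3] at h2
    · rwa [h3, map_neg, map_neg, N.norm_neg, norm_neg] at h2
  have hz₁ : ∀ X : D₁.FullSubcategory, IsZero (D₁.ι.obj X) → IsZero X := fun X h =>
    (isZero_fullSubcategory_iff X).2 h
  have hz₂ : ∀ X : (orth D₁).FullSubcategory, IsZero ((orth D₁).ι.obj X) → IsZero X := fun X h =>
    (isZero_fullSubcategory_iff X).2 h
  obtain ⟨hP₁, hW₁, hPA₁⟩ := isSlicing_heartSlicing_of_functor D₁.ι hz₁ hP hW hsupp hc₀.le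
    (res₁_charge v₁ v₂ Z) t₁ ht₁ fun X hX => by rw [hPA]; exact hA₁ X hX
  have hA₂' : ∀ X, t₂.heart X ↔ t.heart X.obj := fun X => by rw [hA₂]; rfl
  obtain ⟨hP₂, hW₂, hPA₂⟩ := isSlicing_heartSlicing_of_functor (orth D₁).ι hz₂ hP hW hsupp hc₀.le
    (res₂_charge v₁ v₂ Z) t₂ ht₂ fun X hX => by rw [hPA]; exact (hA₂' X).1 hX
  rw [← hA₂] at hss hglue
  set P₁ := heartSlicing ((res₁ Z).comp v₁) t₁.heart with hP₁def
  set P₂ := heartSlicing ((res₂ Z).comp v₂) t₂.heart with hP₂def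
  -- Semistability in `A₂` implies semistability in `A` by assumption; the converse holds because a
  -- triangle in `A₂` is also one in `A`.
  have h₂ : ∀ φ ∈ Set.Ioc (0 : ℝ) 1, ∀ E, P₂ φ E ↔ P φ E.obj := by
    intro φ hφ E
    rw [hmem φ hφ, hP₂def, heartSlicing_iff hφ, isZero_fullSubcategory_iff, res₂_charge v₁ v₂]
    refine or_congr_right (and_congr_left fun _ => ⟨fun h => ?_, fun h => ?_⟩)
    · exact hss E ((semistableIn_iff v₂ (res₂ Z) ⟨t₂, ht₂, rfl⟩ E).2 h)
    · rw [semistableIn_iff _ _ hheart] at h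
      refine ⟨(hA₂' E).2 h.1, fun h0 => h.2.1 ((isZero_fullSubcategory_iff E).1 h0),
        fun F Q hF hQ hT hF₀ => ?_⟩
      rw [res₂_charge v₁ v₂, res₂_charge v₁ v₂]
      exact h.2.2 _ _ ((hA₂' F).1 hF) ((hA₂' Q).1 hQ) (hT.map (orth D₁).ι)
        fun h0 => hF₀ ((isZero_fullSubcategory_iff F).2 h0)
  have h₂' : ∀ φ E, P₂ φ E ↔ P φ E.obj := by
    intro φ E
    obtain ⟨ψ, hψ, n, rfl⟩ := exists_eq_add_int φ
    have key : ψ + n + ((-n : ℤ) : ℝ) = ψ := by push_cast; ring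
    have e := ((orth D₁).ι.commShiftIso (-n)).app E
    rw [← hP₂.shift_int_iff _ (-n), ← hP.shift_int_iff _ (-n), key, h₂ ψ hψ]
    exact ⟨hP.iso_mem ψ e, hP.iso_mem ψ e.symm⟩
  -- The hearts `Pᵢ((δ,δ+1])` lie in `Aᵢ(ε,δ)`, hence they glue.
  have hH := hglue _ _ (hP₁.isBoundedHeart δ) (hP₂.isBoundedHeart δ)
    (by
      rw [← hPA₁]
      exact le_tiltRange hP₁ hW₁ fun φ hφ => ⟨by linarith [hφ.1], by linarith [hφ.1],
        by linarith [hφ.2], by linarith [hφ.2]⟩)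
    (by
      rw [← hPA₂]
      exact le_tiltRange hP₂ hW₂ fun φ hφ => ⟨by linarith [hφ.1], by linarith [hφ.1],
        by linarith [hφ.2], by linarith [hφ.2]⟩)
  have h₁ : ∀ φ E, P₁ φ E → P φ E.obj := fun φ E hE =>
    mem_of_glue hP hP₁ hP₂ hW hW₁ hW₂ (hε.trans hεδ) hδ
      (fun E hE => by rw [hPA₁] at hE; rw [hPA]; exact hA₁ E hE) (fun φ E => (h₂' φ E).1) hH hE
  -- The support property on `D₂` uses an unrelated norm; comparing it with `N` along the projection
  -- `Λ ⟶ Λ₂` costs the factor `K`.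
  obtain ⟨K, hK, hKN⟩ := N.exists_comp_le N₂ (AddMonoidHom.snd Λ₁ Λ₂)
  -- Shrinking `ε` to at most `1 - δ` keeps the interval `(δ-ε,1+δ+ε)` inside `(0,2]`, as
  -- `le_tiltRange` requires.
  refine ⟨hP₁.toSlicing, ⟨hP.toSlicing, hP₂.toSlicing, ⟨hW, c, hc₀, ?_⟩, h₁, h₂', ⟨hW₂, K * c,
    mul_pos hK hc₀, ?_⟩, min ε (1 - δ), δ, lt_min hε (by linarith),
    (min_le_left _ _).trans_lt hεδ, hδ, ?_⟩, ?_⟩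
  · rintro E ⟨φ, hE⟩ hE₀
    exact hsupp φ E hE hE₀
  · rintro E ⟨φ, hE⟩ hE₀
    have h3 := hsupp φ _ ((h₂' φ E).1 hE) fun h => hE₀ (hz₂ E h)
    have h4 := hKN (sumClass v₁ v₂ (K0.of E.obj))
    have h5 : res₂ Z (v₂ (K0.of E)) = Z (sumClass v₁ v₂ (K0.of E.obj)) := res₂_charge v₁ v₂ Z E
    rw [h5, mul_assoc]
    refine le_trans ?_ (h4.trans (mul_le_mul_of_nonneg_left h3 hK.le))
    rw [sumClass_of_right]
    exact le_rfl
  · have hm : ∀ φ ∈ Set.Ioo (δ - min ε (1 - δ)) (1 + δ + min ε (1 - δ)),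
        0 < φ ∧ δ - ε < φ ∧ φ - 1 < δ + ε ∧ φ ≤ 2 := fun φ hφ => by
      have h3 := min_le_left ε (1 - δ)
      have h4 := min_le_right ε (1 - δ)
      exact ⟨by linarith [hφ.1], by linarith [hφ.1], by linarith [hφ.2], by linarith [hφ.2]⟩
    rw [Slicing.interval_eq, Slicing.interval_eq]
    refine hglue.mono ?_ ?_
    · have := le_tiltRange hP₁ hW₁ hm
      rwa [hPA₁] at this
    · have := le_tiltRange hP₂ hW₂ hm
      rwa [hPA₂] at this
  · rw [Slicing.interval_eq]
    exact hPA₁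

end Relative

end RelStab

theorem mainTheorem3 {D : Type u} [Category.{v} D] [Preadditive D] [HasZeroObject D]
    [HasShift D ℤ] [∀ n : ℤ, (shiftFunctor D n).Additive] [Pretriangulated D] [IsTriangulated D]
    (D₁ : ObjectProperty D) [D₁.IsTriangulated] [RelStab.LeftAdmissible D₁]
    {Λ₁ Λ₂ : Type*} [AddCommGroup Λ₁] [AddCommGroup Λ₂]
    [Module.Free ℤ Λ₁] [Module.Finite ℤ Λ₁] [Module.Free ℤ Λ₂] [Module.Finite ℤ Λ₂]
    (v₁ : RelStab.K0 D₁.FullSubcategory →+ Λ₁)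
    (v₂ : RelStab.K0 (RelStab.orth D₁).FullSubcategory →+ Λ₂)
    (hv₁ : Function.Surjective v₁) (hv₂ : Function.Surjective v₂)
    (N : RelStab.LatticeNorm (Λ₁ × Λ₂)) (N₂ : RelStab.LatticeNorm Λ₂) :
    Set.BijOn
      (fun p : (Λ₁ × Λ₂ →+ ℂ) × RelStab.Slicing D₁.FullSubcategory =>
        ((p.1, p.2.interval (Set.Ioc 0 1)) :
          (Λ₁ × Λ₂ →+ ℂ) × ObjectProperty D₁.FullSubcategory))
      {p | RelStab.IsRelStability v₁ v₂ N N₂ p.1 p.2}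
      {q | RelStab.IsHeartDatum v₁ v₂ N q.1 q.2} ∧
    ∀ (Z : Λ₁ × Λ₂ →+ ℂ) (P₁ : RelStab.Slicing D₁.FullSubcategory),
      RelStab.IsRelStability v₁ v₂ N N₂ Z P₁ →
      ∀ φ ∈ Set.Ioc (0 : ℝ) 1, ∀ E : D₁.FullSubcategory,
        P₁.obj φ E ↔ IsZero E ∨
          (RelStab.SemistableIn v₁ (RelStab.res₁ Z) (P₁.interval (Set.Ioc 0 1)) E ∧
            RelStab.phase (RelStab.res₁ Z (v₁ (RelStab.K0.of E))) = φ) := by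
  refine ⟨⟨fun p hp => hp.isHeartDatum, fun p hp q hq h => ?_, fun q hq => ?_⟩,
    fun Z P₁ h φ hφ E => h.mem_iff hφ E⟩
  · obtain ⟨Z, P₁⟩ := p
    obtain ⟨Z', P₁'⟩ := q
    obtain ⟨rfl, h⟩ := Prod.mk.inj h
    have hp : RelStab.IsRelStability v₁ v₂ N N₂ Z P₁ := hp
    have hq : RelStab.IsRelStability v₁ v₂ N N₂ Z P₁' := hq
    -- Membership in phases `(0,1]` depends only on `Z` and the heart, and the remaining phases
    -- follow by shifting.
    have hle : ∀ φ ∈ Set.Ioc (0 : ℝ) 1, ∀ E, P₁.obj φ E ↔ P₁'.obj φ E := fun φ hφ E => by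
      rw [hp.mem_iff hφ, hq.mem_iff hφ]
      rw [show P₁.interval (Set.Ioc 0 1) = P₁'.interval (Set.Ioc 0 1) from h]
    refine Prod.ext rfl (RelStab.Slicing.ext_obj (funext fun φ => le_antisymm ?_ ?_))
    · exact P₁.isSlicing.le_of_le P₁'.isSlicing (fun φ hφ E => (hle φ hφ E).1) φ
    · exact P₁'.isSlicing.le_of_le P₁.isSlicing (fun φ hφ E => (hle φ hφ E).2) φ
  · obtain ⟨P₁, h, h'⟩ := RelStab.IsHeartDatum.exists_slicing (N₂ := N₂) hq
    exact ⟨(q.1, P₁), h, Prod.ext rfl h'⟩
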